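/- **Proposition (automatic differentiation for linear Cauchy problems).** Let $N,M,d\ge1$, let $a_1,\dots,a_N\in\mathbb R$ with $a_N=1$, and let $b_\alpha\in\mathbb R$ ($\alpha\in\mathbb N^d$, $|\alpha|\le M$) with $b_\alpha\ne0$ for some $|\alpha|=M$. Let $p_1,\dots,p_N>0$ with $\sum_n p_n=1$, and let $f_1,\dots,f_N:\mathbb R^d\to\mathbb R$ and $F:\mathbb R_+\times\mathbb R^d\to\mathbb R$ be bounded and continuous. Consider the Cauchy problem $$\sum_{n=1}^N a_n\partial_t^n u-\sum_{|\alpha|\le M} b_\alpha D^\alpha u-F=0,\qquad \partial_t^{n-1}u(0,\cdot)=p_nf_n,\quad n=1,\dots,N. \tag{1}$$ Put $b(\xi)=\sum_\alpha i^{|\alpha|}b_\alpha\xi^\alpha$, let $B(\xi)$ be the $N\times N$ companion matrix with ones above the diagonal, last row $(b(\xi),-a_1,\dots,-a_{N-1})$ and zeros elsewhere, and let $\hat g(t,\xi)=(2\pi)^{-d/2}e^{tB(\xi)^{\rm T}}{\rm e}_1$. Let $T\in(0,\infty]$ and assume the following. 1. For all $t\in[0,T)$ and $n$, $\hat g_n(t,\cdot)$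 represents a tempered distribution. Let $g_n(t,\cdot)=\mathfrak F^{-1}\hat g_n(t,\cdot)$, where $\mathfrak F^{-1}\varphi(x)=(2\pi)^{-d/2}\int e^{i\xi\cdot x}\varphi(\xi)\,d\xi$ on Schwartz functions. 2. For all $n$ and $t\in[0,T)$, $g_n(t,\cdot)$ is a (finite) signed measure $g_n(t,dx)=\gamma_n(t,x)\,\mu_n(t,dx)$ with $\mu_n(t,\cdot)$ a probability measure and $\gamma_n(t,\cdot)$ bounded $\mu_n(t,\cdot)$-a.e.; for every bounded continuous $\phi$, $(t,x)\mapsto (g_n(t,\cdot)*\phi)(x)$ is continuous on $[0,T)\times\mathbb R^d$; and $\int_0^t\int|\gamma_N(s,x)|\,\mu_N(s,dx)\,ds<\infty$ for all $t\in[0,T)$. 3. For $n=N$, and for every other $n$ such that $f_n\not\equiv0$: for all $t\in(0,T)$ the distributional derivatives $\partial_{x_1}g_n(t,\cdot),\dots,\partial_{x_d}g_n(t,\cdot)$ are signed measures and $\partial_xg_n(t,dx)=\gamma^1_n(t,x)\,\mu^1_n(t,dx)$, with $\mu^1_n(t,\cdot)$ a probability measure and $\gamma_n^1(t,\cdot)$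 an $\mathbb R^d$-valued $\mu^1_n(t,\cdot)$-integrable function. Moreover $\int_0^t\int|\gamma^1_N(s,x)|\,\mu^1_N(s,dx)\,ds<\infty$ for all $t\in(0,T)$. (For the remaining $n$, $\mu^1_n(t,\cdot)$ is an arbitrary probability measure and $\gamma^1_n$ an arbitrary measurable function.) Let $\rho$ be a probability density on $[0,\infty)$, continuous there and positive on $(0,\infty)$, and $\bar\rho(t)=\int_t^\infty\rho(s)\,ds$. On a probability space let $\tau$ have density $\rho$, let $I$ be independent of $\tau$ with $\mathbb P[I=n]=p_n$, and let $Z^{1,n}=(Z^{1,n}_t)_t$, $n=1,\dots,N$, be random fields, jointly measurable with respect to a $\sigma$-algebra independent of $(\tau,I)$, with $Z^{1,n}_t$ distributed as $\mu^1_n(t,\cdot)$ for $0<t<T$. Then (1) has a unique solution $u$ among the functions that are continuous on $[0,T)\times\mathbb R^d$ and bounded on $[0,t]\times\mathbb R^d$ for all $t<T$. Here (1) is understood in the sense of tempered distributions in $x$: for every Schwartz function $\varphi$, the function $t\mapsto\langle u(t,\cdot),\varphi\rangle$ is $C^N$ on $[0,T)$ and satisfies the equation and the initial conditions obtained by pairing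 (1) with $\varphi$. For every $t\in(0,T)$, $u(t,\cdot)$ is differentiable on $\mathbb R^d$, and for every $x\in\mathbb R^d$ $$\partial_xu(t,x)=\mathbb E\Big[\mathbf 1_{\{\tau\ge t\}}\frac{\gamma^1_I(t,Z^{1,I}_t)}{\bar\rho(t)}\,f_I\big(x-Z^{1,I}_t\big)+\mathbf 1_{\{\tau<t\}}\frac{\gamma^1_N(\tau,Z^{1,N}_\tau)}{\rho(\tau)}\,F\big(t-\tau,x-Z^{1,N}_\tau\big)\Big],$$ where the random vector inside the expectation is integrable. -/

import Mathlib

open MeasureTheory ProbabilityTheory Set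
open scoped SchwartzMap LineDeriv FourierTransform BoundedContinuousFunction

namespace LinearCauchy

/-- Euclidean space `ℝ^d`. -/
abbrev Sp (d : ℕ) : Type := EuclideanSpace ℝ (Fin d)

/-- The half-open time interval `[0, T)`, for a horizon `T` that may be infinite. -/
def timeSet (T : EReal) : Set ℝ := {t | 0 ≤ t ∧ (t : EReal) < T}

/-- The open time interval `(0, T)`. -/
def openTimeSet (T : EReal) : Set ℝ := {t | 0 < t ∧ (t : EReal) < T}

/-! ### The differential operator and its fundamental solutions

The coefficients `a_1, …, a_N` are `a 1, …, a N` for a sequence `a : ℕ → ℝ`. The coefficients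
`b_α` are those of a polynomial `b` in `d` variables, so that `M` is the total degree of `b`.
An index `n : Fin N` stands for the index `n + 1` of the mathematical notation. -/

/-- The symbol `b(ξ) = ∑_α i^|α| b_α ξ^α`. -/
noncomputable def symbol {d : ℕ} (b : MvPolynomial (Fin d) ℝ) (ξ : Sp d) : ℂ :=
  ∑ α ∈ b.support, Complex.I ^ α.degree * ((b.coeff α : ℝ) : ℂ) * ∏ j, (ξ j : ℂ) ^ α j

/-- The companion matrix `B(ξ)`: ones above the diagonal, and last row
`(b(ξ), -a_1, …, -a_{N-1})`. -/
noncomputable def companion {d : ℕ} (N : ℕ) (a : ℕ → ℝ) (b : MvPolynomial (Fin d) ℝ) (ξ : Sp d) :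
    Matrix (Fin N) (Fin N) ℂ :=
  Matrix.of fun i j =>
    if (i : ℕ) + 1 = N then (if (j : ℕ) = 0 then symbol b ξ else -(a j : ℂ))
    else if (j : ℕ) = (i : ℕ) + 1 then 1 else 0

/-- `ĝ(t, ξ) = (2π)^(-d/2) e^{t B(ξ)ᵀ} e_1`. -/
noncomputable def ghat {d : ℕ} {N : ℕ} [NeZero N] (a : ℕ → ℝ) (b : MvPolynomial (Fin d) ℝ)
    (t : ℝ) (ξ : Sp d) : Fin N → ℂ :=
  (((2 * Real.pi) ^ (-(d : ℝ) / 2) : ℝ) : ℂ) •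
    (NormedSpace.exp ((t : ℂ) • (companion N a b ξ).transpose)).mulVec (Pi.single 0 1)

/-- The dilation `x ↦ x / (2π)`. -/
noncomputable def dilation (d : ℕ) : Sp d ≃L[ℝ] Sp d :=
  ContinuousLinearEquiv.smulLeft (Units.mk0 ((2 * Real.pi)⁻¹ : ℝ) (by positivity))

/-- The inverse Fourier transform `φ ↦ (2π)^(-d/2) ∫ e^{i ξ·x} φ(ξ) dξ` on Schwartz functions. -/
noncomputable def fourierInvS (d : ℕ) (φ : 𝓢(Sp d, ℂ)) : 𝓢(Sp d, ℂ) :=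
  (((2 * Real.pi) ^ (-(d : ℝ) / 2) : ℝ) : ℂ) •
    SchwartzMap.compCLMOfContinuousLinearEquiv ℂ (dilation d) (𝓕⁻ φ)

theorem fourierInvS_apply (d : ℕ) (φ : 𝓢(Sp d, ℂ)) (x : Sp d) :
    fourierInvS d φ x = (((2 * Real.pi) ^ (-(d : ℝ) / 2) : ℝ) : ℂ) *
      ∫ ξ, Complex.exp (Complex.I * (inner ℝ ξ x : ℝ)) * φ ξ := by
  have h : dilation d x = (2 * Real.pi)⁻¹ • x := rfl
  have hpi : (Real.pi : ℂ) ≠ 0 := by exact_mod_cast Real.pi_ne_zero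
  simp only [fourierInvS, smul_apply, smul_eq_mul,
    SchwartzMap.compCLMOfContinuousLinearEquiv_apply, Function.comp_apply, h,
    SchwartzMap.fourierInv_coe, Real.fourierInv_eq']
  congr 1
  refine integral_congr_ae (Filter.Eventually.of_forall fun ξ => ?_)
  simp only [inner_smul_right]
  congr 2
  push_cast
  field_simp

/-- The tempered distribution `G` is the distribution represented by the function `h`. -/
def RepresentsFunction {d : ℕ} (G : 𝓢'(Sp d, ℂ)) (h : Sp d → ℂ) : Prop :=
  ∀ φ : 𝓢(Sp d, ℂ), HasCompactSupport φ → G φ = ∫ ξ, h ξ * φ ξ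

/-- `G` is the Green function `g_n(t, ·)`: the function `ĝ_n(t, ·)` represents a tempered
distribution, of which `G` is the inverse Fourier transform. -/
def IsGreen {d : ℕ} {N : ℕ} [NeZero N] (a : ℕ → ℝ) (b : MvPolynomial (Fin d) ℝ)
    (n : Fin N) (t : ℝ) (G : 𝓢'(Sp d, ℂ)) : Prop :=
  ∃ Ghat : 𝓢'(Sp d, ℂ), RepresentsFunction Ghat (fun ξ => ghat a b t ξ n) ∧
    ∀ φ : 𝓢(Sp d, ℂ), G φ = Ghat (fourierInvS d φ)

/-! ### Signed measures -/

/-- The integral `∫ φ dν = ∫ φ dν⁺ - ∫ φ dν⁻` against a signed measure. -/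
noncomputable def sintegral {X : Type*} [MeasurableSpace X] {V : Type*} [NormedAddCommGroup V]
    [NormedSpace ℝ V] (ν : SignedMeasure X) (φ : X → V) : V :=
  (∫ x, φ x ∂ν.toJordanDecomposition.posPart) - ∫ x, φ x ∂ν.toJordanDecomposition.negPart

/-- The tempered distribution `G` is represented by the signed measure `ν`. -/
def RepresentsMeasure {d : ℕ} (G : 𝓢'(Sp d, ℂ)) (ν : SignedMeasure (Sp d)) : Prop :=
  ∀ φ : 𝓢(Sp d, ℂ), G φ = sintegral ν φ

/-- `ν(dx) = γ(x) μ(dx)`. -/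
def HasSignedDensity {X : Type*} [MeasurableSpace X] (ν : SignedMeasure X) (μ : Measure X)
    (γ : X → ℝ) : Prop :=
  Integrable γ μ ∧ ν = μ.withDensityᵥ γ

/-- The Green functions are signed measures `g_n(t, dx) = γ_n(t, x) μ_n(t, dx)`, depending
continuously on time. -/
structure GreenMeasures {d : ℕ} {N : ℕ} [NeZero N] (T : EReal) (g : Fin N → ℝ → 𝓢'(Sp d, ℂ))
    (ν : Fin N → ℝ → SignedMeasure (Sp d)) (μ : Fin N → ℝ → Measure (Sp d))
    (γ : Fin N → ℝ → Sp d → ℝ) : Prop where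
  represents : ∀ n, ∀ t ∈ timeSet T, RepresentsMeasure (g n t) (ν n t)
  conv_continuous : ∀ n, ∀ φ : Sp d →ᵇ ℝ,
    ContinuousOn (fun q : ℝ × Sp d => sintegral (ν n q.1) fun y => φ (q.2 - y))
      (timeSet T ×ˢ univ)
  prob : ∀ n, ∀ t ∈ timeSet T, IsProbabilityMeasure (μ n t)
  density : ∀ n, ∀ t ∈ timeSet T, HasSignedDensity (ν n t) (μ n t) (γ n t)
  bounded : ∀ n, ∀ t ∈ timeSet T, ∃ C : ℝ, ∀ᵐ x ∂μ n t, |γ n t x| ≤ C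
  time_integrable : ∀ t ∈ timeSet T,
    IntegrableOn (fun s => ∫ x, |γ ⊤ s x| ∂μ ⊤ s) (Icc 0 t)

/-- At positive times, the distributional space gradients of the Green functions are (vectors of)
signed measures `∂_x g_n(t, dx) = γ¹_n(t, x) μ¹_n(t, dx)`. This is required for `n = N`, and for
those other `n` whose initial datum `f_n` is not identically zero. -/
structure GradientMeasures {d : ℕ} {N : ℕ} [NeZero N] (T : EReal) (f : Fin N → Sp d →ᵇ ℝ)
    (g : Fin N → ℝ → 𝓢'(Sp d, ℂ))
    (μ1 : Fin N → ℝ → Measure (Sp d)) (γ1 : Fin N → ℝ → Sp d → Sp d) : Prop where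
  prob : ∀ n, ∀ t ∈ openTimeSet T, IsProbabilityMeasure (μ1 n t)
  measurable : ∀ n, Measurable (fun q : ℝ × Sp d => γ1 n q.1 q.2)
  represents : ∀ n, (n = ⊤ ∨ f n ≠ 0) → ∀ m : Fin d, ∀ t ∈ openTimeSet T, ∃ ν1 : SignedMeasure (Sp d),
    RepresentsMeasure (∂_{EuclideanSpace.single m (1 : ℝ)} (g n t)) ν1 ∧
    HasSignedDensity ν1 (μ1 n t) (fun x => γ1 n t x m)
  time_integrable : ∀ t ∈ openTimeSet T,
    IntegrableOn (fun s => ∫ x, ‖γ1 ⊤ s x‖ ∂μ1 ⊤ s) (Ioc 0 t)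

/-! ### Solutions of the Cauchy problem -/

/-- `D^α φ` for a multi-index `α`. -/
noncomputable def multiDeriv {d : ℕ} (α : Fin d →₀ ℕ) (φ : 𝓢(Sp d, ℂ)) : 𝓢(Sp d, ℂ) :=
  (List.finRange d).foldr
    (fun j ψ => (fun χ : 𝓢(Sp d, ℂ) => ∂_{EuclideanSpace.single j (1 : ℝ)} χ)^[α j] ψ) φ

/-- The formal adjoint `∑_α (-1)^|α| b_α D^α φ` of `∑_α b_α D^α`. -/
noncomputable def adjointOp {d : ℕ} (b : MvPolynomial (Fin d) ℝ) (φ : 𝓢(Sp d, ℂ)) :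
    𝓢(Sp d, ℂ) :=
  ∑ α ∈ b.support, ((-1) ^ α.degree * ((b.coeff α : ℝ) : ℂ)) • multiDeriv α φ

/-- The pairing `⟨v, φ⟩ = ∫ v φ dx`. -/
noncomputable def pairing {d : ℕ} (v : Sp d → ℝ) (φ : 𝓢(Sp d, ℂ)) : ℂ :=
  ∫ x, (v x : ℂ) * φ x

/-- `u` solves `∑ a_n ∂_t^n u - ∑ b_α D^α u - F = 0` on `[0, T) × ℝ^d` with initial conditions
`∂_t^{n-1} u(0, ·) = p_n f_n`, `n = 1, …, N`. The solution is a continuous function, bounded on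
`[0, t] × ℝ^d` for all `t < T`; the equation and the initial conditions hold in the sense of
tempered distributions in the space variable. -/
structure IsSolution {d : ℕ} {N : ℕ} (a : ℕ → ℝ) (b : MvPolynomial (Fin d) ℝ)
    (p : Fin N → ℝ) (f : Fin N → Sp d →ᵇ ℝ) (F : ℝ → Sp d → ℝ) (T : EReal)
    (u : ℝ → Sp d → ℝ) : Prop where
  continuousOn : ContinuousOn (fun q : ℝ × Sp d => u q.1 q.2) (timeSet T ×ˢ univ)
  bounded : ∀ t ∈ timeSet T, ∃ C : ℝ, ∀ s ∈ Icc 0 t, ∀ x, |u s x| ≤ C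
  smooth : ∀ φ : 𝓢(Sp d, ℂ), ContDiffOn ℝ N (fun t => pairing (u t) φ) (timeSet T)
  equation : ∀ φ : 𝓢(Sp d, ℂ), ∀ t ∈ timeSet T,
    ∑ n ∈ Finset.Icc 1 N, (a n : ℂ) * iteratedDerivWithin n (fun s => pairing (u s) φ) (timeSet T) t
      - pairing (u t) (adjointOp b φ) - pairing (F t) φ = 0
  initial : ∀ φ : 𝓢(Sp d, ℂ), ∀ n : Fin N,
    iteratedDerivWithin n (fun s => pairing (u s) φ) (timeSet T) 0 = p n * pairing (f n) φ

/-! ### The random variables of the representation -/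

/-- `ρ` is a density on `[0, ∞)`, continuous there and positive on `(0, ∞)`; `τ` has density `ρ`;
`I` has law `(p_n)` and is independent of `τ`; `Z n t` has law `μ¹_n(t, ·)`, and each random field
`(t, ω) ↦ Z n t ω` is jointly measurable with respect to a `σ`-algebra `𝒢` of events that is
independent of `(τ, I)`. -/
structure DisplacementModel {d : ℕ} {N : ℕ} {Ω : Type*} [mΩ : MeasurableSpace Ω]
    (P : Measure Ω) (T : EReal) (p : Fin N → ℝ) (μ1 : Fin N → ℝ → Measure (Sp d))
    (ρ : ℝ → ℝ) (τ : Ω → ℝ) (I : Ω → Fin N) (Z : Fin N → ℝ → Ω → Sp d) : Prop where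
  density_continuous : ContinuousOn ρ (Ici 0)
  density_pos : ∀ t, 0 < t → 0 < ρ t
  measurable_tau : Measurable τ
  measurable_I : Measurable I
  law_tau : P.map τ = (volume.restrict (Ici 0)).withDensity fun t => ENNReal.ofReal (ρ t)
  law_I : ∀ n, P (I ⁻¹' {n}) = ENNReal.ofReal (p n)
  indep_tau_I : IndepFun τ I P
  field : ∃ 𝒢 : MeasurableSpace Ω, 𝒢 ≤ mΩ ∧
    (∀ n, Measurable[(inferInstance : MeasurableSpace ℝ).prod 𝒢]
      fun q : ℝ × Ω => Z n q.1 q.2) ∧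
    Indep 𝒢 (MeasurableSpace.comap (fun ω => (τ ω, I ω)) inferInstance) P
  law_Z : ∀ n, ∀ t ∈ openTimeSet T, P.map (Z n t) = μ1 n t

/-- The random vector
`1_{τ ≥ t} γ¹_I(t, Z^I_t) f_I(x - Z^I_t) / ρ̄(t) + 1_{τ < t} γ¹_N(τ, Z^N_τ) F(t - τ, x - Z^N_τ) / ρ(τ)`
with `ρ̄(t) = ∫_t^∞ ρ(s) ds`. -/
noncomputable def gradientWeight {d : ℕ} {N : ℕ} [NeZero N] {Ω : Type*}
    (f : Fin N → Sp d →ᵇ ℝ) (F : ℝ → Sp d → ℝ) (γ1 : Fin N → ℝ → Sp d → Sp d)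
    (ρ : ℝ → ℝ) (τ : Ω → ℝ) (I : Ω → Fin N) (Z : Fin N → ℝ → Ω → Sp d)
    (t : ℝ) (x : Sp d) (ω : Ω) : Sp d :=
  {ω | t ≤ τ ω}.indicator (fun ω => (f (I ω) (x - Z (I ω) t ω) / ∫ s in Ioi t, ρ s) •
      γ1 (I ω) t (Z (I ω) t ω)) ω
  + {ω | τ ω < t}.indicator (fun ω => (F (t - τ ω) (x - Z ⊤ (τ ω) ω) / ρ (τ ω)) •
      γ1 ⊤ (τ ω) (Z ⊤ (τ ω) ω)) ω

end LinearCauchy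

/-! The solution is explicit: u(t) = Σ p_n g_n(t) * f_n + ∫_0^t g_N(s) * F(t-s) ds
(`greenSolution`).

Existence. Testing g_n(t) on Fourier transforms in two ways shows that the measure γ_n μ_n has
Fourier transform (e^{tBᵀ} e_1)_n (`GreenMeasures.fourier_eq`). The matrix ODE for this exponential,
carried back to Schwartz space, becomes a first-order system for pairings with test functions. Its
matrix is the companion matrix C in which the number b(ξ) is replaced by the operator `adjointLM b`.
The m-th time derivative of ⟨g_n * h, φ⟩ is then Σ_j ⟨g_j * h, (C^m)_{jn} φ⟩. Two algebraic facts
conclude: Σ_k a_k C^k is the diagonal matrix with entry `adjointLM b`, which turns the system into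
the equation of order N; and for m < N the first row of C^m is a unit vector, which puts f_n into
the derivative of order n-1 and lets F enter only at order N.

Uniqueness. A solution w with zero data is paired with φ_n = (adjoint operator)^n 𝓕ψ, ψ of compact
support. The L¹ norms of the φ_n grow at most geometrically, and ⟨w, φ_n⟩ solves an ODE of order N
with source ⟨w, φ_{n+1}⟩. In a norm weighted by e^{-λt} with λ large, passing from n+1 to n gains
more than the growth costs, so iteration gives ⟨w, 𝓕ψ⟩ = 0. Band-limited approximate identities then
give w = 0.

Gradient. Since ∂_x g_n is a measure, the derivative of g_n * f falls on the measure and not on f: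
∂_x(g_n * f) = (∂_x g_n) * f for f merely bounded and continuous
(`HasMeasureGradient.hasGradientAt`). The time integral is differentiated by domination. Finally the
sum over n and the time integral are written as expectations: I and {τ ≥ t} have probabilities p_n
and ρ̄(t), τ has density ρ, and the independence of the fields from (τ, I) allows Fubini. -/

namespace LinearCauchy

open Filter Topology

/-! ### Integration against signed measures -/

section SignedMeasures

variable {X : Type*} [MeasurableSpace X] {V : Type*} [NormedAddCommGroup V] [NormedSpace ℝ V]

/-- Two decompositions of one signed measure into finite measures agree after adding crosswise, ν⁺ +
β = α + ν⁻, and this is an identity of positive measures that can be integrated. Minimality of the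
Jordan decomposition plays no role. -/
theorem sintegral_sub_toSignedMeasure (α β : Measure X) [IsFiniteMeasure α] [IsFiniteMeasure β]
    {φ : X → V} (hφ : StronglyMeasurable φ) {C : ℝ} (hC : ∀ x, ‖φ x‖ ≤ C) :
    sintegral (α.toSignedMeasure - β.toSignedMeasure) φ = (∫ x, φ x ∂α) - ∫ x, φ x ∂β := by
  set ν := α.toSignedMeasure - β.toSignedMeasure with hν
  have hi : ∀ (κ : Measure X) [IsFiniteMeasure κ], Integrable φ κ := fun κ _ =>
    Integrable.of_bound hφ.aestronglyMeasurable C (Eventually.of_forall hC)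
  have h := ν.toSignedMeasure_toJordanDecomposition
  rw [JordanDecomposition.toSignedMeasure] at h
  have h2 : ν.toJordanDecomposition.posPart + β = α + ν.toJordanDecomposition.negPart := by
    rw [← Measure.toSignedMeasure_eq_toSignedMeasure_iff, Measure.toSignedMeasure_add,
      Measure.toSignedMeasure_add]
    exact sub_eq_sub_iff_add_eq_add.1 (h.trans hν)
  have h4 := congrArg (fun κ : Measure X => ∫ x, φ x ∂κ) h2
  simp only [integral_add_measure (hi _) (hi _)] at h4
  rw [sintegral, sub_eq_sub_iff_add_eq_add, h4]

theorem integral_withDensity_ofReal (μ : Measure X) {γ : X → ℝ} (hγ : AEMeasurable γ μ)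
    (φ : X → V) :
    ∫ x, φ x ∂(μ.withDensity fun x => ENNReal.ofReal (γ x)) = ∫ x, (max (γ x) 0) • φ x ∂μ := by
  rw [integral_withDensity_eq_integral_toReal_smul₀ hγ.ennreal_ofReal
    (Eventually.of_forall fun x => ENNReal.ofReal_lt_top)]
  refine integral_congr_ae (Eventually.of_forall fun x => ?_)
  simp only [ENNReal.toReal_ofReal']

theorem HasSignedDensity.sintegral_eq {ν : SignedMeasure X} {μ : Measure X}
    {γ : X → ℝ} (h : HasSignedDensity ν μ γ) {φ : X → V} (hφ : StronglyMeasurable φ) {C : ℝ}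
    (hC : ∀ x, ‖φ x‖ ≤ C) :
    sintegral ν φ = ∫ x, γ x • φ x ∂μ := by
  obtain ⟨hγ, rfl⟩ := h
  have : IsFiniteMeasure (μ.withDensity fun x => ENNReal.ofReal (γ x)) :=
    isFiniteMeasure_withDensity_ofReal hγ.2
  have : IsFiniteMeasure (μ.withDensity fun x => ENNReal.ofReal (-γ x)) :=
    isFiniteMeasure_withDensity_ofReal hγ.neg.2
  rw [withDensityᵥ_eq_withDensity_pos_part_sub_withDensity_neg_part hγ]
  rw [sintegral_sub_toSignedMeasure _ _ hφ hC, integral_withDensity_ofReal _ hγ.1.aemeasurable,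
    integral_withDensity_ofReal μ (γ := fun x => -γ x) hγ.1.aemeasurable.neg, ← integral_sub]
  · refine integral_congr_ae (Eventually.of_forall fun x => ?_)
    simp only [← sub_smul, max_zero_sub_eq_self]
  · exact hγ.pos_part.smul_bdd _ hφ.aestronglyMeasurable (Eventually.of_forall hC)
  · exact hγ.neg_part.smul_bdd _ hφ.aestronglyMeasurable (Eventually.of_forall hC)

/-- The total variation of a measure with density is controlled by its norm as a functional on
bounded continuous functions. -/
theorem integral_abs_le_of_forall_integral_mul_le [PseudoEMetricSpace X]
    [BorelSpace X] (μ : Measure X) [IsFiniteMeasure μ] {γ : X → ℝ} (hγ : Integrable γ μ)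
    {C : ℝ} (hC : ∀ φ : X →ᵇ ℝ, ‖φ‖ ≤ 1 → ∫ x, γ x * φ x ∂μ ≤ C) : ∫ x, |γ x| ∂μ ≤ C := by
  have : IsFiniteMeasure (μ.withDensity fun x => ENNReal.ofReal |γ x|) :=
    isFiniteMeasure_withDensity_ofReal hγ.abs.2
  set κ := μ.withDensity fun x => ENNReal.ofReal |γ x| with hκ
  -- γ / |γ| is the sign of γ. Where γ vanishes it is 0 / 0 = 0, which is harmless because κ = |γ| μ
  -- does not charge that set.
  have hσm : AEMeasurable (fun x => γ x / |γ x|) μ :=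
    hγ.1.aemeasurable.div hγ.1.aemeasurable.abs
  have hσ1 : ∀ x, ‖γ x / |γ x|‖ ≤ 1 := fun x => by
    rw [Real.norm_eq_abs, abs_div, abs_abs]; exact div_self_le_one _
  have hσ : Integrable (fun x => γ x / |γ x|) κ :=
    Integrable.of_bound (hσm.mono_ac (withDensity_absolutelyContinuous _ _)).aestronglyMeasurable 1
      (Eventually.of_forall hσ1)
  refine le_of_forall_pos_le_add fun ε hε => ?_
  obtain ⟨g, hg, -⟩ := hσ.exists_boundedContinuous_integral_sub_le hε
  -- Truncation to [-1, 1] makes the approximant admissible in `hC` and, the sign taking values in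
  -- that interval, does not increase its distance to the sign.
  set g' : X →ᵇ ℝ := BoundedContinuousFunction.ofNormedAddCommGroup
    (fun x => max (-1) (min 1 (g x))) (by fun_prop) 1
    (fun x => by rw [Real.norm_eq_abs, abs_le]; exact ⟨le_max_left _ _,
      max_le (by norm_num) (min_le_left _ _)⟩) with hg'
  have hg'x : ∀ x, g' x = max (-1) (min 1 (g x)) := fun x => rfl
  have h1 : ‖g'‖ ≤ 1 := BoundedContinuousFunction.norm_ofNormedAddCommGroup_le _ zero_le_one _
  have h2 : ∀ x, |γ x / |γ x| - g' x| ≤ |γ x / |γ x| - g x| := fun x => by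
    have := abs_le.1 (hσ1 x)
    rw [hg'x]
    calc _ = |max (-1) (min 1 (γ x / |γ x|)) - max (-1) (min 1 (g x))| := by
          rw [min_eq_right this.2, max_eq_right this.1]
      _ ≤ |min 1 (γ x / |γ x|) - min 1 (g x)| := by
        simpa using abs_max_sub_max_le_max (-1) (min 1 (γ x / |γ x|)) (-1) (min 1 (g x))
      _ ≤ _ := by simpa using abs_min_sub_min_le_max 1 (γ x / |γ x|) 1 (g x)
  have hi : ∀ (φ : X →ᵇ ℝ), Integrable (fun x => γ x * φ x) μ := fun φ =>
    hγ.mul_bdd (c := ‖φ‖) φ.continuous.aestronglyMeasurable (Eventually.of_forall φ.norm_coe_le_norm)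
  have h4 : ∫ x, |γ x / |γ x| - g x| ∂κ = ∫ x, |γ x| * |γ x / |γ x| - g x| ∂μ := by
    rw [hκ, integral_withDensity_ofReal μ (γ := fun x => |γ x|) hγ.1.aemeasurable.abs]
    simp
  have hi2 : Integrable (fun x => |γ x| * |γ x / |γ x| - g x|) μ := by
    refine hγ.abs.mul_bdd (c := 1 + ‖g‖) ((hσm.sub g.continuous.aemeasurable).abs.aestronglyMeasurable)
      (Eventually.of_forall fun x => ?_)
    rw [Real.norm_eq_abs, abs_abs]
    exact (abs_sub _ _).trans (add_le_add (hσ1 x) (g.norm_coe_le_norm x))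
  have h5 : ∫ x, |γ x| ∂μ ≤ ∫ x, γ x * g' x + |γ x| * |γ x / |γ x| - g x| ∂μ := by
    refine integral_mono hγ.abs ((hi g').add hi2) fun x => ?_
    have h6 : γ x * (γ x / |γ x|) = |γ x| := by
      rw [← mul_div_assoc, ← abs_mul_abs_self, mul_self_div_self]
    have h7 : γ x * (γ x / |γ x| - g' x) ≤ |γ x| * |γ x / |γ x| - g x| :=
      (le_abs_self _).trans (by
        rw [abs_mul]; exact mul_le_mul_of_nonneg_left (h2 x) (abs_nonneg _))
    simp only
    linarith [mul_sub (γ x) (γ x / |γ x|) (g' x)]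
  rw [integral_add (hi g') hi2, ← h4] at h5
  simp only [Real.norm_eq_abs] at hg
  linarith [hC g' h1]

end SignedMeasures

/-! ### Continuous families of signed measures -/

/-- A family of signed measures `γ(t, x) μ(t, dx)`, `t ∈ S`, continuous in `t`, with locally bounded
total variation. -/
structure ContFamily {d : ℕ} (S : Set ℝ) (μ : ℝ → Measure (Sp d)) (γ : ℝ → Sp d → ℝ) :
    Prop where
  prob : ∀ t ∈ S, IsProbabilityMeasure (μ t)
  integrable : ∀ t ∈ S, Integrable (γ t) (μ t)
  cont : ∀ φ : Sp d →ᵇ ℝ,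
    ContinuousOn (fun q : ℝ × Sp d => ∫ y, γ q.1 y * φ (q.2 - y) ∂μ q.1) (S ×ˢ univ)
  tv : ∀ t ∈ S, ∃ C : ℝ, ∀ s ∈ Icc 0 t, ∫ y, |γ s y| ∂μ s ≤ C

theorem timeSet_mono {T : EReal} {s t : ℝ} (ht : t ∈ timeSet T) (hs : s ∈ Icc 0 t) :
    s ∈ timeSet T :=
  ⟨hs.1, lt_of_le_of_lt (EReal.coe_le_coe_iff.2 hs.2) ht.2⟩

theorem measurableSet_timeSet (T : EReal) : MeasurableSet (timeSet T) :=
  measurableSet_Ici.inter (measurableSet_lt measurable_coe_real_ereal measurable_const)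

theorem GreenMeasures.sintegral_eq {d : ℕ} {N : ℕ} [NeZero N] {T : EReal}
    {g : Fin N → ℝ → 𝓢'(Sp d, ℂ)} {ν : Fin N → ℝ → SignedMeasure (Sp d)}
    {μ : Fin N → ℝ → Measure (Sp d)} {γ : Fin N → ℝ → Sp d → ℝ} (h : GreenMeasures T g ν μ γ)
    (n : Fin N) {t : ℝ} (ht : t ∈ timeSet T) (φ : Sp d →ᵇ ℝ) :
    sintegral (ν n t) φ = ∫ y, γ n t y * φ y ∂μ n t := by
  have := h.prob n t ht
  rw [(h.density n t ht).sintegral_eq φ.continuous.stronglyMeasurable φ.norm_coe_le_norm]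
  rfl

/-- The local bound on the total variation comes from the uniform boundedness principle. For each φ
the integral is continuous in time, hence bounded on [0, t]. So the functionals are bounded in norm
uniformly on [0, t], and the norm on bounded continuous functions controls the total variation. -/
theorem GreenMeasures.contFamily {d : ℕ} {N : ℕ} [NeZero N] {T : EReal}
    {g : Fin N → ℝ → 𝓢'(Sp d, ℂ)} {ν : Fin N → ℝ → SignedMeasure (Sp d)}
    {μ : Fin N → ℝ → Measure (Sp d)} {γ : Fin N → ℝ → Sp d → ℝ} (h : GreenMeasures T g ν μ γ)
    (n : Fin N) : ContFamily (timeSet T) (μ n) (γ n) := by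
  have hcont : ∀ φ : Sp d →ᵇ ℝ,
      ContinuousOn (fun q : ℝ × Sp d => ∫ y, γ n q.1 y * φ (q.2 - y) ∂μ n q.1)
        (timeSet T ×ˢ univ) := fun φ => by
    refine (h.conv_continuous n φ).congr fun q hq => ?_
    exact (h.sintegral_eq n hq.1 (φ.compContinuous ⟨fun y => q.2 - y, by fun_prop⟩)).symm
  have hint : ∀ t ∈ timeSet T, Integrable (γ n t) (μ n t) := fun t ht => (h.density n t ht).1
  refine ⟨h.prob n, hint, hcont, fun t ht => ?_⟩
  have hi : ∀ (s : Icc 0 t) (φ : Sp d →ᵇ ℝ), Integrable (fun y => γ n s y * φ y) (μ n s) :=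
    fun s φ => (hint s (timeSet_mono ht s.2)).mul_bdd (c := ‖φ‖) φ.continuous.aestronglyMeasurable
      (Eventually.of_forall φ.norm_coe_le_norm)
  let Λ : Icc 0 t → (Sp d →ᵇ ℝ) →L[ℝ] ℝ := fun s => LinearMap.mkContinuous
    { toFun := fun φ => ∫ y, γ n s y * φ y ∂μ n s
      map_add' := fun φ ψ => by
        rw [← integral_add (hi s φ) (hi s ψ)]
        simp [mul_add]
      map_smul' := fun c φ => by
        simp only [BoundedContinuousFunction.coe_smul, smul_eq_mul, RingHom.id_apply,
          ← integral_const_mul]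
        congr 1; ext; ring }
    (∫ y, |γ n s y| ∂μ n s) fun φ => by
      rw [← integral_mul_const]
      refine norm_integral_le_of_norm_le ((hint s (timeSet_mono ht s.2)).abs.mul_const _)
        (Eventually.of_forall fun y => ?_)
      rw [norm_mul, Real.norm_eq_abs]
      gcongr
      exact φ.norm_coe_le_norm y
  obtain ⟨C, hC⟩ := banach_steinhaus (g := Λ) fun φ => by
    have h0 : ContinuousOn (fun s : ℝ => ∫ y, γ n s y * φ y ∂μ n s) (Icc 0 t) := by
      have h1 := (hcont (φ.compContinuous ⟨fun y => -y, by fun_prop⟩)).comp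
        (f := fun s : ℝ => (s, (0 : Sp d))) (s := Icc 0 t) (by fun_prop)
        fun s hs => ⟨timeSet_mono ht hs, mem_univ _⟩
      refine h1.congr fun s _ => ?_
      simp
    obtain ⟨C, hC⟩ := isCompact_Icc.exists_bound_of_continuousOn h0
    exact ⟨C, fun s => hC s s.2⟩
  refine ⟨C, fun s hs => ?_⟩
  have := h.prob n s (timeSet_mono ht hs)
  refine integral_abs_le_of_forall_integral_mul_le _ (hint s (timeSet_mono ht hs)) fun φ hφ => ?_
  calc ∫ y, γ n s y * φ y ∂μ n s = Λ ⟨s, hs⟩ φ := rfl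
    _ ≤ ‖Λ ⟨s, hs⟩ φ‖ := le_abs_self _
    _ ≤ ‖Λ ⟨s, hs⟩‖ * ‖φ‖ := (Λ ⟨s, hs⟩).le_opNorm φ
    _ ≤ C * 1 := mul_le_mul (hC _) hφ (norm_nonneg _) ((norm_nonneg _).trans (hC ⟨s, hs⟩))
    _ = C := mul_one C

section ContFamily

variable {d : ℕ} {S : Set ℝ} {μ : ℝ → Measure (Sp d)} {γ : ℝ → Sp d → ℝ}
  {V : Type*} [NormedAddCommGroup V] [NormedSpace ℝ V]

theorem ContFamily.integrable_smul (h : ContFamily S μ γ) {t : ℝ} (ht : t ∈ S) {φ : Sp d → V}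
    (hφ : StronglyMeasurable φ) {C : ℝ} (hC : ∀ x, ‖φ x‖ ≤ C) :
    Integrable (fun y => γ t y • φ y) (μ t) :=
  (h.integrable t ht).smul_bdd C hφ.aestronglyMeasurable (Eventually.of_forall hC)

theorem ContFamily.norm_integral_smul_le (h : ContFamily S μ γ) {t : ℝ} (ht : t ∈ S)
    {φ : Sp d → V} {C : ℝ} (hC : ∀ x, ‖φ x‖ ≤ C) :
    ‖∫ y, γ t y • φ y ∂μ t‖ ≤ (∫ y, |γ t y| ∂μ t) * C := by
  rw [← integral_mul_const]
  refine norm_integral_le_of_norm_le ((h.integrable t ht).abs.mul_const _)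
    (Eventually.of_forall fun y => ?_)
  rw [norm_smul, Real.norm_eq_abs]
  exact mul_le_mul_of_nonneg_left (hC y) (abs_nonneg _)

theorem ContFamily.cont_complex (h : ContFamily S μ γ) (φ : Sp d →ᵇ ℂ) :
    ContinuousOn (fun q : ℝ × Sp d => ∫ y, γ q.1 y • φ (q.2 - y) ∂μ q.1) (S ×ˢ univ) := by
  let R : Sp d →ᵇ ℝ := BoundedContinuousFunction.ofNormedAddCommGroup (fun x => (φ x).re)
    (Complex.continuous_re.comp φ.continuous) ‖φ‖
    fun x => (Complex.abs_re_le_norm _).trans (φ.norm_coe_le_norm x)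
  let J : Sp d →ᵇ ℝ := BoundedContinuousFunction.ofNormedAddCommGroup (fun x => (φ x).im)
    (Complex.continuous_im.comp φ.continuous) ‖φ‖
    fun x => (Complex.abs_im_le_norm _).trans (φ.norm_coe_le_norm x)
  have h1 : ContinuousOn (fun q : ℝ × Sp d => ((∫ y, γ q.1 y * R (q.2 - y) ∂μ q.1 : ℝ) : ℂ)
      + ((∫ y, γ q.1 y * J (q.2 - y) ∂μ q.1 : ℝ) : ℂ) * Complex.I) (S ×ˢ univ) :=
    (Complex.continuous_ofReal.comp_continuousOn (h.cont R)).add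
      ((Complex.continuous_ofReal.comp_continuousOn (h.cont J)).mul continuousOn_const)
  refine h1.congr fun q hq => ?_
  have hi := h.integrable_smul hq.1 (φ := fun y => φ (q.2 - y))
    (φ.continuous.comp (by fun_prop)).stronglyMeasurable fun y => φ.norm_coe_le_norm _
  have := integral_re_add_im hi
  simp only [← this]
  have e1 : ∀ y, RCLike.re (γ q.1 y • φ (q.2 - y)) = γ q.1 y * R (q.2 - y) := fun y => by
    simp [R]
  have e2 : ∀ y, RCLike.im (γ q.1 y • φ (q.2 - y)) = γ q.1 y * J (q.2 - y) := fun y => by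
    simp [J]
  simp only [e1, e2]
  rfl

theorem ContFamily.tendsto_integral_mul (h : ContFamily S μ γ) {t : ℝ} (ht : t ∈ S)
    {ι : Type*} {l : Filter ι} [l.IsCountablyGenerated] {φ : ι → Sp d → V} {φ₀ : Sp d → V}
    (hφ : ∀ i, StronglyMeasurable (φ i)) {C : ℝ} (hC : ∀ i x, ‖φ i x‖ ≤ C)
    (hlim : ∀ y, Tendsto (fun i => φ i y) l (𝓝 (φ₀ y))) :
    Tendsto (fun i => ∫ y, γ t y • φ i y ∂μ t) l (𝓝 (∫ y, γ t y • φ₀ y ∂μ t)) := by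
  refine tendsto_integral_filter_of_dominated_convergence (fun y => |γ t y| * C)
    (Eventually.of_forall fun i => (h.integrable_smul ht (hφ i) (hC i)).1)
    (Eventually.of_forall fun i => Eventually.of_forall fun y => ?_)
    ((h.integrable t ht).abs.mul_const C)
    (Eventually.of_forall fun y => (hlim y).const_smul (γ t y))
  rw [norm_smul, Real.norm_eq_abs]
  exact mul_le_mul_of_nonneg_left (hC i y) (abs_nonneg _)

theorem tendsto_floor_mul_div (s : ℝ) :
    Tendsto (fun k : ℕ => (⌊s * (k + 1)⌋ : ℝ) / (k + 1)) atTop (𝓝 s) := by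
  have h0 : Tendsto (fun k : ℕ => s - 1 / ((k : ℝ) + 1)) atTop (𝓝 s) := by
    simpa using tendsto_const_nhds (x := s).sub tendsto_one_div_add_atTop_nhds_zero_nat
  refine tendsto_of_tendsto_of_tendsto_of_le_of_le h0 tendsto_const_nhds (fun k => ?_) fun k => ?_
  · have hk : (0 : ℝ) < k + 1 := by positivity
    simp only
    rw [le_div_iff₀ hk, sub_mul, one_div, inv_mul_cancel₀ hk.ne']
    linarith [Int.lt_floor_add_one (s * (k + 1))]
  · have hk : (0 : ℝ) < k + 1 := by positivity
    simp only
    rw [div_le_iff₀ hk]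
    exact Int.floor_le _

/-- Continuity is known only for convolution with a function that does not depend on time. The time
argument of G is therefore rounded down to the grid ℤ/(k+1), which has countably many values, and k
tends to infinity by dominated convergence. -/
theorem ContFamily.measurable_indicator (h : ContFamily S μ γ) (hS : MeasurableSet S)
    {G : ℝ → Sp d → ℝ} (hG : Continuous fun q : ℝ × Sp d => G q.1 q.2) {C : ℝ}
    (hC : ∀ s x, |G s x| ≤ C) :
    Measurable ((S ×ˢ univ).indicator
      fun q : ℝ × Sp d => ∫ y, γ q.1 y * G q.1 (q.2 - y) ∂μ q.1) := by
  classical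
  let φ : ℝ → Sp d →ᵇ ℝ := fun r => BoundedContinuousFunction.ofNormedAddCommGroup (G r)
    (hG.comp (by fun_prop : Continuous fun x : Sp d => (r, x))) C (hC r)
  have h1 : ∀ r, Measurable ((S ×ˢ univ).indicator
      fun q : ℝ × Sp d => ∫ y, γ q.1 y * G r (q.2 - y) ∂μ q.1) := fun r => by
    rw [← piecewise_eq_indicator]
    exact (h.cont (φ r)).measurable_piecewise continuousOn_const (hS.prod MeasurableSet.univ)
  have h2 : ∀ k : ℕ, Measurable fun q : ℝ × Sp d => (S ×ˢ univ).indicator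
      (fun q' : ℝ × Sp d => ∫ y, γ q'.1 y * G ((⌊q.1 * (k + 1)⌋ : ℝ) / (k + 1)) (q'.2 - y) ∂μ q'.1)
      q := fun k => by
    have h3 : Measurable fun p : ℤ × (ℝ × Sp d) => (S ×ˢ univ).indicator
      (fun q' : ℝ × Sp d => ∫ y, γ q'.1 y * G ((p.1 : ℝ) / (k + 1)) (q'.2 - y) ∂μ q'.1) p.2 :=
      measurable_from_prod_countable_right fun j => h1 ((j : ℝ) / (k + 1))
    exact h3.comp ((Int.measurable_floor.comp (measurable_fst.mul_const _)).prodMk measurable_id)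
  refine measurable_of_tendsto_metrizable h2 (tendsto_pi_nhds.2 fun q => ?_)
  by_cases hq : q ∈ S ×ˢ (univ : Set (Sp d))
  · simp only [indicator_of_mem hq]
    refine h.tendsto_integral_mul hq.1 (fun k => ?_) (fun k y => hC _ _) fun y => ?_
    · exact (hG.comp (by fun_prop : Continuous fun y : Sp d => (_, q.2 - y))).stronglyMeasurable
    · exact (hG.tendsto (q.1, q.2 - y)).comp
        ((tendsto_floor_mul_div q.1).prodMk_nhds tendsto_const_nhds)
  · simp only [indicator_of_notMem hq]
    exact tendsto_const_nhds

end ContFamily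

theorem exists_gt_mem_timeSet {T : EReal} {t : ℝ} (ht : t ∈ timeSet T) :
    ∃ t₁ ∈ timeSet T, t < t₁ := by
  obtain ⟨t₁, h1, h2⟩ := EReal.lt_iff_exists_real_btwn.1 ht.2
  have h3 := EReal.coe_lt_coe_iff.1 h1
  exact ⟨t₁, ⟨ht.1.trans h3.le, h2⟩, h3⟩

/-! ### Convolution in space and time: measurability, continuity, bounds -/

section Duhamel

variable {d : ℕ} {T : EReal} {μ : ℝ → Measure (Sp d)} {γ : ℝ → Sp d → ℝ}

/-- The convolution in space and time of a family of signed measures with a function. -/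
noncomputable def duhamel (μ : ℝ → Measure (Sp d)) (γ : ℝ → Sp d → ℝ) (F : ℝ → Sp d → ℝ)
    (t : ℝ) (x : Sp d) : ℝ :=
  ∫ s in Ioc 0 t, ∫ y, γ s y * F (t - s) (x - y) ∂μ s

theorem ContFamily.measurable_convolution (h : ContFamily (timeSet T) μ γ) {F : ℝ → Sp d → ℝ}
    (hF : Continuous fun q : ℝ × Sp d => F q.1 q.2) {C : ℝ} (hC : ∀ s x, |F s x| ≤ C) (t : ℝ) :
    Measurable ((timeSet T ×ˢ univ).indicator
      fun q : ℝ × Sp d => ∫ y, γ q.1 y * F (t - q.1) (q.2 - y) ∂μ q.1) :=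
  h.measurable_indicator (measurableSet_timeSet T) (G := fun s x => F (t - s) x)
    (hF.comp (by fun_prop : Continuous fun q : ℝ × Sp d => (t - q.1, q.2))) fun s x => hC _ _

theorem ContFamily.aestronglyMeasurable_convolution (h : ContFamily (timeSet T) μ γ)
    {F : ℝ → Sp d → ℝ} (hF : Continuous fun q : ℝ × Sp d => F q.1 q.2) {C : ℝ}
    (hC : ∀ s x, |F s x| ≤ C) (t : ℝ) (x : Sp d) {t₁ : ℝ} (ht₁ : t₁ ∈ timeSet T) :
    AEStronglyMeasurable (fun s => ∫ y, γ s y * F (t - s) (x - y) ∂μ s)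
      (volume.restrict (Ioc 0 t₁)) := by
  have h1 := (h.measurable_convolution hF hC t).comp
    (by fun_prop : Measurable fun s : ℝ => (s, x))
  refine (h1.aestronglyMeasurable (μ := volume.restrict (Ioc 0 t₁))).congr ?_
  filter_upwards [ae_restrict_mem measurableSet_Ioc] with s hs
  rw [Function.comp_apply, indicator_of_mem]
  exact ⟨timeSet_mono ht₁ ⟨hs.1.le, hs.2⟩, mem_univ _⟩

theorem ContFamily.abs_convolution_le (h : ContFamily (timeSet T) μ γ)
    {F : ℝ → Sp d → ℝ} {C : ℝ} (hC : ∀ s x, |F s x| ≤ C) {s : ℝ} (hs : s ∈ timeSet T)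
    (t : ℝ) (x : Sp d) :
    |∫ y, γ s y * F (t - s) (x - y) ∂μ s| ≤ (∫ y, |γ s y| ∂μ s) * C :=
  h.norm_integral_smul_le hs (φ := fun y => F (t - s) (x - y)) fun _ => hC _ _

/-- The moving upper limit is turned into an indicator on a fixed interval (0, t₁] with t₁ > t₀. The
integrand is then bounded by M C and continuous at (t₀, x₀) for every s ≠ t₀, hence for almost every
s. -/
theorem ContFamily.duhamel_continuousOn (h : ContFamily (timeSet T) μ γ) {F : ℝ → Sp d → ℝ}
    (hF : Continuous fun q : ℝ × Sp d => F q.1 q.2) {C : ℝ} (hC : ∀ s x, |F s x| ≤ C) :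
    ContinuousOn (fun q : ℝ × Sp d => duhamel μ γ F q.1 q.2) (timeSet T ×ˢ univ) := by
  rintro ⟨t₀, x₀⟩ ⟨ht₀ : t₀ ∈ timeSet T, -⟩
  obtain ⟨t₁, ht₁, hlt⟩ := exists_gt_mem_timeSet ht₀
  obtain ⟨M, hM⟩ := h.tv t₁ ht₁
  have hC0 : 0 ≤ C := (abs_nonneg _).trans (hC 0 0)
  have hev : ∀ᶠ q : ℝ × Sp d in 𝓝[timeSet T ×ˢ univ] (t₀, x₀), q.1 ∈ Icc 0 t₁ := by
    have h1 : ∀ᶠ q : ℝ × Sp d in 𝓝[timeSet T ×ˢ univ] (t₀, x₀), q.1 < t₁ :=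
      nhdsWithin_le_nhds (continuous_fst.tendsto (t₀, x₀) |>.eventually (Iio_mem_nhds hlt))
    filter_upwards [h1, self_mem_nhdsWithin] with q hq hq' using ⟨hq'.1.1, hq.le⟩
  have hmain : ContinuousWithinAt (fun q : ℝ × Sp d => ∫ s in Ioc 0 t₁,
      (Iic q.1).indicator (fun s => ∫ y, γ s y * F (q.1 - s) (q.2 - y) ∂μ s) s)
      (timeSet T ×ˢ univ) (t₀, x₀) := by
    refine continuousWithinAt_of_dominated (bound := fun _ => M * C) ?_ ?_ ?_ ?_
    · filter_upwards with q
      exact (h.aestronglyMeasurable_convolution hF hC q.1 q.2 ht₁).indicator measurableSet_Iic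
    · filter_upwards with q
      filter_upwards [ae_restrict_mem measurableSet_Ioc] with s hs
      have hs' : s ∈ Icc 0 t₁ := ⟨hs.1.le, hs.2⟩
      refine (norm_indicator_le_norm_self _ _).trans
        ((h.abs_convolution_le hC (timeSet_mono ht₁ hs') _ _).trans ?_)
      exact mul_le_mul_of_nonneg_right (hM s hs') hC0
    · exact integrable_const _
    · have hne : ∀ᵐ s ∂(volume.restrict (Ioc 0 t₁) : Measure ℝ), s ≠ t₀ :=
        ae_restrict_of_ae (Measure.ae_ne volume t₀)
      filter_upwards [hne, ae_restrict_mem measurableSet_Ioc] with s hs hs1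
      have hs' : s ∈ timeSet T := timeSet_mono ht₁ ⟨hs1.1.le, hs1.2⟩
      rcases lt_or_gt_of_ne hs with hlt' | hgt
      · have h1 : ∀ᶠ q : ℝ × Sp d in 𝓝 (t₀, x₀), s ∈ Iic q.1 :=
          continuous_fst.tendsto (t₀, x₀) |>.eventually (Ici_mem_nhds hlt')
        have h2 : ContinuousAt (fun q : ℝ × Sp d =>
            ∫ y, γ s y * F (q.1 - s) (q.2 - y) ∂μ s) (t₀, x₀) := by
          refine h.tendsto_integral_mul hs' (fun q => ?_) (fun q y => hC _ _) fun y => ?_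
          · exact (hF.comp (by fun_prop :
              Continuous fun y : Sp d => (q.1 - s, q.2 - y))).stronglyMeasurable
          · exact (hF.comp (by fun_prop :
              Continuous fun q : ℝ × Sp d => (q.1 - s, q.2 - y))).tendsto (t₀, x₀)
        refine (h2.congr ?_).continuousWithinAt
        filter_upwards [h1] with q hq
        rw [indicator_of_mem hq]
      · have h1 : ∀ᶠ q : ℝ × Sp d in 𝓝 (t₀, x₀), s ∉ Iic q.1 := by
          filter_upwards [continuous_fst.tendsto (t₀, x₀) |>.eventually (Iio_mem_nhds hgt)]
            with q hq using not_le.2 hq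
        refine (continuousAt_const (y := (0 : ℝ)).congr ?_).continuousWithinAt
        filter_upwards [h1] with q hq
        rw [indicator_of_notMem hq]
  have heq : ∀ q : ℝ × Sp d, q.1 ∈ Icc 0 t₁ → (∫ s in Ioc 0 t₁,
      (Iic q.1).indicator (fun s => ∫ y, γ s y * F (q.1 - s) (q.2 - y) ∂μ s) s)
      = duhamel μ γ F q.1 q.2 := fun q hq => by
    rw [setIntegral_indicator measurableSet_Iic, duhamel, Ioc_inter_Iic, min_eq_right hq.2]
  refine hmain.congr_of_eventuallyEq ?_ (heq (t₀, x₀) ⟨ht₀.1, hlt.le⟩).symm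
  filter_upwards [hev] with q hq using (heq q hq).symm

theorem ContFamily.duhamel_bound (h : ContFamily (timeSet T) μ γ) {F : ℝ → Sp d → ℝ}
    {C : ℝ} (hC : ∀ s x, |F s x| ≤ C) {t : ℝ} (ht : t ∈ timeSet T) :
    ∃ K : ℝ, ∀ s ∈ Icc 0 t, ∀ x, |duhamel μ γ F s x| ≤ K := by
  obtain ⟨M, hM⟩ := h.tv t ht
  have hC0 : 0 ≤ C := (abs_nonneg _).trans (hC 0 0)
  have hM0 : 0 ≤ M := (integral_nonneg fun _ => abs_nonneg _).trans (hM t ⟨ht.1, le_rfl⟩)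
  refine ⟨M * C * t, fun s hs x => ?_⟩
  have h1 : ‖∫ r in Ioc 0 s, ∫ y, γ r y * F (s - r) (x - y) ∂μ r‖
      ≤ M * C * volume.real (Ioc 0 s) := by
    refine norm_setIntegral_le_of_norm_le_const (by simp) fun r hr => ?_
    have hr' : r ∈ Icc 0 t := ⟨hr.1.le, hr.2.trans hs.2⟩
    exact (h.abs_convolution_le hC (timeSet_mono ht hr') _ _).trans
      (mul_le_mul_of_nonneg_right (hM r hr') hC0)
  refine h1.trans ?_
  rw [Real.volume_real_Ioc_of_le hs.1, sub_zero]
  exact mul_le_mul_of_nonneg_left hs.2 (mul_nonneg hM0 hC0)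

end Duhamel

/-! ### The symbol on the Fourier side -/

/-- The character `η ↦ exp(-2πi ⟨η, y⟩)`. -/
noncomputable def character {d : ℕ} (η y : Sp d) : ℂ :=
  Complex.exp (((-2 * Real.pi * inner ℝ η y : ℝ) : ℂ) * Complex.I)

theorem norm_character {d : ℕ} (η y : Sp d) : ‖character η y‖ = 1 :=
  Complex.norm_exp_ofReal_mul_I _

theorem character_add {d : ℕ} (η y z : Sp d) :
    character η (y + z) = character η y * character η z := by
  rw [character, character, character, ← Complex.exp_add, inner_add_right]
  congr 1
  push_cast
  ring

theorem continuous_character {d : ℕ} :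
    Continuous fun q : Sp d × Sp d => character q.1 q.2 := by
  unfold character
  fun_prop

theorem fourier_eq_integral_character {d : ℕ} (ψ : 𝓢(Sp d, ℂ)) (y : Sp d) :
    (𝓕 ψ) y = ∫ η, character η y * ψ η := by
  rw [SchwartzMap.fourier_coe, Real.fourier_eq']
  rfl

theorem eq_integral_character_fourierInv {d : ℕ} (φ : 𝓢(Sp d, ℂ)) (y : Sp d) :
    φ y = ∫ η, character η y * (𝓕⁻ φ) η := by
  rw [← fourier_eq_integral_character, FourierTransform.fourier_fourierInv_eq]

theorem fourierInv_lineDeriv_apply {d : ℕ} (φ : 𝓢(Sp d, ℂ)) (j : Fin d) (η : Sp d) :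
    (𝓕⁻ (∂_{EuclideanSpace.single j (1 : ℝ)} φ)) η
      = (-Complex.I * ((2 * Real.pi * η j : ℝ) : ℂ)) * (𝓕⁻ φ) η := by
  have h : (fun x : Sp d => inner ℝ x (EuclideanSpace.single j (1 : ℝ))).HasTemperateGrowth := by
    fun_prop
  rw [SchwartzMap.fourierInv_lineDerivOp_eq]
  have h2 : inner ℝ η (EuclideanSpace.single j (1 : ℝ)) = η j := by
    simp [EuclideanSpace.inner_single_right]
  simp only [smul_apply, SchwartzMap.smulLeftCLM_apply_apply h, h2, smul_eq_mul,
    Complex.real_smul]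
  push_cast
  ring

theorem multiDeriv_fourierInv_apply {d : ℕ} (α : Fin d →₀ ℕ) (φ : 𝓢(Sp d, ℂ)) (η : Sp d) :
    (𝓕⁻ (multiDeriv α φ)) η
      = (∏ j, (-Complex.I * ((2 * Real.pi * η j : ℝ) : ℂ)) ^ α j) * (𝓕⁻ φ) η := by
  have h1 : ∀ (j : Fin d) (k : ℕ) (ψ : 𝓢(Sp d, ℂ)),
      (𝓕⁻ ((fun χ : 𝓢(Sp d, ℂ) => ∂_{EuclideanSpace.single j (1 : ℝ)} χ)^[k] ψ)) η
        = (-Complex.I * ((2 * Real.pi * η j : ℝ) : ℂ)) ^ k * (𝓕⁻ ψ) η := fun j k ψ => by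
    induction k with
    | zero => simp
    | succ k ih =>
      rw [Function.iterate_succ_apply', fourierInv_lineDeriv_apply, ih, pow_succ]
      ring
  have h2 : ∀ l : List (Fin d), (𝓕⁻ (l.foldr
      (fun j ψ => (fun χ : 𝓢(Sp d, ℂ) => ∂_{EuclideanSpace.single j (1 : ℝ)} χ)^[α j] ψ) φ)) η
      = (l.map fun j => (-Complex.I * ((2 * Real.pi * η j : ℝ) : ℂ)) ^ α j).prod * (𝓕⁻ φ) η :=
    fun l => by
    induction l with
    | nil => simp
    | cons j l ih => rw [List.foldr_cons, h1, ih, List.map_cons, List.prod_cons,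
        ← mul_assoc]
  rw [multiDeriv, h2, ← List.ofFn_eq_map, List.prod_ofFn]

/-- The sign (-1)^|α| of the adjoint and the factor (-i)^|α| of the differentiations multiply to
i^|α|. The argument 2πη comes from the normalisation e^{2πi⟨η,x⟩} of the transform. -/
theorem adjointOp_fourierInv_apply {d : ℕ} (b : MvPolynomial (Fin d) ℝ) (φ : 𝓢(Sp d, ℂ))
    (η : Sp d) :
    (𝓕⁻ (adjointOp b φ)) η = symbol b ((2 * Real.pi) • η) * (𝓕⁻ φ) η := by
  have h0 : 𝓕⁻ (adjointOp b φ) = ∑ α ∈ b.support,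
      ((-1) ^ α.degree * ((b.coeff α : ℝ) : ℂ)) • 𝓕⁻ (multiDeriv α φ) := by
    rw [adjointOp]
    change FourierTransform.fourierInvCLM ℂ 𝓢(Sp d, ℂ) _ = _
    rw [map_sum]
    simp only [map_smul]
    rfl
  rw [h0, symbol, Finset.sum_mul]
  simp only [_root_.sum_apply, smul_apply, smul_eq_mul, multiDeriv_fourierInv_apply]
  refine Finset.sum_congr rfl fun α _ => ?_
  have h1 : ∀ j : Fin d, (-Complex.I * ((2 * Real.pi * η j : ℝ) : ℂ)) ^ α j
      = (-Complex.I) ^ α j * ((((2 * Real.pi) • η) j : ℝ) : ℂ) ^ α j := fun j => by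
    rw [mul_pow]; rfl
  simp only [h1, Finset.prod_mul_distrib, Finset.prod_pow_eq_pow_sum]
  rw [← Finsupp.degree_eq_sum]
  have h2 : ((-1 : ℂ)) ^ α.degree * (-Complex.I) ^ α.degree = Complex.I ^ α.degree := by
    rw [← mul_pow]; simp
  rw [← h2]
  ring

/-- Linearity is read off from the multiplier, the inverse Fourier transform being injective. -/
theorem adjointOp_add {d : ℕ} (b : MvPolynomial (Fin d) ℝ) (φ ψ : 𝓢(Sp d, ℂ)) :
    adjointOp b (φ + ψ) = adjointOp b φ + adjointOp b ψ := by
  have h : 𝓕⁻ (adjointOp b (φ + ψ)) = 𝓕⁻ (adjointOp b φ + adjointOp b ψ) := by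
    ext η
    simp only [FourierTransform.fourierInv_add, adjointOp_fourierInv_apply, add_apply, mul_add]
  simpa using congrArg (fun χ : 𝓢(Sp d, ℂ) => 𝓕 χ) h

theorem adjointOp_smul {d : ℕ} (b : MvPolynomial (Fin d) ℝ) (c : ℂ) (φ : 𝓢(Sp d, ℂ)) :
    adjointOp b (c • φ) = c • adjointOp b φ := by
  have h : 𝓕⁻ (adjointOp b (c • φ)) = 𝓕⁻ (c • adjointOp b φ) := by
    ext η
    simp only [FourierTransform.fourierInv_smul, adjointOp_fourierInv_apply, smul_apply,
      smul_eq_mul]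
    ring
  simpa using congrArg (fun χ : 𝓢(Sp d, ℂ) => 𝓕 χ) h

/-- The formal adjoint as a linear map. -/
noncomputable def adjointLM {d : ℕ} (b : MvPolynomial (Fin d) ℝ) : Module.End ℂ 𝓢(Sp d, ℂ) where
  toFun := adjointOp b
  map_add' := adjointOp_add b
  map_smul' := adjointOp_smul b

theorem continuous_symbol {d : ℕ} (b : MvPolynomial (Fin d) ℝ) : Continuous (symbol b) := by
  unfold symbol
  fun_prop

theorem contDiff_symbol {d : ℕ} (b : MvPolynomial (Fin d) ℝ) {n : WithTop ℕ∞} :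
    ContDiff ℝ n (symbol b) := by
  unfold symbol
  have h : ∀ j : Fin d, ContDiff ℝ n fun ξ : Sp d => ((ξ j : ℝ) : ℂ) := fun j =>
    Complex.ofRealCLM.contDiff.comp (EuclideanSpace.proj j : Sp d →L[ℝ] ℝ).contDiff
  exact ContDiff.sum fun α _ => contDiff_const.mul (contDiff_prod fun j _ => (h j).pow _)

/-! ### Companion matrices -/

/-- The companion matrix over an algebra, with lower left entry `L`. -/
def companionOver {A : Type*} [Ring A] [Algebra ℂ A] (N : ℕ) (a : ℕ → ℝ) (L : A) :
    Matrix (Fin N) (Fin N) A :=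
  Matrix.of fun i j =>
    if (i : ℕ) + 1 = N then (if (j : ℕ) = 0 then L else -algebraMap ℂ A (a j))
    else if (j : ℕ) = (i : ℕ) + 1 then 1 else 0

/-- This is the dictionary that carries the ODE for e^{tB(ξ)ᵀ} to Schwartz space: entries of the
operator matrix are Fourier multipliers by the entries of B. -/
theorem companionOver_adjointLM_fourierInv {d N : ℕ} (a : ℕ → ℝ) (b : MvPolynomial (Fin d) ℝ)
    (i j : Fin N) (φ : 𝓢(Sp d, ℂ)) (η : Sp d) :
    (𝓕⁻ (companionOver N a (adjointLM b) i j φ)) η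
      = companion N a b ((2 * Real.pi) • η) i j * (𝓕⁻ φ) η := by
  simp only [companionOver, companion, Matrix.of_apply]
  split_ifs
  · exact adjointOp_fourierInv_apply b φ η
  · rw [Module.algebraMap_end_eq_smul_id]
    simp [FourierTransform.fourierInv_smul]
  · simp
  · simp [FourierTransform.fourierInv_zero]

theorem continuous_companion {d : ℕ} (N : ℕ) (a : ℕ → ℝ) (b : MvPolynomial (Fin d) ℝ) :
    Continuous (companion N a b) := by
  refine continuous_matrix fun i j => ?_
  simp only [companion, Matrix.of_apply]
  split_ifs
  · exact continuous_symbol b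
  all_goals exact continuous_const

/-- The function `(e^{t B(ξ)ᵀ} e_1)_n`. -/
noncomputable def expKernel {d N : ℕ} [NeZero N] (a : ℕ → ℝ) (b : MvPolynomial (Fin d) ℝ)
    (t : ℝ) (ξ : Sp d) (n : Fin N) : ℂ :=
  NormedSpace.exp ((t : ℂ) • (companion N a b ξ).transpose) n 0

theorem ghat_eq_expKernel {d N : ℕ} [NeZero N] (a : ℕ → ℝ) (b : MvPolynomial (Fin d) ℝ)
    (t : ℝ) (ξ : Sp d) (n : Fin N) :
    ghat a b t ξ n = (((2 * Real.pi) ^ (-(d : ℝ) / 2) : ℝ) : ℂ) * expKernel a b t ξ n := by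
  simp [ghat, expKernel]

section
attribute [local instance] Matrix.linftyOpNormedRing Matrix.linftyOpNormedAlgebra

theorem continuous_expKernel {d N : ℕ} [NeZero N] (a : ℕ → ℝ) (b : MvPolynomial (Fin d) ℝ)
    (n : Fin N) : Continuous fun q : ℝ × Sp d => expKernel a b q.1 q.2 n := by
  have h1 : Continuous fun q : ℝ × Sp d => (q.1 : ℂ) • (companion N a b q.2).transpose :=
    (Complex.continuous_ofReal.comp continuous_fst).smul
      ((continuous_companion N a b).comp continuous_snd).matrix_transpose
  have h2 := (NormedSpace.exp_continuous (𝔸 := Matrix (Fin N) (Fin N) ℂ)).comp h1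
  exact h2.matrix_elem n 0

theorem expKernel_zero {d N : ℕ} [NeZero N] (a : ℕ → ℝ) (b : MvPolynomial (Fin d) ℝ)
    (ξ : Sp d) (n : Fin N) : expKernel a b 0 ξ n = if n = 0 then 1 else 0 := by
  simp [expKernel, Matrix.one_apply]

theorem hasDerivAt_expKernel {d N : ℕ} [NeZero N] (a : ℕ → ℝ) (b : MvPolynomial (Fin d) ℝ)
    (t : ℝ) (ξ : Sp d) (n : Fin N) :
    HasDerivAt (fun s => expKernel a b s ξ n)
      (∑ j, companion N a b ξ j n * expKernel a b t ξ j) t := by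
  have h1 := hasDerivAt_exp_smul_const' (𝕂 := ℂ) (companion N a b ξ).transpose (t : ℂ)
  have h3 := (hasDerivAt_pi.1 (hasDerivAt_pi.1 h1 n) 0).comp_ofReal
  exact h3.congr_deriv (Matrix.mul_apply ..)

end

/-! ### The Fourier transforms of the Green functions -/

/-- Families of signed measures whose Fourier transforms are the entries of `e^{t B(ξ)ᵀ} e_1`. -/
structure GreenFamily {d N : ℕ} [NeZero N] (a : ℕ → ℝ) (b : MvPolynomial (Fin d) ℝ) (T : EReal)
    (μ : Fin N → ℝ → Measure (Sp d)) (γ : Fin N → ℝ → Sp d → ℝ) : Prop where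
  family : ∀ n, ContFamily (timeSet T) (μ n) (γ n)
  fourier : ∀ n, ∀ t ∈ timeSet T, ∀ η, ∫ y, γ n t y • character η y ∂μ n t
    = expKernel a b t ((2 * Real.pi) • η) n

theorem ContFamily.integral_smul_integral_character {d : ℕ} {S : Set ℝ} {μ : ℝ → Measure (Sp d)}
    {γ : ℝ → Sp d → ℝ} (h : ContFamily S μ γ) {t : ℝ} (ht : t ∈ S) {ψ : Sp d → ℂ}
    (hψ : Integrable ψ) :
    ∫ y, γ t y • (∫ η, character η y * ψ η) ∂μ t
      = ∫ η, (∫ y, γ t y • character η y ∂μ t) * ψ η := by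
  have := h.prob t ht
  have hi : Integrable (fun q : Sp d × Sp d => (γ t q.1 • ψ q.2) * character q.2 q.1)
      ((μ t).prod volume) :=
    ((h.integrable t ht).smul_prod hψ).mul_bdd (c := 1)
      (continuous_character.comp continuous_swap).aestronglyMeasurable
      (Eventually.of_forall fun q => (norm_character _ _).le)
  calc ∫ y, γ t y • (∫ η, character η y * ψ η) ∂μ t
      = ∫ y, (∫ η, (γ t y • ψ η) * character η y) ∂μ t := by
        refine integral_congr_ae (Eventually.of_forall fun y => ?_)
        simp only
        rw [← integral_smul]
        refine integral_congr_ae (Eventually.of_forall fun η => ?_)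
        simp only [smul_mul_assoc, mul_comm]
    _ = ∫ η, ∫ y, (γ t y • ψ η) * character η y ∂μ t :=
      integral_integral_swap (f := fun y η => (γ t y • ψ η) * character η y) hi
    _ = _ := by
        refine integral_congr_ae (Eventually.of_forall fun η => ?_)
        simp only [← integral_mul_const]
        refine integral_congr_ae (Eventually.of_forall fun y => ?_)
        simp only [Complex.real_smul]
        ring

theorem ContFamily.continuous_fourier {d : ℕ} {S : Set ℝ} {μ : ℝ → Measure (Sp d)}
    {γ : ℝ → Sp d → ℝ} (h : ContFamily S μ γ) {t : ℝ} (ht : t ∈ S) :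
    Continuous fun η => ∫ y, γ t y • character η y ∂μ t := by
  refine continuous_iff_continuousAt.2 fun η₀ => ?_
  refine h.tendsto_integral_mul ht (φ := fun η y => character η y) (C := 1) (fun η => ?_)
    (fun η y => (norm_character _ _).le) fun y => ?_
  · exact (continuous_character.comp (by fun_prop : Continuous fun y => (η, y))).stronglyMeasurable
  · exact (continuous_character.comp (by fun_prop : Continuous fun η => (η, y))).tendsto η₀

/-- The value of g_n(t) at 𝓕ψ is computed once from the measure, by Fubini, and once from ĝ_n. Both
give the integral of ψ against a continuous function; since ψ is arbitrary the two functions agree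
almost everywhere, hence everywhere. -/
theorem GreenMeasures.fourier_eq {d : ℕ} {N : ℕ} [NeZero N] {a : ℕ → ℝ}
    {b : MvPolynomial (Fin d) ℝ} {T : EReal}
    {g : Fin N → ℝ → 𝓢'(Sp d, ℂ)} {ν : Fin N → ℝ → SignedMeasure (Sp d)}
    {μ : Fin N → ℝ → Measure (Sp d)} {γ : Fin N → ℝ → Sp d → ℝ} (h : GreenMeasures T g ν μ γ)
    (hg : ∀ n, ∀ t ∈ timeSet T, IsGreen a b n t (g n t)) :
    GreenFamily a b T μ γ := by
  refine ⟨h.contFamily, fun n t ht => ?_⟩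
  have hc1 := (h.contFamily n).continuous_fourier ht
  have hc2 : Continuous fun η : Sp d => expKernel a b t ((2 * Real.pi) • η) n :=
    (continuous_expKernel a b n).comp
      (by fun_prop : Continuous fun η : Sp d => (t, (2 * Real.pi) • η))
  refine congrFun ((hc1.ae_eq_iff_eq volume hc2).1 ?_)
  refine ae_eq_of_integral_contDiff_smul_eq hc1.locallyIntegrable hc2.locallyIntegrable
    fun q hq hqc => ?_
  have hψc : HasCompactSupport fun x => (q x : ℂ) :=
    hqc.comp_left (g := fun r : ℝ => (r : ℂ)) Complex.ofReal_zero
  let ψ : 𝓢(Sp d, ℂ) := hψc.toSchwartzMap (Complex.ofRealCLM.contDiff.comp hq)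
  have hψ : ∀ x, ψ x = q x := fun x => rfl
  have := h.prob n t ht
  obtain ⟨Ghat, hGhat, hG⟩ := hg n t ht
  set c : ℝ := (2 * Real.pi) ^ (-(d : ℝ) / 2) with hc
  have hpi : (0 : ℝ) < 2 * Real.pi := by positivity
  -- One factor (2π)^(-d/2) stands in ĝ and one in the inverse transform; together they cancel the
  -- Jacobian (2π)^d of the dilation.
  have hcc : c * c * |((2 * Real.pi)⁻¹ ^ d)⁻¹| = 1 := by
    rw [hc, ← Real.rpow_add hpi, abs_of_pos (by positivity), inv_pow, inv_inv,
      ← Real.rpow_natCast, ← Real.rpow_add hpi]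
    ring_nf
    exact Real.rpow_zero _
  have hinv : ∀ ξ, fourierInvS d (𝓕 ψ) ξ = (c : ℂ) * ψ ((2 * Real.pi)⁻¹ • ξ) := fun ξ => by
    rw [fourierInvS, FourierTransform.fourierInv_fourier_eq]
    rfl
  -- The distribution is known to be given by the function ĝ_n only on compactly supported tests;
  -- the inverse transform of 𝓕ψ is one, being a multiple of a dilate of ψ.
  have hcs : HasCompactSupport (fourierInvS d (𝓕 ψ)) := by
    have h1 : HasCompactSupport fun ξ => ψ ((2 * Real.pi)⁻¹ • ξ) :=
      hψc.comp_homeomorph (Homeomorph.smulOfNeZero (2 * Real.pi)⁻¹ (by positivity))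
    have h2 := h1.mul_left (f := fun _ => (c : ℂ))
    exact (funext hinv : ⇑(fourierInvS d (𝓕 ψ)) = _) ▸ h2
  have e1 : g n t (𝓕 ψ) = ∫ η, q η • ∫ y, γ n t y • character η y ∂μ n t := by
    rw [h.represents n t ht, (h.density n t ht).sintegral_eq
      (𝓕 ψ).continuous.stronglyMeasurable
      ((𝓕 ψ).toBoundedContinuousFunction.norm_coe_le_norm)]
    simp only [fourier_eq_integral_character]
    rw [(h.contFamily n).integral_smul_integral_character ht ψ.integrable]
    refine integral_congr_ae (Eventually.of_forall fun η => ?_)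
    simp only [hψ, Complex.real_smul, mul_comm]
  have e2 : g n t (𝓕 ψ) = ∫ η, q η • expKernel a b t ((2 * Real.pi) • η) n := by
    have e3 := Measure.integral_comp_smul (volume : Measure (Sp d))
      (fun η => q η • expKernel a b t ((2 * Real.pi) • η) n) ((2 * Real.pi)⁻¹)
    rw [finrank_euclideanSpace_fin] at e3
    have e4 : g n t (𝓕 ψ) = ((c * c : ℝ) : ℂ) * ∫ ξ, q ((2 * Real.pi)⁻¹ • ξ) •
        expKernel a b t ((2 * Real.pi) • (2 * Real.pi)⁻¹ • ξ) n := by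
      rw [hG, hGhat _ hcs, ← integral_const_mul]
      refine integral_congr_ae (Eventually.of_forall fun ξ => ?_)
      simp only [hinv, ghat_eq_expKernel, hψ, Complex.real_smul, smul_inv_smul₀ hpi.ne']
      push_cast
      ring
    rw [e4, e3, Complex.real_smul, ← mul_assoc, ← Complex.ofReal_mul, hcc, Complex.ofReal_one,
      one_mul]
  exact e1.symm.trans e2

/-! ### The evolution of translated test functions -/

/-- The function `z ↦ ∫ φ(z + y) γ(y) μ(dy)`. -/
noncomputable def translateIntegral {d : ℕ} (μ : Measure (Sp d)) (γ : Sp d → ℝ)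
    (φ : Sp d → ℂ) (z : Sp d) : ℂ :=
  ∫ y, γ y • φ (z + y) ∂μ

section GreenFamily

variable {d N : ℕ} [NeZero N] {a : ℕ → ℝ} {b : MvPolynomial (Fin d) ℝ} {T : EReal}
  {μ : Fin N → ℝ → Measure (Sp d)} {γ : Fin N → ℝ → Sp d → ℝ}

theorem integrable_character_mul (z : Sp d) (ψ : 𝓢(Sp d, ℂ)) :
    Integrable fun η => character η z * ψ η :=
  ψ.integrable.bdd_mul (c := 1)
    (continuous_character.comp (by fun_prop : Continuous fun η => (η, z))).aestronglyMeasurable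
    (Eventually.of_forall fun η => (norm_character _ _).le)

theorem GreenFamily.translateIntegral_eq (h : GreenFamily a b T μ γ) (n : Fin N) {t : ℝ}
    (ht : t ∈ timeSet T) (φ : 𝓢(Sp d, ℂ)) (z : Sp d) :
    translateIntegral (μ n t) (γ n t) φ z = ∫ η, expKernel a b t ((2 * Real.pi) • η) n *
      (character η z * (𝓕⁻ φ) η) := by
  rw [translateIntegral]
  have h1 : ∀ y, φ (z + y) = ∫ η, character η y * (character η z * (𝓕⁻ φ) η) := fun y => by
    rw [eq_integral_character_fourierInv]
    refine integral_congr_ae (Eventually.of_forall fun η => ?_)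
    simp only [character_add]
    ring
  simp only [h1]
  rw [(h.family n).integral_smul_integral_character ht (integrable_character_mul z _)]
  simp only [h.fourier n t ht]

theorem GreenFamily.norm_expKernel_le (h : GreenFamily a b T μ γ) (n : Fin N) {t : ℝ}
    (ht : t ∈ timeSet T) (η : Sp d) :
    ‖expKernel a b t ((2 * Real.pi) • η) n‖ ≤ ∫ y, |γ n t y| ∂μ n t := by
  rw [← h.fourier n t ht]
  simpa using (h.family n).norm_integral_smul_le ht (fun y => (norm_character η y).le)

/-- This is ∂_t e^{tBᵀ} e_1 = Bᵀ e^{tBᵀ} e_1 in integrated form, multiplied by a character and the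
inverse transform of φ and integrated over η. The total variation bounds the Fourier transforms
uniformly in η and s ≤ t, which justifies the interchange of integrals. -/
theorem GreenFamily.translateIntegral_sub_eq (h : GreenFamily a b T μ γ) (n : Fin N) {t : ℝ}
    (ht : t ∈ timeSet T) (φ : 𝓢(Sp d, ℂ)) (z : Sp d) :
    translateIntegral (μ n t) (γ n t) φ z = (if n = 0 then φ z else 0) + ∫ s in Ioc 0 t,
      ∑ j, translateIntegral (μ j s) (γ j s) (companionOver N a (adjointLM b) j n φ) z := by
  have hint : ∀ j, Integrable (fun q : ℝ × Sp d => expKernel a b q.1 ((2 * Real.pi) • q.2) j *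
      (character q.2 z * (𝓕⁻ (companionOver N a (adjointLM b) j n φ)) q.2))
      ((volume.restrict (Ioc 0 t)).prod volume) := fun j => by
    obtain ⟨M, hM⟩ := (h.family j).tv t ht
    refine Integrable.bdd_mul (c := M) ?_ ?_ ?_
    · exact Integrable.comp_snd (integrable_character_mul z _) _
    · exact ((continuous_expKernel a b j).comp (by fun_prop :
        Continuous fun q : ℝ × Sp d => (q.1, (2 * Real.pi) • q.2))).aestronglyMeasurable
    · have h1 : ∀ᵐ q ∂((volume.restrict (Ioc 0 t)).prod (volume : Measure (Sp d))),
          q.1 ∈ Ioc 0 t := by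
        rw [← Measure.restrict_univ (μ := (volume : Measure (Sp d))), Measure.prod_restrict]
        filter_upwards [ae_restrict_mem (measurableSet_Ioc.prod MeasurableSet.univ)] with q hq
          using hq.1
      filter_upwards [h1] with q hq
      have hq' : q.1 ∈ Icc 0 t := ⟨hq.1.le, hq.2⟩
      exact (h.norm_expKernel_le j (timeSet_mono ht hq') _).trans (hM _ hq')
  have hode : ∀ η : Sp d, expKernel a b t ((2 * Real.pi) • η) n = (if n = 0 then 1 else 0) +
      ∫ s in Ioc 0 t, ∑ j, companion N a b ((2 * Real.pi) • η) j n *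
        expKernel a b s ((2 * Real.pi) • η) j := fun η => by
    have h1 : Continuous fun s => ∑ j, companion N a b ((2 * Real.pi) • η) j n *
        expKernel a b s ((2 * Real.pi) • η) j :=
      continuous_finsetSum _ fun j _ => continuous_const.mul ((continuous_expKernel a b j).comp
        (by fun_prop : Continuous fun s : ℝ => (s, (2 * Real.pi) • η)))
    have h2 := intervalIntegral.integral_eq_sub_of_hasDerivAt
      (fun s _ => hasDerivAt_expKernel a b s ((2 * Real.pi) • η) n) (h1.intervalIntegrable 0 t)
    rw [intervalIntegral.integral_of_le ht.1] at h2
    rw [h2, expKernel_zero]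
    ring
  rw [h.translateIntegral_eq n ht]
  have hsum : ∫ s in Ioc 0 t,
      ∑ j, translateIntegral (μ j s) (γ j s) (companionOver N a (adjointLM b) j n φ) z
      = ∫ η, ∫ s in Ioc 0 t, ∑ j, expKernel a b s ((2 * Real.pi) • η) j *
      (character η z * (𝓕⁻ (companionOver N a (adjointLM b) j n φ)) η) := by
    rw [← integral_integral_swap (integrable_finsetSum _ fun j _ => hint j)]
    have h3 : ∀ᵐ s ∂(volume.restrict (Ioc 0 t)), ∀ j, Integrable fun η =>
        expKernel a b s ((2 * Real.pi) • η) j *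
        (character η z * (𝓕⁻ (companionOver N a (adjointLM b) j n φ)) η) := by
      rw [ae_all_iff]
      exact fun j => (hint j).prod_right_ae
    refine integral_congr_ae ?_
    filter_upwards [ae_restrict_mem measurableSet_Ioc, h3] with s hs hs'
    rw [integral_finsetSum _ fun j _ => hs' j]
    exact Finset.sum_congr rfl fun j _ => h.translateIntegral_eq j
      (timeSet_mono ht ⟨hs.1.le, hs.2⟩) _ z
  rw [hsum]
  have hz : (if n = 0 then φ z else 0)
      = ∫ η, (if n = 0 then 1 else 0) * (character η z * (𝓕⁻ φ) η) := by
    rw [integral_const_mul, ← eq_integral_character_fourierInv]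
    simp
  rw [hz, ← integral_add]
  · refine integral_congr_ae (Eventually.of_forall fun η => ?_)
    simp only [hode, add_mul]
    congr 1
    rw [← integral_mul_const]
    refine integral_congr_ae (Eventually.of_forall fun s => ?_)
    simp only [companionOver_adjointLM_fourierInv, Finset.sum_mul]
    refine Finset.sum_congr rfl fun j _ => ?_
    ring
  · exact (integrable_character_mul z _).const_mul _
  · exact (integrable_finsetSum _ fun j _ => hint j).integral_prod_right

end GreenFamily

/-! ### First-order systems with a companion matrix -/

section Companion

variable {A : Type*} [Ring A] [Algebra ℂ A] {N : ℕ} [NeZero N] (a : ℕ → ℝ) (L : A)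

/-- Right multiplication by the companion matrix moves a unit row one place to the right; its last
row is not met while m < N. -/
theorem companionOver_pow_zero_apply {m : ℕ} (hm : m < N) (j : Fin N) :
    (companionOver N a L ^ m) 0 j = if (j : ℕ) = m then 1 else 0 := by
  induction m generalizing j with
  | zero =>
    rw [pow_zero, Matrix.one_apply]
    simp only [Fin.ext_iff, Fin.val_zero, eq_comm]
  | succ m ih =>
    have hm' : m < N := by omega
    rw [pow_succ, Matrix.mul_apply, Finset.sum_eq_single ⟨m, hm'⟩]
    · rw [ih hm']
      simp [companionOver, hm.ne]
    · intro l _ hl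
      rw [ih hm', if_neg (fun h => hl (Fin.ext h)), zero_mul]
    · simp

theorem companionOver_pow_self_zero_apply (j : Fin N) :
    (companionOver N a L ^ N) 0 j = if (j : ℕ) = 0 then L else -algebraMap ℂ A (a j) := by
  obtain ⟨m, hm⟩ : ∃ m, N = m + 1 := Nat.exists_eq_succ_of_ne_zero (NeZero.ne N)
  have hm' : m < N := by omega
  have h1 : companionOver N a L ^ N = companionOver N a L ^ m * companionOver N a L := by
    rw [← pow_succ, ← hm]
  rw [h1, Matrix.mul_apply, Finset.sum_eq_single ⟨m, hm'⟩]
  · rw [companionOver_pow_zero_apply a L hm']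
    simp [companionOver, hm]
  · intro l _ hl
    rw [companionOver_pow_zero_apply a L hm', if_neg (fun h => hl (Fin.ext h)), zero_mul]
  · simp

/-- Every row of X is the first row of some C^i X, so identities between powers of C need to be
checked only in the first row. -/
theorem companionOver_pow_zero_mul (X : Matrix (Fin N) (Fin N) A) (i j : Fin N) :
    (companionOver N a L ^ (i : ℕ) * X) 0 j = X i j := by
  rw [Matrix.mul_apply, Finset.sum_eq_single i]
  · rw [companionOver_pow_zero_apply a L i.2]
    simp
  · intro l _ hl
    rw [companionOver_pow_zero_apply a L i.2, if_neg (fun h => hl (Fin.ext h)), zero_mul]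
  · simp

/-- The companion matrix satisfies its characteristic equation. -/
theorem sum_smul_companionOver_pow (ha : a N = 1) (i j : Fin N) :
    ∑ k ∈ Finset.Icc 1 N, (a k : ℂ) • (companionOver N a L ^ k) i j = if i = j then L else 0 := by
  set C := companionOver N a L with hC
  have h1 : (C ^ N) i j = ∑ l : Fin N, (C ^ N) 0 l * (C ^ (i : ℕ)) l j := by
    rw [← Matrix.mul_apply, ← pow_add, add_comm, pow_add, companionOver_pow_zero_mul]
  -- Both sides are the (0, j) entry of C^(l+i). Only powers of C are commuted, as the entries lie
  -- in a possibly noncommutative ring.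
  have h2 : ∀ l : Fin N, (C ^ (i : ℕ)) l j = (C ^ (l : ℕ)) i j := fun l => by
    rw [← companionOver_pow_zero_mul a L (C ^ (i : ℕ)) l j,
      ← companionOver_pow_zero_mul a L (C ^ (l : ℕ)) i j, ← pow_add, ← pow_add, add_comm]
  obtain ⟨m, rfl⟩ : ∃ m, N = m + 1 := Nat.exists_eq_succ_of_ne_zero (NeZero.ne N)
  have h3 : (C ^ (m + 1)) i j = (if i = j then L else 0) -
      ∑ l ∈ Finset.Icc 1 m, (a l : ℂ) • (C ^ l) i j := by
    rw [h1, Fin.sum_univ_succ]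
    have e0 : (C ^ (m + 1)) 0 0 * (C ^ (i : ℕ)) 0 j = if i = j then L else 0 := by
      rw [companionOver_pow_self_zero_apply, h2]
      simp [Matrix.one_apply]
    have e1 : ∀ l : Fin m, (C ^ (m + 1)) 0 l.succ * (C ^ (i : ℕ)) l.succ j
        = -((a ((l : ℕ) + 1) : ℂ) • (C ^ ((l : ℕ) + 1)) i j) := fun l => by
      rw [companionOver_pow_self_zero_apply, h2, if_neg (by simp), neg_mul,
        Algebra.smul_def, Fin.val_succ]
    rw [e0, Finset.sum_congr rfl fun l _ => e1 l, Finset.sum_neg_distrib, ← sub_eq_add_neg]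
    congr 1
    rw [Fin.sum_univ_eq_sum_range fun l => (a (l + 1) : ℂ) • (C ^ (l + 1)) i j,
      Finset.range_eq_Ico, Finset.sum_Ico_add' (fun l => (a l : ℂ) • (C ^ l) i j) 0 m 1]
    rfl
  rw [Finset.sum_Icc_succ_top (by omega), ha, h3]
  simp

end Companion

section CompanionSystem

variable {N : ℕ} [NeZero N] {W : Type*} [AddCommGroup W] [Module ℂ W]

/-- A family of linear functionals solving a first-order linear system with companion matrix, with a
source term in the first equation. -/
structure CompanionSystem (S : Set ℝ) (a : ℕ → ℝ) (L : Module.End ℂ W) (src : ℝ → W → ℂ)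
    (U : Fin N → ℝ → W → ℂ) : Prop where
  linear : ∀ j, ∀ t ∈ S, IsLinearMap ℂ (U j t)
  deriv : ∀ j φ, ∀ t ∈ S, HasDerivWithinAt (fun s => U j s φ)
    ((if j = 0 then src t φ else 0) + ∑ l, U l t (companionOver N a L l j φ)) S t

/-- The `m`-th time derivative of the `n`-th functional, up to source terms. -/
noncomputable def systemDeriv (a : ℕ → ℝ) (L : Module.End ℂ W) (U : Fin N → ℝ → W → ℂ) (n : Fin N)
    (φ : W) (m : ℕ) (t : ℝ) : ℂ :=
  ∑ j, U j t ((companionOver N a L ^ m) j n φ)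

variable {S : Set ℝ} {a : ℕ → ℝ} {L : Module.End ℂ W} {src : ℝ → W → ℂ} {U : Fin N → ℝ → W → ℂ}

theorem CompanionSystem.systemDeriv_zero (h : CompanionSystem S a L src U) (n : Fin N) (φ : W)
    {t : ℝ} (ht : t ∈ S) : systemDeriv a L U n φ 0 t = U n t φ := by
  rw [systemDeriv, Finset.sum_eq_single n]
  · simp
  · intro j _ hj
    rw [pow_zero, Matrix.one_apply_ne hj]
    exact (h.linear j t ht).map_zero
  · simp

/-- The source is seen only through the entry (0, n) of C^m, which vanishes for m < N unless m = n.
For the last component it stays invisible up to m = N - 2. -/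
theorem CompanionSystem.hasDerivWithinAt (h : CompanionSystem S a L src U) (n : Fin N) (φ : W)
    (m : ℕ) {t : ℝ} (ht : t ∈ S) :
    HasDerivWithinAt (systemDeriv a L U n φ m)
      (src t ((companionOver N a L ^ m) 0 n φ) + systemDeriv a L U n φ (m + 1) t) S t := by
  have h1 := HasDerivWithinAt.fun_sum (u := Finset.univ) fun (j : Fin N) _ =>
    h.deriv j ((companionOver N a L ^ m) j n φ) t ht
  refine h1.congr_deriv ?_
  rw [Finset.sum_add_distrib, Finset.sum_ite_eq' Finset.univ (0 : Fin N), if_pos (Finset.mem_univ _),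
    Finset.sum_comm, systemDeriv]
  congr 1
  refine Finset.sum_congr rfl fun l _ => ?_
  rw [pow_succ', Matrix.mul_apply, LinearMap.sum_apply]
  exact (map_sum (h.linear l t ht).mk' _ _).symm

theorem CompanionSystem.sum_systemDeriv (h : CompanionSystem S a L src U) (ha : a N = 1)
    (n : Fin N) (φ : W) {t : ℝ} (ht : t ∈ S) :
    ∑ k ∈ Finset.Icc 1 N, (a k : ℂ) * systemDeriv a L U n φ k t = U n t (L φ) := by
  simp only [systemDeriv, Finset.mul_sum]
  rw [Finset.sum_comm]
  have h1 : ∀ j : Fin N, ∑ k ∈ Finset.Icc 1 N, (a k : ℂ) * U j t ((companionOver N a L ^ k) j n φ)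
      = U j t ((if j = n then L else 0 : Module.End ℂ W) φ) := fun j => by
    rw [← sum_smul_companionOver_pow a L ha j n, LinearMap.sum_apply]
    refine Eq.trans ?_ (map_sum (h.linear j t ht).mk' _ _).symm
    refine Finset.sum_congr rfl fun k _ => ?_
    exact ((h.linear j t ht).map_smul _ _).symm
  simp only [h1]
  rw [Finset.sum_eq_single n]
  · simp
  · intro j _ hj
    rw [if_neg hj]
    exact (h.linear j t ht).map_zero
  · simp

/-- Since only component 0 is present at the initial time, only the first row of C^m matters, and
that row is a unit vector. -/
theorem systemDeriv_initial {I : W → ℂ} (hI : I 0 = 0) {t : ℝ}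
    (hU : ∀ j φ, U j t φ = if j = 0 then I φ else 0)
    (n : Fin N) (φ : W) {m : ℕ} (hm : m < N) :
    systemDeriv a L U n φ m t = if (n : ℕ) = m then I φ else 0 := by
  rw [systemDeriv, Finset.sum_eq_single 0]
  · rw [hU, if_pos rfl, companionOver_pow_zero_apply a L hm]
    split_ifs
    · rfl
    · exact hI
  · intro j _ hj
    rw [hU, if_neg hj]
  · simp

theorem iteratedDerivWithin_eq_of_hasDerivWithinAt (hS : UniqueDiffOn ℝ S) {y : ℕ → ℝ → ℂ} (N : ℕ)
    (hy : ∀ m < N, ∀ t ∈ S, HasDerivWithinAt (y m) (y (m + 1) t) S t) :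
    ∀ m ≤ N, ∀ t ∈ S, iteratedDerivWithin m (y 0) S t = y m t := by
  intro m
  induction m with
  | zero => intro _ t _; simp
  | succ m ih =>
    intro hm t ht
    rw [iteratedDerivWithin_succ, derivWithin_congr (fun s hs => ih (by omega) s hs)
      (ih (by omega) t ht)]
    exact (hy m (by omega) t ht).derivWithin (hS t ht)

theorem contDiffOn_of_hasDerivWithinAt (hS : UniqueDiffOn ℝ S) (N : ℕ) {y : ℕ → ℝ → ℂ}
    (hy : ∀ m < N, ∀ t ∈ S, HasDerivWithinAt (y m) (y (m + 1) t) S t)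
    (hc : ContinuousOn (y N) S) : ContDiffOn ℝ N (y 0) S := by
  induction N generalizing y with
  | zero => simpa using (contDiffOn_zero (𝕜 := ℝ)).2 hc
  | succ N ih =>
    have h1 : ContDiffOn ℝ N (y 1) S :=
      ih (y := fun m => y (m + 1)) (fun m hm t ht => hy (m + 1) (by omega) t ht) hc
    rw [Nat.cast_succ, contDiffOn_succ_iff_derivWithin hS]
    refine ⟨fun t ht => (hy 0 (by omega) t ht).differentiableWithinAt, by simp, ?_⟩
    exact h1.congr fun t ht => (hy 0 (by omega) t ht).derivWithin (hS t ht)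

end CompanionSystem

theorem convex_timeSet (T : EReal) : Convex ℝ (timeSet T) := by
  refine Set.OrdConnected.convex ⟨fun x hx y hy z hz => ?_⟩
  exact timeSet_mono hy ⟨hx.1.trans hz.1, hz.2⟩

theorem zero_mem_timeSet {T : EReal} (hT : 0 < T) : (0 : ℝ) ∈ timeSet T :=
  ⟨le_rfl, by simpa using hT⟩

theorem uniqueDiffOn_timeSet {T : EReal} (hT : 0 < T) : UniqueDiffOn ℝ (timeSet T) := by
  obtain ⟨t, ht, ht0⟩ := exists_gt_mem_timeSet (zero_mem_timeSet hT)
  refine uniqueDiffOn_convex (convex_timeSet T) ⟨t / 2, ?_⟩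
  rw [mem_interior]
  exact ⟨Ioo 0 t, fun s hs => timeSet_mono ht ⟨hs.1.le, hs.2.le⟩, isOpen_Ioo, by
    constructor <;> linarith⟩

/-! ### Pairings of convolutions with test functions -/

section Pairing

variable {d : ℕ} {T : EReal}

theorem pairing_continuousOn {v : ℝ → Sp d → ℝ}
    (hv : ContinuousOn (fun q : ℝ × Sp d => v q.1 q.2) (timeSet T ×ˢ univ))
    (hb : ∀ t ∈ timeSet T, ∃ C : ℝ, ∀ s ∈ Icc 0 t, ∀ x, |v s x| ≤ C) (φ : 𝓢(Sp d, ℂ)) :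
    ContinuousOn (fun t => pairing (v t) φ) (timeSet T) := by
  intro t₀ ht₀
  obtain ⟨t₁, ht₁, hlt⟩ := exists_gt_mem_timeSet ht₀
  obtain ⟨C, hC⟩ := hb t₁ ht₁
  have hslice : ∀ t ∈ timeSet T, Continuous (v t) := fun t ht =>
    continuousOn_univ.1 (hv.comp (f := fun x : Sp d => (t, x)) (by fun_prop)
      fun x _ => ⟨ht, mem_univ _⟩)
  have hev : ∀ᶠ t in 𝓝[timeSet T] t₀, t ∈ timeSet T ∧ t ∈ Icc 0 t₁ := by
    filter_upwards [nhdsWithin_le_nhds (Iio_mem_nhds hlt), self_mem_nhdsWithin] with t h1 h2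
      using ⟨h2, h2.1, h1.le⟩
  refine tendsto_integral_filter_of_dominated_convergence (fun x => C * ‖φ x‖) ?_ ?_
    (φ.integrable.norm.const_mul C) (Eventually.of_forall fun x => ?_)
  · filter_upwards [hev] with t ht
    exact ((Complex.continuous_ofReal.comp (hslice t ht.1)).mul φ.continuous).aestronglyMeasurable
  · filter_upwards [hev] with t ht
    refine Eventually.of_forall fun x => ?_
    rw [norm_mul, Complex.norm_real]
    exact mul_le_mul_of_nonneg_right (hC t ht.2 x) (norm_nonneg _)
  · have h1 : ContinuousOn (fun t => v t x) (timeSet T) :=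
      hv.comp (f := fun t : ℝ => (t, x)) (by fun_prop) fun t ht => ⟨ht, mem_univ _⟩
    exact (Complex.continuous_ofReal.continuousAt.comp_continuousWithinAt (h1 t₀ ht₀)).mul
      continuousWithinAt_const

theorem hasDerivWithinAt_integral_timeSet {g : ℝ → ℂ} (hg : ContinuousOn g (timeSet T)) {t : ℝ}
    (ht : t ∈ timeSet T) :
    HasDerivWithinAt (fun t => ∫ s in Ioc 0 t, g s) (g t) (timeSet T) t := by
  obtain ⟨t₁, ht₁, hlt⟩ := exists_gt_mem_timeSet ht
  have h01 : (0 : ℝ) ≤ t₁ := ht₁.1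
  -- The fundamental theorem of calculus is applied to an extension that is continuous on all of ℝ
  -- and constant outside [0, t₁].
  let g' : ℝ → ℂ := IccExtend h01 (domRestrict (Icc 0 t₁) g)
  have hg' : Continuous g' :=
    (hg.mono fun s hs => timeSet_mono ht₁ hs).domRestrict.Icc_extend'
  have hgg : ∀ s ∈ Icc 0 t₁, g' s = g s := fun s hs => IccExtend_of_mem h01 _ hs
  have h1 := (hg'.integral_hasStrictDerivAt 0 t).hasDerivAt.hasDerivWithinAt (s := timeSet T)
  rw [hgg t ⟨ht.1, hlt.le⟩] at h1
  have h2 : ∀ s ∈ Icc 0 t₁, ∫ r in Ioc 0 s, g r = ∫ r in (0 : ℝ)..s, g' r := fun s hs => by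
    rw [intervalIntegral.integral_of_le hs.1]
    exact setIntegral_congr_fun measurableSet_Ioc fun r hr =>
      (hgg r ⟨hr.1.le, hr.2.trans hs.2⟩).symm
  refine h1.congr_of_eventuallyEq ?_ (h2 t ⟨ht.1, hlt.le⟩)
  filter_upwards [nhdsWithin_le_nhds (Iio_mem_nhds hlt), self_mem_nhdsWithin] with s hs1 hs2
    using h2 s ⟨hs2.1, hs1.le⟩

end Pairing

/-! ### Moving the convolution onto the test function -/

section Smeared

variable {d : ℕ}

/-- The pairing of the convolution of `γ(y) μ(dy)` and `h` with `φ`. -/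
noncomputable def smeared (μ : Measure (Sp d)) (γ : Sp d → ℝ) (h : Sp d → ℝ)
    (φ : 𝓢(Sp d, ℂ)) : ℂ :=
  ∫ z, (h z : ℂ) * translateIntegral μ γ φ z

variable {S : Set ℝ} {μ : ℝ → Measure (Sp d)} {γ : ℝ → Sp d → ℝ}

theorem ContFamily.integrable_translate (hf : ContFamily S μ γ) {t : ℝ} (ht : t ∈ S)
    (φ : 𝓢(Sp d, ℂ)) :
    Integrable (fun q : Sp d × Sp d => γ t q.1 • φ (q.2 + q.1)) ((μ t).prod volume) := by
  have := hf.prob t ht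
  have hm : AEStronglyMeasurable (fun q : Sp d × Sp d => γ t q.1 • φ (q.2 + q.1))
      ((μ t).prod volume) :=
    (hf.integrable t ht).1.comp_fst.smul
      (φ.continuous.comp (by fun_prop :
        Continuous fun q : Sp d × Sp d => q.2 + q.1)).aestronglyMeasurable
  rw [integrable_prod_iff hm]
  refine ⟨Eventually.of_forall fun y => (φ.integrable.comp_add_right y).smul (γ t y), ?_⟩
  have h1 : ∀ y, ∫ z, ‖γ t y • φ (z + y)‖ = |γ t y| * ∫ z, ‖φ z‖ := fun y => by
    simp only [norm_smul, Real.norm_eq_abs, integral_const_mul]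
    rw [integral_add_right_eq_self fun z => ‖φ z‖]
  simp only [h1]
  exact (hf.integrable t ht).abs.mul_const _

theorem ContFamily.integrable_translateIntegral (hf : ContFamily S μ γ) {t : ℝ} (ht : t ∈ S)
    (φ : 𝓢(Sp d, ℂ)) : Integrable (translateIntegral (μ t) (γ t) φ) := by
  have := hf.prob t ht
  exact (hf.integrable_translate ht φ).integral_prod_right

theorem ContFamily.integral_norm_translateIntegral_le (hf : ContFamily S μ γ) {t : ℝ} (ht : t ∈ S)
    (φ : 𝓢(Sp d, ℂ)) :
    ∫ z, ‖translateIntegral (μ t) (γ t) φ z‖ ≤ (∫ y, |γ t y| ∂μ t) * ∫ z, ‖φ z‖ := by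
  have := hf.prob t ht
  have hi := hf.integrable_translate ht φ
  calc ∫ z, ‖translateIntegral (μ t) (γ t) φ z‖
      ≤ ∫ z, ∫ y, ‖γ t y • φ (z + y)‖ ∂μ t :=
        integral_mono (hf.integrable_translateIntegral ht φ).norm hi.norm.integral_prod_right
          fun z => norm_integral_le_integral_norm _
    _ = ∫ y, (∫ z, ‖γ t y • φ (z + y)‖) ∂μ t :=
        (integral_integral_swap (f := fun y z => ‖γ t y • φ (z + y)‖) hi.norm).symm
    _ = _ := by
        rw [← integral_mul_const]
        refine integral_congr_ae (Eventually.of_forall fun y => ?_)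
        simp only [norm_smul, Real.norm_eq_abs, integral_const_mul]
        rw [integral_add_right_eq_self fun z => ‖φ z‖]

theorem ContFamily.continuousOn_translateIntegral (hf : ContFamily S μ γ) (φ : 𝓢(Sp d, ℂ)) :
    ContinuousOn (fun q : ℝ × Sp d => translateIntegral (μ q.1) (γ q.1) φ q.2) (S ×ˢ univ) := by
  have h1 := hf.cont_complex
    (φ.toBoundedContinuousFunction.compContinuous ⟨fun y => -y, by fun_prop⟩)
  have h2 := h1.comp (f := fun q : ℝ × Sp d => (q.1, -q.2)) (s := S ×ˢ univ) (by fun_prop)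
    fun q hq => ⟨hq.1, mem_univ _⟩
  refine h2.congr fun q _ => ?_
  simp only [translateIntegral, Function.comp_apply, BoundedContinuousFunction.compContinuous_apply,
    ContinuousMap.coe_mk, SchwartzMap.toBoundedContinuousFunction_apply]
  refine integral_congr_ae (Eventually.of_forall fun y => ?_)
  simp only [neg_sub, sub_neg_eq_add, add_comm]

theorem ContFamily.integrable_mul_translateIntegral (hf : ContFamily S μ γ) {t : ℝ} (ht : t ∈ S)
    {h : Sp d → ℝ} (hc : Continuous h) {C : ℝ} (hC : ∀ x, |h x| ≤ C) (φ : 𝓢(Sp d, ℂ)) :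
    Integrable fun z => (h z : ℂ) * translateIntegral (μ t) (γ t) φ z :=
  (hf.integrable_translateIntegral ht φ).bdd_mul (c := C)
    (Complex.continuous_ofReal.comp hc).aestronglyMeasurable
    (Eventually.of_forall fun z => by simpa using hC z)

theorem ContFamily.norm_smeared_le (hf : ContFamily S μ γ) {t : ℝ} (ht : t ∈ S)
    {h : Sp d → ℝ} {C : ℝ} (hC : ∀ x, |h x| ≤ C) (φ : 𝓢(Sp d, ℂ)) :
    ‖smeared (μ t) (γ t) h φ‖ ≤ C * ((∫ y, |γ t y| ∂μ t) * ∫ z, ‖φ z‖) := by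
  have hC0 : 0 ≤ C := (abs_nonneg _).trans (hC 0)
  refine le_trans ?_ (mul_le_mul_of_nonneg_left (hf.integral_norm_translateIntegral_le ht φ) hC0)
  rw [← integral_const_mul]
  refine norm_integral_le_of_norm_le ((hf.integrable_translateIntegral ht φ).norm.const_mul C)
    (Eventually.of_forall fun z => ?_)
  rw [norm_mul, Complex.norm_real]
  exact mul_le_mul_of_nonneg_right (hC z) (norm_nonneg _)

theorem ContFamily.smeared_isLinearMap (hf : ContFamily S μ γ) {t : ℝ} (ht : t ∈ S)
    {h : Sp d → ℝ} (hc : Continuous h) {C : ℝ} (hC : ∀ x, |h x| ≤ C) :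
    IsLinearMap ℂ (smeared (μ t) (γ t) h) := by
  have hi : ∀ (φ : 𝓢(Sp d, ℂ)) (z : Sp d), Integrable (fun y => γ t y • φ (z + y)) (μ t) :=
    fun φ z => hf.integrable_smul ht (φ := fun y => φ (z + y))
      (φ.continuous.comp (by fun_prop)).stronglyMeasurable
      fun y => φ.toBoundedContinuousFunction.norm_coe_le_norm _
  constructor
  · intro φ ψ
    rw [smeared, smeared, smeared, ← integral_add (hf.integrable_mul_translateIntegral ht hc hC φ)
      (hf.integrable_mul_translateIntegral ht hc hC ψ)]
    refine integral_congr_ae (Eventually.of_forall fun z => ?_)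
    simp only [translateIntegral, add_apply, smul_add, ← mul_add]
    rw [integral_add (hi φ z) (hi ψ z)]
  · intro c φ
    rw [smeared, smeared, smul_eq_mul, ← integral_const_mul]
    refine integral_congr_ae (Eventually.of_forall fun z => ?_)
    simp only [translateIntegral, smul_apply]
    rw [mul_left_comm, ← smul_eq_mul (a := c), ← integral_smul]
    simp only [smul_comm c]

/-- Fubini, the shift x = z + y, and Fubini again. The convolution now acts on φ, where the
companion system operates, and h remains as a bounded weight that is never differentiated. -/
theorem ContFamily.pairing_convolution (hf : ContFamily S μ γ) {t : ℝ} (ht : t ∈ S)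
    {h : Sp d → ℝ} (hc : Continuous h) {C : ℝ} (hC : ∀ x, |h x| ≤ C) (φ : 𝓢(Sp d, ℂ)) :
    pairing (fun x => ∫ y, γ t y * h (x - y) ∂μ t) φ = smeared (μ t) (γ t) h φ := by
  have := hf.prob t ht
  have hi1 : Integrable (fun q : Sp d × Sp d => (γ t q.1 • φ q.2) * (h (q.2 - q.1) : ℂ))
      ((μ t).prod volume) :=
    ((hf.integrable t ht).smul_prod φ.integrable).mul_bdd (c := C)
      (Complex.continuous_ofReal.comp (hc.comp (by fun_prop :
        Continuous fun q : Sp d × Sp d => q.2 - q.1))).aestronglyMeasurable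
      (Eventually.of_forall fun q => by simpa using hC _)
  have hi2 : Integrable (fun q : Sp d × Sp d => (γ t q.1 • φ (q.2 + q.1)) * (h q.2 : ℂ))
      ((μ t).prod volume) :=
    (hf.integrable_translate ht φ).mul_bdd (c := C)
      (Complex.continuous_ofReal.comp (hc.comp continuous_snd)).aestronglyMeasurable
      (Eventually.of_forall fun q => by simpa using hC _)
  calc pairing (fun x => ∫ y, γ t y * h (x - y) ∂μ t) φ
      = ∫ x, ∫ y, (γ t y • φ x) * (h (x - y) : ℂ) ∂μ t := by
        refine integral_congr_ae (Eventually.of_forall fun x => ?_)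
        simp only
        rw [← integral_complex_ofReal, ← integral_mul_const]
        refine integral_congr_ae (Eventually.of_forall fun y => ?_)
        simp only [Complex.real_smul, Complex.ofReal_mul]
        ring
    _ = ∫ y, (∫ x, (γ t y • φ x) * (h (x - y) : ℂ)) ∂μ t :=
        (integral_integral_swap (f := fun y x => (γ t y • φ x) * (h (x - y) : ℂ)) hi1).symm
    _ = ∫ y, (∫ z, (γ t y • φ (z + y)) * (h z : ℂ)) ∂μ t := by
        refine integral_congr_ae (Eventually.of_forall fun y => ?_)
        simp only
        rw [← integral_add_right_eq_self _ y]
        simp only [add_sub_cancel_right]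
    _ = ∫ z, ∫ y, (γ t y • φ (z + y)) * (h z : ℂ) ∂μ t :=
        integral_integral_swap (f := fun y z => (γ t y • φ (z + y)) * (h z : ℂ)) hi2
    _ = _ := by
        refine integral_congr_ae (Eventually.of_forall fun z => ?_)
        simp only [translateIntegral]
        rw [integral_mul_const, mul_comm]

theorem ContFamily.integrable_prod_translateIntegral {T : EReal}
    (hf : ContFamily (timeSet T) μ γ) {t : ℝ} (ht : t ∈ timeSet T)
    {h : Sp d → ℝ} (hc : Continuous h) {C : ℝ} (hC : ∀ x, |h x| ≤ C) (φ : 𝓢(Sp d, ℂ)) :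
    Integrable (fun q : ℝ × Sp d => (h q.2 : ℂ) * translateIntegral (μ q.1) (γ q.1) φ q.2)
      ((volume.restrict (Ioc 0 t)).prod volume) := by
  obtain ⟨M, hM⟩ := hf.tv t ht
  have hsub : ∀ s ∈ Ioc 0 t, s ∈ timeSet T := fun s hs => timeSet_mono ht ⟨hs.1.le, hs.2⟩
  have hm : AEStronglyMeasurable (fun q : ℝ × Sp d => translateIntegral (μ q.1) (γ q.1) φ q.2)
      ((volume.restrict (Ioc 0 t)).prod volume) := by
    rw [← Measure.restrict_univ (μ := (volume : Measure (Sp d))), Measure.prod_restrict]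
    exact ((hf.continuousOn_translateIntegral φ).mono
      (prod_mono_left hsub)).aestronglyMeasurable (measurableSet_Ioc.prod MeasurableSet.univ)
  refine Integrable.bdd_mul (c := C) ?_
    (Complex.continuous_ofReal.comp (hc.comp continuous_snd)).aestronglyMeasurable
    (Eventually.of_forall fun q => by simpa using hC q.2)
  rw [integrable_prod_iff hm]
  constructor
  · filter_upwards [ae_restrict_mem measurableSet_Ioc] with s hs
      using hf.integrable_translateIntegral (hsub s hs) φ
  · refine Integrable.of_bound hm.norm.integral_prod_right' (M * ∫ z, ‖φ z‖) ?_
    filter_upwards [ae_restrict_mem measurableSet_Ioc] with s hs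
    rw [Real.norm_of_nonneg (integral_nonneg fun _ => norm_nonneg _)]
    exact (hf.integral_norm_translateIntegral_le (hsub s hs) φ).trans
      (mul_le_mul_of_nonneg_right (hM s ⟨hs.1.le, hs.2⟩) (integral_nonneg fun _ => norm_nonneg _))

end Smeared

/-! ### The companion system satisfied by convolutions with the Green functions -/

section GreenSystem

variable {d N : ℕ} [NeZero N] {a : ℕ → ℝ} {b : MvPolynomial (Fin d) ℝ} {T : EReal}
  {μ : Fin N → ℝ → Measure (Sp d)} {γ : Fin N → ℝ → Sp d → ℝ}

theorem GreenFamily.smeared_eq (hG : GreenFamily a b T μ γ) (n : Fin N) {t : ℝ}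
    (ht : t ∈ timeSet T) {h : Sp d → ℝ} (hc : Continuous h) {C : ℝ} (hC : ∀ x, |h x| ≤ C)
    (φ : 𝓢(Sp d, ℂ)) :
    smeared (μ n t) (γ n t) h φ = (if n = 0 then pairing h φ else 0) + ∫ s in Ioc 0 t,
      ∑ j, smeared (μ j s) (γ j s) h (companionOver N a (adjointLM b) j n φ) := by
  have hsub : ∀ s ∈ Ioc 0 t, s ∈ timeSet T := fun s hs => timeSet_mono ht ⟨hs.1.le, hs.2⟩
  have hint : ∀ j, Integrable (fun q : ℝ × Sp d => (h q.2 : ℂ) *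
      translateIntegral (μ j q.1) (γ j q.1) (companionOver N a (adjointLM b) j n φ) q.2)
      ((volume.restrict (Ioc 0 t)).prod volume) := fun j =>
    (hG.family j).integrable_prod_translateIntegral ht hc hC _
  have hsum := integrable_finsetSum Finset.univ fun j _ => hint j
  have e1 : ∫ s in Ioc 0 t, ∑ j, smeared (μ j s) (γ j s) h
      (companionOver N a (adjointLM b) j n φ) = ∫ z, ∫ s in Ioc 0 t, ∑ j, (h z : ℂ) *
      translateIntegral (μ j s) (γ j s) (companionOver N a (adjointLM b) j n φ) z := by
    rw [← integral_integral_swap (f := fun s z => ∑ j, (h z : ℂ) *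
      translateIntegral (μ j s) (γ j s) (companionOver N a (adjointLM b) j n φ) z) hsum]
    refine setIntegral_congr_fun measurableSet_Ioc fun s hs => ?_
    rw [integral_finsetSum _ fun j _ =>
      (hG.family j).integrable_mul_translateIntegral (hsub s hs) hc hC _]
    rfl
  have hφ : Integrable fun z => (h z : ℂ) * φ z :=
    φ.integrable.bdd_mul (c := C) (Complex.continuous_ofReal.comp hc).aestronglyMeasurable
      (Eventually.of_forall fun z => by simpa using hC z)
  have e2 : (if n = 0 then pairing h φ else 0)
      = ∫ z, (h z : ℂ) * (if n = 0 then φ z else 0) := by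
    split_ifs <;> simp [pairing]
  rw [e1, e2, ← integral_add ?_ hsum.integral_prod_right, smeared]
  · refine integral_congr_ae (Eventually.of_forall fun z => ?_)
    simp only
    rw [hG.translateIntegral_sub_eq n ht φ z, mul_add]
    congr 1
    rw [← integral_const_mul]
    simp only [Finset.mul_sum]
  · split_ifs
    · exact hφ
    · simp

/-- Continuity is taken from the convolution side, where it is the assumed joint continuity of g_n *
h. -/
theorem GreenFamily.smeared_continuousOn (hG : GreenFamily a b T μ γ) (n : Fin N) {h : Sp d → ℝ}
    (hc : Continuous h) {C : ℝ} (hC : ∀ x, |h x| ≤ C) (φ : 𝓢(Sp d, ℂ)) :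
    ContinuousOn (fun t => smeared (μ n t) (γ n t) h φ) (timeSet T) := by
  have h1 := (hG.family n).cont (BoundedContinuousFunction.ofNormedAddCommGroup h hc C hC)
  refine (pairing_continuousOn h1 (fun t ht => ?_) φ).congr fun t ht =>
    ((hG.family n).pairing_convolution ht hc hC φ).symm
  obtain ⟨M, hM⟩ := (hG.family n).tv t ht
  refine ⟨M * C, fun s hs x => ?_⟩
  exact ((hG.family n).norm_integral_smul_le (timeSet_mono ht hs) (φ := fun y => h (x - y))
    fun y => hC _).trans
    (mul_le_mul_of_nonneg_right (hM s hs) ((abs_nonneg _).trans (hC 0)))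

theorem GreenFamily.companionSystem_smeared (hG : GreenFamily a b T μ γ) {h : Sp d → ℝ}
    (hc : Continuous h) {C : ℝ} (hC : ∀ x, |h x| ≤ C) :
    CompanionSystem (timeSet T) a (adjointLM b) (fun _ _ => 0)
      (fun n t φ => smeared (μ n t) (γ n t) h φ) := by
  refine ⟨fun j t ht => (hG.family j).smeared_isLinearMap ht hc hC, fun n φ t ht => ?_⟩
  have h1 : ContinuousOn (fun s => ∑ j, smeared (μ j s) (γ j s) h
      (companionOver N a (adjointLM b) j n φ)) (timeSet T) :=
    continuousOn_finsetSum _ fun j _ => hG.smeared_continuousOn j hc hC _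
  have h2 := (hasDerivWithinAt_integral_timeSet h1 ht).const_add
    (if n = 0 then pairing h φ else 0)
  simp only [ite_self, zero_add]
  exact h2.congr (fun s hs => hG.smeared_eq n hs hc hC φ) (hG.smeared_eq n ht hc hC φ)

theorem GreenFamily.smeared_zero (hG : GreenFamily a b T μ γ) (hT : 0 < T) {h : Sp d → ℝ}
    (hc : Continuous h) {C : ℝ} (hC : ∀ x, |h x| ≤ C) (n : Fin N) (φ : 𝓢(Sp d, ℂ)) :
    smeared (μ n 0) (γ n 0) h φ = if n = 0 then pairing h φ else 0 := by
  rw [hG.smeared_eq n (zero_mem_timeSet hT) hc hC φ]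
  simp

end GreenSystem

/-! ### Duhamel's formula -/

theorem integral_triangle_swap {t : ℝ} {G : ℝ → ℝ → ℂ}
    (hG : ContinuousOn (fun q : ℝ × ℝ => G q.1 q.2) (Icc 0 t ×ˢ Icc 0 t)) :
    ∫ s in Ioc 0 t, ∫ σ in Ioc 0 s, G s σ = ∫ σ in Ioc 0 t, ∫ s in Ioc σ t, G s σ := by
  have hi : Integrable (fun q : ℝ × ℝ => {q : ℝ × ℝ | q.2 ≤ q.1}.indicator
      (fun q => G q.1 q.2) q) ((volume.restrict (Ioc 0 t)).prod (volume.restrict (Ioc 0 t))) := by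
    refine Integrable.indicator ?_ (measurableSet_le measurable_snd measurable_fst)
    rw [Measure.prod_restrict]
    exact (hG.integrableOn_compact (isCompact_Icc.prod isCompact_Icc)).mono_set
      (prod_mono Ioc_subset_Icc_self Ioc_subset_Icc_self)
  have h1 := integral_integral_swap (f := fun s σ => {q : ℝ × ℝ | q.2 ≤ q.1}.indicator
      (fun q => G q.1 q.2) (s, σ)) hi
  calc _ = ∫ s in Ioc 0 t, ∫ σ in Ioc 0 t,
        {q : ℝ × ℝ | q.2 ≤ q.1}.indicator (fun q => G q.1 q.2) (s, σ) := by
        refine setIntegral_congr_fun measurableSet_Ioc fun s hs => ?_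
        have e : ∀ σ, {q : ℝ × ℝ | q.2 ≤ q.1}.indicator (fun q => G q.1 q.2) (s, σ)
            = (Iic s).indicator (G s) σ := fun σ => rfl
        simp only [e]
        rw [setIntegral_indicator measurableSet_Iic, Ioc_inter_Iic, min_eq_right hs.2]
    _ = _ := h1
    _ = _ := by
        refine setIntegral_congr_fun measurableSet_Ioc fun σ hσ => ?_
        have e : ∀ s, {q : ℝ × ℝ | q.2 ≤ q.1}.indicator (fun q => G q.1 q.2) (s, σ)
            = (Ici σ).indicator (fun s => G s σ) s := fun s => rfl
        simp only [e]
        rw [setIntegral_indicator measurableSet_Ici, ← integral_Icc_eq_integral_Ioc]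
        congr 2
        ext s
        exact ⟨fun h => ⟨h.2, h.1.2⟩, fun h => ⟨⟨hσ.1.trans_le h.1, h.2⟩, h.1⟩⟩

theorem integral_Ioc_comp_sub {t : ℝ} (ht : 0 ≤ t) (f : ℝ → ℂ) :
    ∫ s in Ioc 0 t, f (t - s) = ∫ r in Ioc 0 t, f r := by
  rw [← intervalIntegral.integral_of_le ht, ← intervalIntegral.integral_of_le ht,
    intervalIntegral.integral_comp_sub_left f t, sub_self, sub_zero]

/-- After the order of integration is exchanged, for fixed σ both inner integrals equal ∫_0^{t-σ}
D(σ, r) dr, by r = t - s on one side and r = s - σ on the other. -/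
theorem integral_triangle_reflect {t : ℝ} {D : ℝ → ℝ → ℂ}
    (hD : ContinuousOn (fun q : ℝ × ℝ => D q.1 q.2) (Icc 0 t ×ˢ univ)) :
    ∫ s in Ioc 0 t, ∫ σ in Ioc 0 s, D σ (t - s)
      = ∫ s in Ioc 0 t, ∫ σ in Ioc 0 s, D σ (s - σ) := by
  rw [integral_triangle_swap (G := fun s σ => D σ (t - s)), integral_triangle_swap
    (G := fun s σ => D σ (s - σ))]
  · refine setIntegral_congr_fun measurableSet_Ioc fun σ hσ => ?_
    rw [← intervalIntegral.integral_of_le hσ.2, ← intervalIntegral.integral_of_le hσ.2,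
      intervalIntegral.integral_comp_sub_left (D σ) t,
      intervalIntegral.integral_comp_sub_right (D σ) σ, sub_self, sub_self]
  · exact hD.comp (f := fun q : ℝ × ℝ => (q.2, q.1 - q.2)) (by fun_prop)
      fun q hq => ⟨hq.2, mem_univ _⟩
  · exact hD.comp (f := fun q : ℝ × ℝ => (q.2, t - q.1)) (by fun_prop)
      fun q hq => ⟨hq.2, mem_univ _⟩

theorem pairing_isLinearMap {d : ℕ} {v : Sp d → ℝ} (hv : Continuous v) {C : ℝ}
    (hC : ∀ x, |v x| ≤ C) : IsLinearMap ℂ (pairing v) := by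
  have hi : ∀ φ : 𝓢(Sp d, ℂ), Integrable fun x => (v x : ℂ) * φ x := fun φ =>
    φ.integrable.bdd_mul (c := C) (Complex.continuous_ofReal.comp hv).aestronglyMeasurable
      (Eventually.of_forall fun z => by simpa using hC z)
  refine ⟨fun φ ψ => ?_, fun c φ => ?_⟩
  · simp only [pairing, add_apply, mul_add]
    exact integral_add (hi φ) (hi ψ)
  · simp only [pairing, smul_apply, smul_eq_mul, mul_left_comm _ c]
    exact integral_const_mul _ _

theorem continuous_integral_mul_of_bounded {d : ℕ} {F : ℝ → Sp d → ℝ}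
    (hF : Continuous fun q : ℝ × Sp d => F q.1 q.2) {C : ℝ} (hC : ∀ s x, |F s x| ≤ C)
    {g : Sp d → ℂ} (hg : Integrable g) : Continuous fun r => ∫ z, (F r z : ℂ) * g z := by
  refine continuous_of_dominated (bound := fun z => C * ‖g z‖) (fun r => ?_) (fun r => ?_)
    (hg.norm.const_mul C) (Eventually.of_forall fun z => ?_)
  · exact (Complex.continuous_ofReal.comp (hF.comp (by fun_prop :
      Continuous fun z : Sp d => (r, z)))).aestronglyMeasurable.mul hg.1
  · refine Eventually.of_forall fun z => ?_
    rw [norm_mul, Complex.norm_real]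
    exact mul_le_mul_of_nonneg_right (hC r z) (norm_nonneg _)
  · exact (Complex.continuous_ofReal.comp (hF.comp (by fun_prop :
      Continuous fun r : ℝ => (r, z)))).mul continuous_const

section GreenSystem

variable {d N : ℕ} [NeZero N] {a : ℕ → ℝ} {b : MvPolynomial (Fin d) ℝ} {T : EReal}
  {μ : Fin N → ℝ → Measure (Sp d)} {γ : Fin N → ℝ → Sp d → ℝ}

theorem ContFamily.pairing_duhamel {μ : ℝ → Measure (Sp d)} {γ : ℝ → Sp d → ℝ}
    (hf : ContFamily (timeSet T) μ γ) {F : ℝ → Sp d → ℝ}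
    (hF : Continuous fun q : ℝ × Sp d => F q.1 q.2) {C : ℝ} (hC : ∀ s x, |F s x| ≤ C)
    {t : ℝ} (ht : t ∈ timeSet T) (φ : 𝓢(Sp d, ℂ)) :
    pairing (duhamel μ γ F t) φ = ∫ s in Ioc 0 t, smeared (μ s) (γ s) (F (t - s)) φ := by
  have hC0 : 0 ≤ C := (abs_nonneg _).trans (hC 0 0)
  have hsub : ∀ s ∈ Ioc 0 t, s ∈ timeSet T := fun s hs => timeSet_mono ht ⟨hs.1.le, hs.2⟩
  obtain ⟨M, hM⟩ := hf.tv t ht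
  have hmem : ∀ᵐ q ∂((volume.restrict (Ioc 0 t)).prod (volume : Measure (Sp d))),
      q.1 ∈ Ioc 0 t := by
    rw [← Measure.restrict_univ (μ := (volume : Measure (Sp d))), Measure.prod_restrict]
    filter_upwards [ae_restrict_mem (measurableSet_Ioc.prod MeasurableSet.univ)] with q hq
      using hq.1
  have hm : AEStronglyMeasurable (fun q : ℝ × Sp d =>
      ((∫ y, γ q.1 y * F (t - q.1) (q.2 - y) ∂μ q.1 : ℝ) : ℂ))
      ((volume.restrict (Ioc 0 t)).prod volume) := by
    refine Complex.continuous_ofReal.comp_aestronglyMeasurable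
      ((hf.measurable_convolution hF hC t).aestronglyMeasurable.congr ?_)
    filter_upwards [hmem] with q hq
    rw [indicator_of_mem]
    exact ⟨hsub _ hq, mem_univ _⟩
  have hi : Integrable (fun q : ℝ × Sp d =>
      ((∫ y, γ q.1 y * F (t - q.1) (q.2 - y) ∂μ q.1 : ℝ) : ℂ) * φ q.2)
      ((volume.restrict (Ioc 0 t)).prod volume) := by
    refine Integrable.bdd_mul (c := M * C) (φ.integrable.comp_snd _) hm ?_
    filter_upwards [hmem] with q hq
    rw [Complex.norm_real]
    exact (hf.abs_convolution_le hC (hsub _ hq) t q.2).trans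
      (mul_le_mul_of_nonneg_right (hM _ ⟨hq.1.le, hq.2⟩) hC0)
  calc pairing (duhamel μ γ F t) φ
      = ∫ x, ∫ s in Ioc 0 t, ((∫ y, γ s y * F (t - s) (x - y) ∂μ s : ℝ) : ℂ) * φ x := by
        refine integral_congr_ae (Eventually.of_forall fun x => ?_)
        simp only [duhamel]
        rw [← integral_complex_ofReal, ← integral_mul_const]
    _ = ∫ s in Ioc 0 t, ∫ x, ((∫ y, γ s y * F (t - s) (x - y) ∂μ s : ℝ) : ℂ) * φ x :=
        (integral_integral_swap (f := fun s x =>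
          ((∫ y, γ s y * F (t - s) (x - y) ∂μ s : ℝ) : ℂ) * φ x) hi).symm
    _ = _ := setIntegral_congr_fun measurableSet_Ioc fun s hs =>
        hf.pairing_convolution (hsub s hs) (hF.comp (by fun_prop :
          Continuous fun z : Sp d => (t - s, z))) (hC _) φ

/-- Separate continuity is upgraded to joint continuity: the system bounds the derivative in the
first variable uniformly in r, so the map is Lipschitz there, and it is continuous in r by dominated
convergence. -/
theorem GreenFamily.smeared_continuousOn_prod (hG : GreenFamily a b T μ γ) (n : Fin N)
    {F : ℝ → Sp d → ℝ} (hF : Continuous fun q : ℝ × Sp d => F q.1 q.2) {C : ℝ}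
    (hC : ∀ s x, |F s x| ≤ C) (φ : 𝓢(Sp d, ℂ)) {t : ℝ} (ht : t ∈ timeSet T) :
    ContinuousOn (fun q : ℝ × ℝ => smeared (μ n q.1) (γ n q.1) (F q.2) φ) (Icc 0 t ×ˢ univ) := by
  have hC0 : 0 ≤ C := (abs_nonneg _).trans (hC 0 0)
  have hslice : ∀ r, Continuous (F r) := fun r =>
    hF.comp (by fun_prop : Continuous fun z : Sp d => (r, z))
  choose M hM using fun j => (hG.family j).tv t ht
  let B : Fin N → 𝓢(Sp d, ℂ) := fun j => companionOver N a (adjointLM b) j n φ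
  have hLip : ∀ r ∈ (univ : Set ℝ), LipschitzOnWith
      (Real.toNNReal (∑ j, C * (M j * ∫ z, ‖B j z‖)))
      (fun s => smeared (μ n s) (γ n s) (F r) φ) (Icc 0 t) := fun r _ => by
    have hsys := hG.companionSystem_smeared (hslice r) (hC r)
    refine Convex.lipschitzOnWith_of_nnnorm_hasDerivWithin_le (convex_Icc 0 t)
      (fun s hs => (hsys.deriv n φ s (timeSet_mono ht hs)).mono fun s hs => timeSet_mono ht hs) ?_
    intro s hs
    rw [← NNReal.coe_le_coe, coe_nnnorm]
    refine le_trans ?_ (Real.le_coe_toNNReal _)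
    rw [ite_self, zero_add]
    refine norm_sum_le_of_le _ fun j _ => ?_
    refine ((hG.family j).norm_smeared_le (timeSet_mono ht hs) (hC r) (B j)).trans ?_
    exact mul_le_mul_of_nonneg_left (mul_le_mul_of_nonneg_right (hM j s hs)
      (integral_nonneg fun _ => norm_nonneg _)) hC0
  refine continuousOn_prod_of_continuousOn_lipschitzOnWith _
    (Real.toNNReal (∑ j, C * (M j * ∫ z, ‖B j z‖))) (fun s hs => ?_) hLip
  exact (continuous_integral_mul_of_bounded hF hC
    ((hG.family n).integrable_translateIntegral (timeSet_mono ht hs) φ)).continuousOn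

/-- Inserting the integrated system for g_n(s) * F(t-s) leaves ∫_0^t A(t-s) ds and a double integral
over a triangle. Reflecting the triangle makes the inner integral a Duhamel term at the intermediate
time r. -/
theorem GreenFamily.duhamel_eq (hG : GreenFamily a b T μ γ) (n : Fin N)
    {F : ℝ → Sp d → ℝ} (hF : Continuous fun q : ℝ × Sp d => F q.1 q.2) {C : ℝ}
    (hC : ∀ s x, |F s x| ≤ C) (φ : 𝓢(Sp d, ℂ)) {t : ℝ} (ht : t ∈ timeSet T) :
    pairing (duhamel (μ n) (γ n) F t) φ = ∫ r in Ioc 0 t,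
      ((if n = 0 then pairing (F r) φ else 0) +
      ∑ j, pairing (duhamel (μ j) (γ j) F r) (companionOver N a (adjointLM b) j n φ)) := by
  have hslice : ∀ r, Continuous (F r) := fun r =>
    hF.comp (by fun_prop : Continuous fun z : Sp d => (r, z))
  have hsub : ∀ s ∈ Ioc 0 t, s ∈ timeSet T := fun s hs => timeSet_mono ht ⟨hs.1.le, hs.2⟩
  set B : Fin N → 𝓢(Sp d, ℂ) := fun j => companionOver N a (adjointLM b) j n φ with hB
  let A : ℝ → ℂ := fun r => if n = 0 then pairing (F r) φ else 0
  have hA : Continuous A := by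
    by_cases hn : n = 0
    · simp only [A, if_pos hn]
      exact continuous_integral_mul_of_bounded hF hC φ.integrable
    · simp only [A, if_neg hn]
      exact continuous_const
  let D : ℝ → ℝ → ℂ := fun σ r => ∑ j, smeared (μ j σ) (γ j σ) (F r) (B j)
  have hD : ContinuousOn (fun q : ℝ × ℝ => D q.1 q.2) (Icc 0 t ×ˢ univ) :=
    continuousOn_finsetSum _ fun j _ => hG.smeared_continuousOn_prod j hF hC (B j) ht
  have hKA : ∀ s ∈ Ioc 0 t, smeared (μ n s) (γ n s) (F (t - s)) φ
      = A (t - s) + ∫ σ in Ioc 0 s, D σ (t - s) := fun s hs =>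
    hG.smeared_eq n (hsub s hs) (hslice _) (hC _) φ
  have hAi : IntegrableOn (fun s => A (t - s)) (Ioc 0 t) :=
    ((hA.comp (by fun_prop : Continuous fun s : ℝ => t - s)).integrableOn_Icc).mono_set
      Ioc_subset_Icc_self
  have hKi : IntegrableOn (fun s => smeared (μ n s) (γ n s) (F (t - s)) φ) (Ioc 0 t) := by
    have h1 := (hG.smeared_continuousOn_prod n hF hC φ ht).comp
      (f := fun s : ℝ => (s, t - s)) (s := Icc 0 t) (by fun_prop) fun s hs => ⟨hs, mem_univ _⟩
    exact (h1.integrableOn_compact isCompact_Icc).mono_set Ioc_subset_Icc_self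
  -- By `hKA` this function is the difference of two integrable ones.
  have hBi : IntegrableOn (fun s => ∫ σ in Ioc 0 s, D σ (t - s)) (Ioc 0 t) := by
    refine (hKi.sub hAi).congr_fun (fun s hs => ?_) measurableSet_Ioc
    simp only [Pi.sub_apply, hKA s hs, add_sub_cancel_left]
  have hcont : ∀ j, ContinuousOn (fun r => pairing (duhamel (μ j) (γ j) F r) (B j)) (timeSet T) :=
    fun j => pairing_continuousOn ((hG.family j).duhamel_continuousOn hF hC)
      (fun t ht => (hG.family j).duhamel_bound hC ht) _
  have hDQ : ∀ r ∈ Icc 0 t, ∫ σ in Ioc 0 r, D σ (r - σ)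
      = ∑ j, pairing (duhamel (μ j) (γ j) F r) (B j) := fun r hr => by
    have hr' := timeSet_mono ht hr
    have hsumi : ∀ j ∈ (Finset.univ : Finset (Fin N)),
        IntegrableOn (fun σ => smeared (μ j σ) (γ j σ) (F (r - σ)) (B j)) (Ioc 0 r) := fun j _ => by
      have h1 := (hG.smeared_continuousOn_prod j hF hC (B j) hr').comp
        (f := fun s : ℝ => (s, r - s)) (s := Icc 0 r) (by fun_prop) fun s hs => ⟨hs, mem_univ _⟩
      exact (h1.integrableOn_compact isCompact_Icc).mono_set Ioc_subset_Icc_self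
    simp only [D]
    rw [integral_finsetSum _ hsumi]
    exact Finset.sum_congr rfl fun j _ => ((hG.family j).pairing_duhamel hF hC hr' (B j)).symm
  rw [(hG.family n).pairing_duhamel hF hC ht, setIntegral_congr_fun measurableSet_Ioc hKA,
    integral_add hAi hBi, integral_Ioc_comp_sub ht.1 A, integral_triangle_reflect hD,
    ← integral_add (hA.integrableOn_Icc.mono_set Ioc_subset_Icc_self)]
  · refine setIntegral_congr_fun measurableSet_Ioc fun r hr => ?_
    simp only [hDQ r ⟨hr.1.le, hr.2⟩, A, hB]
  · have h2 : ContinuousOn (fun r => ∑ j, pairing (duhamel (μ j) (γ j) F r) (B j)) (Icc 0 t) :=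
      continuousOn_finsetSum _ fun j _ => (hcont j).mono fun s hs => timeSet_mono ht hs
    exact ((h2.congr hDQ).integrableOn_compact isCompact_Icc).mono_set Ioc_subset_Icc_self

theorem GreenFamily.companionSystem_duhamel (hG : GreenFamily a b T μ γ)
    {F : ℝ → Sp d → ℝ} (hF : Continuous fun q : ℝ × Sp d => F q.1 q.2) {C : ℝ}
    (hC : ∀ s x, |F s x| ≤ C) :
    CompanionSystem (timeSet T) a (adjointLM b) (fun t => pairing (F t))
      (fun n t => pairing (duhamel (μ n) (γ n) F t)) := by
  refine ⟨fun j t ht => ?_, fun n φ t ht => ?_⟩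
  · obtain ⟨K, hK⟩ := (hG.family j).duhamel_bound hC ht
    refine pairing_isLinearMap ?_ (hK t ⟨ht.1, le_rfl⟩)
    exact continuousOn_univ.1 (((hG.family j).duhamel_continuousOn hF hC).comp
      (f := fun x : Sp d => (t, x)) (by fun_prop) fun x _ => ⟨ht, mem_univ _⟩)
  · have h1 : ContinuousOn (fun r => (if n = 0 then pairing (F r) φ else 0) + ∑ j,
        pairing (duhamel (μ j) (γ j) F r) (companionOver N a (adjointLM b) j n φ)) (timeSet T) := by
      refine ContinuousOn.add ?_ (continuousOn_finsetSum _ fun j _ =>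
        pairing_continuousOn ((hG.family j).duhamel_continuousOn hF hC)
        (fun t ht => (hG.family j).duhamel_bound hC ht) _)
      split_ifs
      · exact (continuous_integral_mul_of_bounded hF hC φ.integrable).continuousOn
      · exact continuousOn_const
    exact (hasDerivWithinAt_integral_timeSet h1 ht).congr
      (fun s hs => hG.duhamel_eq n hF hC φ hs) (hG.duhamel_eq n hF hC φ ht)

end GreenSystem

/-! ### Existence of a solution -/

section Existence

variable {d N : ℕ} [NeZero N] {a : ℕ → ℝ} {b : MvPolynomial (Fin d) ℝ} {T : EReal}
  {μ : Fin N → ℝ → Measure (Sp d)} {γ : Fin N → ℝ → Sp d → ℝ}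

/-- The solution given by the Green functions. -/
noncomputable def greenSolution (p : Fin N → ℝ) (f : Fin N → Sp d →ᵇ ℝ) (F : ℝ → Sp d → ℝ)
    (μ : Fin N → ℝ → Measure (Sp d)) (γ : Fin N → ℝ → Sp d → ℝ) (t : ℝ) (x : Sp d) : ℝ :=
  (∑ n, p n * ∫ y, γ n t y * f n (x - y) ∂μ n t) + duhamel (μ ⊤) (γ ⊤) F t x

theorem GreenFamily.greenSolution_continuousOn (hG : GreenFamily a b T μ γ) (p : Fin N → ℝ)
    (f : Fin N → Sp d →ᵇ ℝ) {F : ℝ → Sp d → ℝ} (hF : Continuous fun q : ℝ × Sp d => F q.1 q.2)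
    {C : ℝ} (hC : ∀ s x, |F s x| ≤ C) :
    ContinuousOn (fun q : ℝ × Sp d => greenSolution p f F μ γ q.1 q.2) (timeSet T ×ˢ univ) :=
  (continuousOn_finsetSum _ fun n _ => continuousOn_const.mul ((hG.family n).cont (f n))).add
    ((hG.family ⊤).duhamel_continuousOn hF hC)

theorem GreenFamily.greenSolution_bounded (hG : GreenFamily a b T μ γ) (p : Fin N → ℝ)
    (f : Fin N → Sp d →ᵇ ℝ) {F : ℝ → Sp d → ℝ} {C : ℝ} (hC : ∀ s x, |F s x| ≤ C)
    {t : ℝ} (ht : t ∈ timeSet T) :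
    ∃ K : ℝ, ∀ s ∈ Icc 0 t, ∀ x, |greenSolution p f F μ γ s x| ≤ K := by
  obtain ⟨K, hK⟩ := (hG.family ⊤).duhamel_bound hC ht
  choose M hM using fun j => (hG.family j).tv t ht
  refine ⟨(∑ n, |p n| * (M n * ‖f n‖)) + K, fun s hs x => ?_⟩
  refine (abs_add_le _ _).trans (add_le_add ((Finset.abs_sum_le_sum_abs _ _).trans
    (Finset.sum_le_sum fun n _ => ?_)) (hK s hs x))
  rw [abs_mul]
  refine mul_le_mul_of_nonneg_left ?_ (abs_nonneg _)
  exact ((hG.family n).norm_integral_smul_le (timeSet_mono ht hs) (φ := fun y => f n (x - y))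
    fun y => (f n).norm_coe_le_norm _).trans
    (mul_le_mul_of_nonneg_right (hM n s hs) (norm_nonneg _))

theorem GreenFamily.pairing_greenSolution (hG : GreenFamily a b T μ γ) (p : Fin N → ℝ)
    (f : Fin N → Sp d →ᵇ ℝ) {F : ℝ → Sp d → ℝ} (hF : Continuous fun q : ℝ × Sp d => F q.1 q.2)
    {C : ℝ} (hC : ∀ s x, |F s x| ≤ C) {t : ℝ} (ht : t ∈ timeSet T) (φ : 𝓢(Sp d, ℂ)) :
    pairing (greenSolution p f F μ γ t) φ
      = (∑ n, (p n : ℂ) * smeared (μ n t) (γ n t) (f n) φ)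
        + pairing (duhamel (μ ⊤) (γ ⊤) F t) φ := by
  have hi : ∀ {v : Sp d → ℝ} (_ : Continuous v) {K : ℝ} (_ : ∀ x, |v x| ≤ K),
      Integrable fun x => (v x : ℂ) * φ x := fun hv K hK =>
    φ.integrable.bdd_mul (c := K) (Complex.continuous_ofReal.comp hv).aestronglyMeasurable
      (Eventually.of_forall fun z => by simpa using hK z)
  have h1 : ∀ n, Integrable fun x => ((∫ y, γ n t y * f n (x - y) ∂μ n t : ℝ) : ℂ) * φ x := fun n =>
    hi (continuousOn_univ.1 (((hG.family n).cont (f n)).comp (f := fun x : Sp d => (t, x))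
      (by fun_prop) fun x _ => ⟨ht, mem_univ _⟩)) fun x =>
      (hG.family n).norm_integral_smul_le ht (φ := fun y => f n (x - y))
        fun y => (f n).norm_coe_le_norm _
  obtain ⟨K, hK⟩ := (hG.family ⊤).duhamel_bound hC ht
  have h2 : Integrable fun x => (duhamel (μ ⊤) (γ ⊤) F t x : ℂ) * φ x :=
    hi (continuousOn_univ.1 (((hG.family ⊤).duhamel_continuousOn hF hC).comp
      (f := fun x : Sp d => (t, x)) (by fun_prop) fun x _ => ⟨ht, mem_univ _⟩)) (hK t ⟨ht.1, le_rfl⟩)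
  simp only [← (hG.family _).pairing_convolution ht (f _).continuous (f _).norm_coe_le_norm φ]
  simp only [pairing, ← integral_const_mul]
  rw [← integral_finsetSum _ fun n _ => (h1 n).const_mul _,
    ← integral_add (integrable_finsetSum _ fun n _ => (h1 n).const_mul _) h2]
  refine integral_congr_ae (Eventually.of_forall fun x => ?_)
  simp only [greenSolution]
  push_cast
  rw [add_mul, Finset.sum_mul]
  simp only [mul_assoc]

/-- Component n of the system driven by f_n and the last component of the Duhamel system are
differentiated N times. The sources vanish along the way except for F at the very end, and the
characteristic equation of C assembles the derivatives. -/
theorem GreenFamily.isSolution (hG : GreenFamily a b T μ γ) (hT : 0 < T) (ha : a N = 1)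
    (p : Fin N → ℝ) (f : Fin N → Sp d →ᵇ ℝ) {F : ℝ → Sp d → ℝ}
    (hF : Continuous fun q : ℝ × Sp d => F q.1 q.2) {C : ℝ} (hC : ∀ s x, |F s x| ≤ C) :
    IsSolution a b p f F T (greenSolution p f F μ γ) := by
  have hS := uniqueDiffOn_timeSet hT
  let L := adjointLM b
  let K : Fin N → Fin N → ℝ → 𝓢(Sp d, ℂ) → ℂ := fun n j t φ => smeared (μ j t) (γ j t) (f n) φ
  let Q : Fin N → ℝ → 𝓢(Sp d, ℂ) → ℂ := fun j t => pairing (duhamel (μ j) (γ j) F t)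
  have hK : ∀ n, CompanionSystem (timeSet T) a L (fun _ _ => 0) (K n) := fun n =>
    hG.companionSystem_smeared (f n).continuous (f n).norm_coe_le_norm
  have hQ : CompanionSystem (timeSet T) a L (fun t => pairing (F t)) Q :=
    hG.companionSystem_duhamel hF hC
  -- F is added only at m = N: it arises when the derivative of order N - 1 of the Duhamel term is
  -- differentiated, and it is not differentiated again.
  let y : 𝓢(Sp d, ℂ) → ℕ → ℝ → ℂ := fun φ m t =>
    (∑ n, (p n : ℂ) * systemDeriv a L (K n) n φ m t) +
      (systemDeriv a L Q ⊤ φ m t + if m = N then pairing (F t) φ else 0)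
  have htop : ((⊤ : Fin N) : ℕ) + 1 = N := by
    have := Fin.val_top N
    have := NeZero.pos N
    omega
  have hy : ∀ φ, ∀ m < N, ∀ t ∈ timeSet T,
      HasDerivWithinAt (y φ m) (y φ (m + 1) t) (timeSet T) t := fun φ m hm t ht => by
    have h1 := (HasDerivWithinAt.fun_sum (u := Finset.univ) fun (n : Fin N) _ =>
      ((hK n).hasDerivWithinAt n φ m ht).const_mul (p n : ℂ)).add
      (hQ.hasDerivWithinAt ⊤ φ m ht)
    -- The first row of C^m has its 1 in column m, and the last column is N - 1.
    have h2 : pairing (F t) ((companionOver N a L ^ m) 0 ⊤ φ)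
        = if m + 1 = N then pairing (F t) φ else 0 := by
      rw [companionOver_pow_zero_apply a L hm]
      by_cases h : m + 1 = N
      · rw [if_pos (by omega), if_pos h]; rfl
      · rw [if_neg (by omega), if_neg h]; simp [pairing]
    refine (h1.congr_deriv ?_).congr_of_mem (fun s _ => ?_) ht
    · simp only [y, zero_add, h2]
      ring
    · simp only [y, if_neg hm.ne, add_zero, Pi.add_apply]
  have hyc : ∀ φ, ContinuousOn (y φ N) (timeSet T) := fun φ => by
    have hc : ∀ (U : Fin N → ℝ → 𝓢(Sp d, ℂ) → ℂ) (src : ℝ → 𝓢(Sp d, ℂ) → ℂ),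
        CompanionSystem (timeSet T) a L src U → ∀ n,
        ContinuousOn (systemDeriv a L U n φ N) (timeSet T) := fun U src hU n t ht =>
      (hU.hasDerivWithinAt n φ N ht).continuousWithinAt
    refine (continuousOn_finsetSum _ fun n _ => continuousOn_const.mul (hc _ _ (hK n) n)).add
      ((hc _ _ hQ ⊤).add ?_)
    simp only [if_true]
    exact (continuous_integral_mul_of_bounded hF hC φ.integrable).continuousOn
  have hy0 : ∀ φ, EqOn (fun t => pairing (greenSolution p f F μ γ t) φ) (y φ 0) (timeSet T) :=
    fun φ t ht => by
    simp only [y, if_neg (NeZero.ne N).symm, add_zero]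
    rw [hG.pairing_greenSolution p f hF hC ht, hQ.systemDeriv_zero ⊤ φ ht]
    simp only [(hK _).systemDeriv_zero _ φ ht]
    rfl
  have hiter : ∀ φ, ∀ m ≤ N, ∀ t ∈ timeSet T, iteratedDerivWithin m
      (fun t => pairing (greenSolution p f F μ γ t) φ) (timeSet T) t = y φ m t :=
    fun φ m hm t ht => by
    rw [iteratedDerivWithin_congr (hy0 φ) ht]
    exact iteratedDerivWithin_eq_of_hasDerivWithinAt hS N (hy φ) m hm t ht
  refine ⟨hG.greenSolution_continuousOn p f hF hC, fun t ht => hG.greenSolution_bounded p f hC ht,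
    fun φ => (contDiffOn_of_hasDerivWithinAt hS N (hy φ) (hyc φ)).congr (hy0 φ),
    fun φ t ht => ?_, fun φ n => ?_⟩
  · rw [Finset.sum_congr rfl fun k hk => by rw [hiter φ k (Finset.mem_Icc.1 hk).2 t ht]]
    have h1 : ∑ k ∈ Finset.Icc 1 N, (a k : ℂ) * y φ k t
        = (∑ n, (p n : ℂ) * K n n t (L φ)) + (Q ⊤ t (L φ) + pairing (F t) φ) := by
      simp only [y, mul_add, Finset.sum_add_distrib]
      rw [hQ.sum_systemDeriv ha ⊤ φ ht]
      congr 1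
      · simp only [Finset.mul_sum]
        rw [Finset.sum_comm]
        refine Finset.sum_congr rfl fun n _ => ?_
        rw [← (hK n).sum_systemDeriv ha n φ ht, Finset.mul_sum]
        exact Finset.sum_congr rfl fun k _ => by ring
      · congr 1
        simp only [mul_ite, mul_zero]
        rw [Finset.sum_ite_eq', if_pos (Finset.mem_Icc.2 ⟨NeZero.one_le, le_rfl⟩), ha]
        simp
    have h2 : adjointOp b φ = L φ := rfl
    rw [h1, h2, hG.pairing_greenSolution p f hF hC ht]
    ring
  · rw [hiter φ n n.2.le 0 (zero_mem_timeSet hT)]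
    have h1 : ∀ m, systemDeriv a L (K m) m φ n 0 = if m = n then pairing (f m) φ else 0 := fun m => by
      rw [systemDeriv_initial (I := pairing (f m)) (by simp [pairing])
        (fun j φ => hG.smeared_zero hT (f m).continuous (f m).norm_coe_le_norm j φ) m φ n.2]
      simp only [Fin.ext_iff]
    have h2 : systemDeriv a L Q ⊤ φ n 0 = 0 := by
      rw [systemDeriv_initial (I := fun _ => 0) rfl (fun j φ => by simp [Q, duhamel, pairing]) ⊤ φ n.2,
        ite_self]
    simp only [y, h1, h2, if_neg n.2.ne]
    simp

end Existence

/-! ### Uniqueness of the solution -/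

section Growth

variable {d : ℕ}

theorem tsupport_subset_of_eq_mul {f g h : Sp d → ℂ} (hfg : ∀ x, f x = h x * g x) :
    tsupport f ⊆ tsupport g :=
  closure_mono fun x hx hg => hx (by rw [hfg, hg, mul_zero])

/-- Repeated multiplication by a smooth function lets the derivatives of a compactly supported
function grow at most geometrically. -/
theorem exists_geometric_bound_iteratedFDeriv {σ : Sp d → ℂ} (hσ : ContDiff ℝ ⊤ σ)
    {ψ : ℕ → 𝓢(Sp d, ℂ)} (h0 : HasCompactSupport (ψ 0))
    (hψ : ∀ n x, ψ (n + 1) x = σ x * ψ n x) (m : ℕ) :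
    ∃ R : ℝ, 0 < R ∧ ∀ k : ℕ, ∃ C : ℝ, 0 ≤ C ∧ ∀ n, ∀ i ≤ m,
      SchwartzMap.seminorm ℂ k i (ψ n) ≤ C * R ^ n := by
  have hsupp : ∀ n, tsupport (ψ n) ⊆ tsupport (ψ 0) := fun n => by
    induction n with
    | zero => exact subset_rfl
    | succ n ih => exact (tsupport_subset_of_eq_mul (hψ n)).trans ih
  have hbd : ∀ i, ∃ S : ℝ, ∀ x ∈ tsupport (ψ 0), ‖iteratedFDeriv ℝ i σ x‖ ≤ S := fun i =>
    h0.exists_bound_of_continuousOn (hσ.continuous_iteratedFDeriv (by exact_mod_cast le_top)).continuousOn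
  choose S hS using hbd
  let M : ℝ := 1 + ∑ i ∈ Finset.range (m + 1), |S i|
  have hM0 : 0 < M := add_pos_of_pos_of_nonneg one_pos (Finset.sum_nonneg fun _ _ => abs_nonneg _)
  have hM : ∀ i ≤ m, ∀ x ∈ tsupport (ψ 0), ‖iteratedFDeriv ℝ i σ x‖ ≤ M := fun i hi x hx => by
    refine (hS i x hx).trans ((le_abs_self _).trans ?_)
    refine (Finset.single_le_sum (f := fun i => |S i|) (fun _ _ => abs_nonneg _)
      (Finset.mem_range.2 (Nat.lt_succ_of_le hi))).trans ?_
    simp [M]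
  -- In the Leibniz formula 2^m bounds the sum of the binomial coefficients and M bounds the
  -- derivatives of σ on the common support. The rate is independent of k, so one rate serves
  -- finitely many seminorms at once.
  refine ⟨2 ^ m * M, by positivity, fun k => ?_⟩
  let C : ℝ := ∑ i ∈ Finset.range (m + 1), SchwartzMap.seminorm ℂ k i (ψ 0)
  have hC0 : 0 ≤ C := Finset.sum_nonneg fun _ _ => apply_nonneg _ _
  refine ⟨C, hC0, fun n => ?_⟩
  induction n with
  | zero =>
    intro i hi
    rw [pow_zero, mul_one]
    exact Finset.single_le_sum (f := fun i => SchwartzMap.seminorm ℂ k i (ψ 0))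
      (fun _ _ => apply_nonneg _ _) (Finset.mem_range.2 (Nat.lt_succ_of_le hi))
  | succ n ih =>
    intro i hi
    refine SchwartzMap.seminorm_le_bound ℂ k i _ (by positivity) fun x => ?_
    have hfun : ⇑(ψ (n + 1)) = fun x => σ x * ψ n x := funext (hψ n)
    by_cases hx : x ∈ tsupport (ψ 0)
    · have h1 := norm_iteratedFDeriv_mul_le (hσ.of_le le_top) (ψ n).smooth' x
        (n := i) (by exact_mod_cast le_top)
      rw [hfun]
      calc ‖x‖ ^ k * ‖iteratedFDeriv ℝ i (fun x => σ x * ψ n x) x‖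
          ≤ ‖x‖ ^ k * ∑ l ∈ Finset.range (i + 1), (i.choose l : ℝ) *
            ‖iteratedFDeriv ℝ l σ x‖ * ‖iteratedFDeriv ℝ (i - l) (ψ n) x‖ :=
            mul_le_mul_of_nonneg_left h1 (by positivity)
        _ ≤ ∑ l ∈ Finset.range (i + 1), (i.choose l : ℝ) * (M * (C * (2 ^ m * M) ^ n)) := by
            rw [Finset.mul_sum]
            refine Finset.sum_le_sum fun l hl => ?_
            have hl' : l ≤ i := Nat.lt_succ_iff.1 (Finset.mem_range.1 hl)
            have h2 : ‖x‖ ^ k * ‖iteratedFDeriv ℝ (i - l) (ψ n) x‖ ≤ C * (2 ^ m * M) ^ n :=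
              (SchwartzMap.le_seminorm ℂ k (i - l) (ψ n) x).trans (ih _ (by omega))
            calc _ = (i.choose l : ℝ) * (‖iteratedFDeriv ℝ l σ x‖ *
                  (‖x‖ ^ k * ‖iteratedFDeriv ℝ (i - l) (ψ n) x‖)) := by ring
              _ ≤ _ := by
                gcongr
                exact hM l (hl'.trans hi) x hx
        _ = 2 ^ i * (M * (C * (2 ^ m * M) ^ n)) := by
            rw [← Finset.sum_mul]
            congr 1
            exact_mod_cast Nat.sum_range_choose i
        _ ≤ 2 ^ m * (M * (C * (2 ^ m * M) ^ n)) := by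
            gcongr
            norm_num
        _ = C * (2 ^ m * M) ^ (n + 1) := by ring
    · have h1 : iteratedFDeriv ℝ i (ψ (n + 1)) x = 0 := by
        by_contra hne
        exact hx (hsupp (n + 1) (support_iteratedFDeriv_subset i hne))
      rw [h1, norm_zero, mul_zero]
      positivity

/-- The L¹ norm of the Fourier transform is a continuous seminorm on Schwartz space, hence dominated
by finitely many of the standard ones, each of which grows geometrically. -/
theorem exists_geometric_bound_integral_fourier {σ : Sp d → ℂ} (hσ : ContDiff ℝ ⊤ σ)
    {ψ : ℕ → 𝓢(Sp d, ℂ)} (h0 : HasCompactSupport (ψ 0))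
    (hψ : ∀ n x, ψ (n + 1) x = σ x * ψ n x) :
    ∃ R : ℝ, 0 < R ∧ ∃ C : ℝ, ∀ n, ∫ x, ‖𝓕 (ψ n) x‖ ≤ C * R ^ n := by
  let Λ : 𝓢(Sp d, ℂ) →L[ℂ] Lp ℂ 1 (volume : Measure (Sp d)) :=
    (SchwartzMap.toLpCLM ℂ ℂ 1 volume).comp (FourierTransform.fourierCLM ℂ 𝓢(Sp d, ℂ))
  let q : Seminorm ℂ 𝓢(Sp d, ℂ) := (normSeminorm ℂ _).comp Λ.toLinearMap
  have hq : Continuous q := continuous_norm.comp Λ.continuous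
  obtain ⟨s, C, -, hC⟩ := Seminorm.bound_of_continuous
    (schwartz_withSeminorms ℂ (Sp d) ℂ) q hq
  have hqe : ∀ φ, q φ = ∫ x, ‖𝓕 φ x‖ := fun φ => SchwartzMap.norm_toLp_one
  obtain ⟨R, hR, hb⟩ := exists_geometric_bound_iteratedFDeriv hσ h0 hψ (s.sup Prod.snd)
  choose D hD0 hD using hb
  refine ⟨R, hR, C * ∑ i ∈ s, D i.1, fun n => ?_⟩
  rw [← hqe]
  refine (hC (ψ n)).trans ?_
  rw [_root_.smul_apply, NNReal.smul_def, smul_eq_mul, mul_assoc]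
  refine mul_le_mul_of_nonneg_left ?_ C.2
  refine Seminorm.finset_sup_apply_le (mul_nonneg (Finset.sum_nonneg fun _ _ => hD0 _)
    (pow_nonneg hR.le _)) fun i hi => ?_
  refine (hD i.1 n i.2 (Finset.le_sup (f := Prod.snd) hi)).trans
    (mul_le_mul_of_nonneg_right ?_ (pow_nonneg hR.le _))
  exact Finset.single_le_sum (f := fun i : ℕ × ℕ => D i.1) (fun _ _ => hD0 _) hi

end Growth

/-- A bounded continuous function that annihilates all band-limited test functions vanishes. -/
theorem eq_zero_of_pairing_eq_zero {d : ℕ} {w : Sp d → ℝ} (hw : Continuous w) {C : ℝ}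
    (hC : ∀ x, |w x| ≤ C)
    (h : ∀ ψ : 𝓢(Sp d, ℂ), HasCompactSupport ψ → pairing w (𝓕 ψ) = 0) (x₀ : Sp d) : w x₀ = 0 := by
  let β : ContDiffBump (0 : Sp d) := default
  have hβc : HasCompactSupport fun η => (β η : ℂ) :=
    β.hasCompactSupport.comp_left (g := fun r : ℝ => (r : ℂ)) Complex.ofReal_zero
  have hβs : ContDiff ℝ (⊤ : ℕ∞) fun η => (β η : ℂ) := Complex.ofRealCLM.contDiff.comp β.contDiff
  let B : 𝓢(Sp d, ℂ) := hβc.toSchwartzMap hβs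
  let κ : 𝓢(Sp d, ℂ) := 𝓕 B
  -- The integral of a Fourier transform is the value of the bump at 0.
  have hκ : ∫ z, κ z = 1 := by
    have h1 : (𝓕⁻ κ) 0 = B 0 := by rw [FourierTransform.fourierInv_fourier_eq]
    rw [SchwartzMap.fourierInv_coe, Real.fourierInv_eq'] at h1
    simp only [inner_zero_right, mul_zero, Complex.ofReal_zero, zero_mul, Complex.exp_zero,
      one_smul] at h1
    rw [h1]
    change ((β 0 : ℝ) : ℂ) = 1
    rw [β.one_of_mem_closedBall (Metric.mem_closedBall_self β.rIn_pos.le), Complex.ofReal_one]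
  -- The kernel κ concentrated at x₀ with scale ε is the transform of η ↦ e^{2πi⟨η,x₀⟩} β(εη), which
  -- has compact support and is therefore an admissible test.
  have hzero : ∀ n : ℕ, ∫ z, (w ((1 / ((n : ℝ) + 1)) • z + x₀) : ℂ) * κ z = 0 := fun n => by
    set ε : ℝ := 1 / ((n : ℝ) + 1) with hε
    have hε0 : 0 < ε := by positivity
    have hψc : HasCompactSupport fun η => character η (-x₀) * (β (ε • η) : ℂ) :=
      HasCompactSupport.mul_left
        (hβc.comp_homeomorph (Homeomorph.smulOfNeZero ε hε0.ne'))
    have hψs : ContDiff ℝ (⊤ : ℕ∞) fun η => character η (-x₀) * (β (ε • η) : ℂ) := by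
      refine ContDiff.mul ?_ (hβs.comp (contDiff_const_smul ε))
      unfold character
      exact ((Complex.ofRealCLM.contDiff.comp (contDiff_const.mul
        (contDiff_id.inner ℝ contDiff_const))).mul contDiff_const).cexp
    let ψ : 𝓢(Sp d, ℂ) := hψc.toSchwartzMap hψs
    have hψ : ∀ x, 𝓕 ψ x = ((|(ε ^ d)⁻¹| : ℝ) : ℂ) * κ (ε⁻¹ • (x - x₀)) := fun x => by
      have h1 := Measure.integral_comp_smul (volume : Measure (Sp d))
        (fun η => character η (ε⁻¹ • (x - x₀)) * (β η : ℂ)) ε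
      rw [finrank_euclideanSpace_fin, Complex.real_smul] at h1
      rw [fourier_eq_integral_character]
      refine Eq.trans ?_ (h1.trans ?_)
      · refine integral_congr_ae (Eventually.of_forall fun η => ?_)
        have h2 : character (ε • η) (ε⁻¹ • (x - x₀)) = character η x * character η (-x₀) := by
          rw [← character_add, ← sub_eq_add_neg, character, character, inner_smul_left,
            inner_smul_right]
          simp only [conj_trivial]
          rw [← mul_assoc ε, mul_inv_cancel₀ hε0.ne', one_mul]
        simp only [h2, mul_assoc]
        rfl
      · exact congrArg _ (fourier_eq_integral_character B _).symm
    have h1 := h ψ hψc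
    simp only [pairing, hψ] at h1
    have h2 := Measure.integral_comp_smul (volume : Measure (Sp d))
      (fun z => (w (ε • z + x₀) : ℂ) * κ z) ε⁻¹
    rw [finrank_euclideanSpace_fin] at h2
    have h3 : ∫ x, (w x : ℂ) * (((|(ε ^ d)⁻¹| : ℝ) : ℂ) * κ (ε⁻¹ • (x - x₀)))
        = ((|(ε ^ d)⁻¹| : ℝ) : ℂ) *
          ∫ x, (w (ε • ε⁻¹ • x + x₀) : ℂ) * κ (ε⁻¹ • x) := by
      rw [← integral_const_mul, ← integral_add_right_eq_self _ x₀]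
      refine integral_congr_ae (Eventually.of_forall fun x => ?_)
      simp only [add_sub_cancel_right, smul_inv_smul₀ hε0.ne']
      ring
    rw [h3, h2, Complex.real_smul] at h1
    have hd : ((|(ε ^ d)⁻¹| : ℝ) : ℂ) ≠ 0 := by
      exact_mod_cast abs_ne_zero.2 (inv_ne_zero (pow_ne_zero _ hε0.ne'))
    have hd' : ((|(ε⁻¹ ^ d)⁻¹| : ℝ) : ℂ) ≠ 0 := by
      exact_mod_cast abs_ne_zero.2 (inv_ne_zero (pow_ne_zero _ (inv_ne_zero hε0.ne')))
    exact (mul_eq_zero.1 ((mul_eq_zero.1 h1).resolve_left hd)).resolve_left hd'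
  have hlim : Tendsto (fun n : ℕ => ∫ z, (w ((1 / ((n : ℝ) + 1)) • z + x₀) : ℂ) * κ z) atTop
      (𝓝 (∫ z, (w x₀ : ℂ) * κ z)) := by
    refine tendsto_integral_of_dominated_convergence (fun z => C * ‖κ z‖) (fun n => ?_)
      (κ.integrable.norm.const_mul C) (fun n => Eventually.of_forall fun z => ?_)
      (Eventually.of_forall fun z => ?_)
    · exact ((Complex.continuous_ofReal.comp (hw.comp (by fun_prop))).mul
        κ.continuous).aestronglyMeasurable
    · rw [norm_mul, Complex.norm_real]
      exact mul_le_mul_of_nonneg_right (hC _) (norm_nonneg _)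
    · have h1 : Tendsto (fun n : ℕ => (1 / ((n : ℝ) + 1)) • z + x₀) atTop (𝓝 x₀) := by
        have h2 := (tendsto_one_div_add_atTop_nhds_zero_nat (𝕜 := ℝ).smul_const z).add_const x₀
        rwa [zero_smul, zero_add] at h2
      exact ((Complex.continuous_ofReal.tendsto _).comp ((hw.tendsto x₀).comp h1)).mul_const _
  simp only [hzero] at hlim
  have h1 := tendsto_nhds_unique tendsto_const_nhds hlim
  rw [integral_const_mul, hκ, mul_one] at h1
  exact_mod_cast h1.symm

/-- A growth bound for solutions of a linear scalar equation with zero initial data. -/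
theorem norm_le_of_linear_ode {S : Set ℝ} {N : ℕ} [NeZero N] {a : ℕ → ℂ} {y : ℕ → ℝ → ℂ}
    {r : ℝ → ℂ} {t₀ : ℝ} (hS : ∀ t ∈ Icc 0 t₀, t ∈ S) (hS' : ∀ t ∈ Ico 0 t₀, S ∈ 𝓝[≥] t)
    (hy : ∀ m < N, ∀ t ∈ S, HasDerivWithinAt (y m) (y (m + 1) t) S t)
    (heq : ∀ t ∈ S, y N t + ∑ m ∈ Finset.range N, a m * y m t = r t)
    (h0 : ∀ m < N, y m 0 = 0) {A lam : ℝ} (hA : 0 ≤ A)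
    (hlam : 1 + ∑ m ∈ Finset.range N, ‖a m‖ < lam)
    (hr : ∀ t ∈ Icc 0 t₀, ‖r t‖ ≤ A * Real.exp (lam * t)) {t : ℝ} (ht : t ∈ Icc 0 t₀) :
    ‖y 0 t‖ ≤ A / (lam - (1 + ∑ m ∈ Finset.range N, ‖a m‖)) * Real.exp (lam * t) := by
  set c := 1 + ∑ m ∈ Finset.range N, ‖a m‖ with hc
  have hlc : 0 < lam - c := sub_pos.2 hlam
  let Y : ℝ → Fin N → ℂ := fun t m => y m t
  let Y' : ℝ → Fin N → ℂ := fun t m => y (m + 1) t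
  have hYd : ∀ t ∈ S, HasDerivWithinAt Y (Y' t) S t := fun t ht =>
    hasDerivWithinAt_pi.2 fun m => hy m m.2 t ht
  have hYc : ContinuousOn Y (Icc 0 t₀) := fun t ht =>
    (hYd t (hS t ht)).continuousWithinAt.mono hS
  -- All components of Y' but the last are components of Y; the last one is given by the equation.
  have hY' : ∀ t ∈ Icc 0 t₀, ‖Y' t‖ ≤ c * ‖Y t‖ + ‖r t‖ := fun t ht => by
    refine (pi_norm_le_iff_of_nonneg (by positivity)).2 fun m => ?_
    have hsum0 : 0 ≤ ∑ m ∈ Finset.range N, ‖a m‖ := Finset.sum_nonneg fun _ _ => norm_nonneg _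
    by_cases hm : (m : ℕ) + 1 < N
    · calc ‖Y' t m‖ = ‖Y t ⟨m + 1, hm⟩‖ := rfl
        _ ≤ ‖Y t‖ := norm_le_pi_norm (Y t) _
        _ ≤ c * ‖Y t‖ := le_mul_of_one_le_left (norm_nonneg _) (by linarith)
        _ ≤ _ := le_add_of_nonneg_right (norm_nonneg _)
    · have hmN : (m : ℕ) + 1 = N := by have := m.2; omega
      have h1 : Y' t m = r t - ∑ m ∈ Finset.range N, a m * y m t := by
        rw [← heq t (hS t ht), add_sub_cancel_right, ← hmN]
      rw [h1]
      refine (norm_sub_le _ _).trans ?_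
      have h2 : ‖∑ m ∈ Finset.range N, a m * y m t‖
          ≤ (∑ m ∈ Finset.range N, ‖a m‖) * ‖Y t‖ := by
        rw [Finset.sum_mul]
        refine norm_sum_le_of_le _ fun k hk => ?_
        rw [norm_mul]
        exact mul_le_mul_of_nonneg_left
          (norm_le_pi_norm (Y t) ⟨k, Finset.mem_range.1 hk⟩) (norm_nonneg _)
      rw [hc, add_mul, one_mul]
      linarith [norm_nonneg (Y t)]
  -- The barrier K e^{λt} with K = (A + ε)/(λ - c) satisfies λK = cK + A + ε. Where ‖Y‖ touches it,
  -- its slope exceeds c‖Y‖ + ‖r‖, strictly because of ε.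
  have hmain : ∀ ε > 0, ‖Y t‖ ≤ (A + ε) / (lam - c) * Real.exp (lam * t) := fun ε hε => by
    have hB : ∀ s, HasDerivAt (fun s => (A + ε) / (lam - c) * Real.exp (lam * s))
        ((A + ε) / (lam - c) * (Real.exp (lam * s) * lam)) s := fun s => by
      have h1 := ((hasDerivAt_id s).const_mul lam).exp
      simp only [id, mul_one] at h1
      exact h1.const_mul _
    refine image_norm_le_of_norm_deriv_right_lt_deriv_boundary hYc
      (fun s hs => (hYd s (hS s ⟨hs.1, hs.2.le⟩)).mono_of_mem_nhdsWithin (hS' s hs)) ?_ hB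
      (fun s hs hsB => ?_) ht
    · have h1 : Y 0 = 0 := funext fun m => h0 m m.2
      rw [h1, norm_zero]
      positivity
    · have hs' : s ∈ Icc 0 t₀ := ⟨hs.1, hs.2.le⟩
      refine lt_of_le_of_lt (hY' s hs') ?_
      rw [hsB]
      have h1 : (A + ε) / (lam - c) * (Real.exp (lam * s) * lam)
          = c * ((A + ε) / (lam - c) * Real.exp (lam * s)) + (A + ε) * Real.exp (lam * s) := by
        field_simp
        ring
      rw [h1]
      have := hr s hs'
      have := mul_pos hε (Real.exp_pos (lam * s))
      linarith
  have hY0 : ‖y 0 t‖ ≤ ‖Y t‖ := norm_le_pi_norm (Y t) 0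
  refine hY0.trans ?_
  have hlim : Tendsto (fun ε : ℝ => (A + ε) / (lam - c) * Real.exp (lam * t)) (𝓝[>] 0)
      (𝓝 ((A + 0) / (lam - c) * Real.exp (lam * t))) := by
    refine Tendsto.mono_left (Continuous.tendsto (by fun_prop) 0) nhdsWithin_le_nhds
  rw [add_zero] at hlim
  exact ge_of_tendsto hlim (eventually_mem_nhdsWithin.mono fun ε hε => hmain ε hε)

section Uniqueness

variable {d N : ℕ} {a : ℕ → ℝ} {b : MvPolynomial (Fin d) ℝ} {T : EReal}

theorem IsSolution.continuous_slice {p : Fin N → ℝ} {f : Fin N → Sp d →ᵇ ℝ} {F : ℝ → Sp d → ℝ}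
    {u : ℝ → Sp d → ℝ} (hu : IsSolution a b p f F T u) {t : ℝ} (ht : t ∈ timeSet T) :
    Continuous (u t) :=
  continuousOn_univ.1 (hu.continuousOn.comp (f := fun x : Sp d => (t, x)) (by fun_prop)
    fun x _ => ⟨ht, mem_univ _⟩)

theorem IsSolution.integrable_mul {p : Fin N → ℝ} {f : Fin N → Sp d →ᵇ ℝ} {F : ℝ → Sp d → ℝ}
    {u : ℝ → Sp d → ℝ} (hu : IsSolution a b p f F T u) {t : ℝ} (ht : t ∈ timeSet T)
    (φ : 𝓢(Sp d, ℂ)) : Integrable fun x => (u t x : ℂ) * φ x := by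
  obtain ⟨C, hC⟩ := hu.bounded t ht
  exact φ.integrable.bdd_mul (c := C)
    (Complex.continuous_ofReal.comp (hu.continuous_slice ht)).aestronglyMeasurable
    (Eventually.of_forall fun z => by simpa using hC t ⟨ht.1, le_rfl⟩ z)

theorem IsSolution.sub (hT : 0 < T) {p : Fin N → ℝ} {f : Fin N → Sp d →ᵇ ℝ} {F : ℝ → Sp d → ℝ}
    {u v : ℝ → Sp d → ℝ} (hu : IsSolution a b p f F T u) (hv : IsSolution a b p f F T v) :
    IsSolution a b p 0 0 T (fun t x => u t x - v t x) := by
  have hS := uniqueDiffOn_timeSet hT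
  have hp : ∀ φ, ∀ t ∈ timeSet T, pairing (fun x => u t x - v t x) φ
      = pairing (u t) φ - pairing (v t) φ := fun φ t ht => by
    rw [pairing, pairing, pairing, ← integral_sub (hu.integrable_mul ht φ) (hv.integrable_mul ht φ)]
    simp only [Complex.ofReal_sub, sub_mul]
  have hiter : ∀ φ, ∀ n ≤ N, ∀ t ∈ timeSet T, iteratedDerivWithin n
      (fun s => pairing (fun x => u s x - v s x) φ) (timeSet T) t
      = iteratedDerivWithin n (fun s => pairing (u s) φ) (timeSet T) t
        - iteratedDerivWithin n (fun s => pairing (v s) φ) (timeSet T) t := fun φ n hn t ht => by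
    rw [iteratedDerivWithin_congr (hp φ) ht]
    exact iteratedDerivWithin_sub ht hS (((hu.smooth φ).of_le (by exact_mod_cast hn)) t ht)
      (((hv.smooth φ).of_le (by exact_mod_cast hn)) t ht)
  refine ⟨hu.continuousOn.sub hv.continuousOn, fun t ht => ?_, fun φ => ?_, fun φ t ht => ?_,
    fun φ n => ?_⟩
  · obtain ⟨C, hC⟩ := hu.bounded t ht
    obtain ⟨D, hD⟩ := hv.bounded t ht
    exact ⟨C + D, fun s hs x => (abs_sub _ _).trans (add_le_add (hC s hs x) (hD s hs x))⟩
  · exact ((hu.smooth φ).sub (hv.smooth φ)).congr (hp φ)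
  · rw [Finset.sum_congr rfl fun n hn => by rw [hiter φ n (Finset.mem_Icc.1 hn).2 t ht], hp _ t ht]
    simp only [mul_sub, Finset.sum_sub_distrib]
    have h1 := hu.equation φ t ht
    have h2 := hv.equation φ t ht
    have h3 : pairing ((0 : ℝ → Sp d → ℝ) t) φ = 0 := by simp [pairing]
    rw [h3]
    linear_combination h1 - h2
  · rw [hiter φ n n.2.le 0 (zero_mem_timeSet hT), hu.initial, hv.initial]
    simp [pairing]

variable [NeZero N]

/-- On the Fourier side the adjoint operator multiplies by the symbol, which is bounded on the
support of ψ. It thus behaves as a bounded operator along the sequence φ, and a Gronwall iteration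
works although the operator is unbounded. -/
theorem IsSolution.pairing_fourier_eq_zero (hT : 0 < T) (ha : a N = 1) {p : Fin N → ℝ}
    {w : ℝ → Sp d → ℝ} (hw : IsSolution a b p 0 0 T w) {ψ : 𝓢(Sp d, ℂ)}
    (hψ : HasCompactSupport ψ) {t : ℝ} (ht : t ∈ timeSet T) : pairing (w t) (𝓕 ψ) = 0 := by
  have hS := uniqueDiffOn_timeSet hT
  let φ : ℕ → 𝓢(Sp d, ℂ) := fun n => (adjointOp b)^[n] (𝓕 ψ)
  have hφ : ∀ n, φ (n + 1) = adjointOp b (φ n) := fun n => Function.iterate_succ_apply' _ _ _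
  obtain ⟨R, hR, D, hD⟩ := exists_geometric_bound_integral_fourier
    (σ := fun η => symbol b ((2 * Real.pi) • η)) (ψ := fun n => 𝓕⁻ (φ n))
    ((contDiff_symbol b).comp (contDiff_const_smul _))
    (by simpa [φ, FourierTransform.fourierInv_fourier_eq] using hψ)
    (fun n x => by rw [hφ]; exact adjointOp_fourierInv_apply b (φ n) x)
  simp only [FourierTransform.fourier_fourierInv_eq] at hD
  obtain ⟨C, hC⟩ := hw.bounded t ht
  have hC0 : 0 ≤ C := (abs_nonneg _).trans (hC t ⟨ht.1, le_rfl⟩ 0)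
  have hsub : ∀ s ∈ Icc 0 t, s ∈ timeSet T := fun s hs => timeSet_mono ht hs
  have hbase : ∀ n, ∀ s ∈ Icc 0 t, ‖pairing (w s) (φ n)‖ ≤ C * (D * R ^ n) := fun n s hs => by
    refine le_trans ?_ (mul_le_mul_of_nonneg_left (hD n) hC0)
    rw [← integral_const_mul]
    refine norm_integral_le_of_norm_le ((φ n).integrable.norm.const_mul C)
      (Eventually.of_forall fun x => ?_)
    rw [norm_mul, Complex.norm_real]
    exact mul_le_mul_of_nonneg_right (hC s hs x) (norm_nonneg _)
  -- The time derivatives in the equation begin at order 1, so the coefficient of order 0 is set to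
  -- zero.
  let a' : ℕ → ℂ := fun m => if m = 0 then 0 else a m
  -- The excess 2R makes each step gain 1/(2R) against a growth by R, so k steps leave a factor
  -- 2^{-k}.
  let lam : ℝ := (1 + ∑ m ∈ Finset.range N, ‖a' m‖) + 2 * R
  have hlam0 : 0 < lam := by positivity
  have hD0 : 0 ≤ C * D := by
    have := (norm_nonneg _).trans (hbase 0 t ⟨ht.1, le_rfl⟩)
    simpa using this
  have hstep : ∀ n, ∀ A, 0 ≤ A →
      (∀ s ∈ Icc 0 t, ‖pairing (w s) (φ (n + 1))‖ ≤ A * Real.exp (lam * s)) →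
      ∀ s ∈ Icc 0 t, ‖pairing (w s) (φ n)‖ ≤ A / (2 * R) * Real.exp (lam * s) := by
    intro n A hA hb s hs
    have h1 := norm_le_of_linear_ode (S := timeSet T) (N := N) (a := a')
      (y := fun m s => iteratedDerivWithin m (fun s => pairing (w s) (φ n)) (timeSet T) s)
      (r := fun s => pairing (w s) (φ (n + 1))) (t₀ := t) (A := A) (lam := lam)
      hsub (fun s hs => ?_) (fun m hm s hs => ?_) (fun s hs => ?_) (fun m hm => ?_) hA
      (by simp only [lam]; linarith) hb hs
    · simpa [lam] using h1
    · exact mem_of_superset (Icc_mem_nhdsGE hs.2) fun r hr => hsub r ⟨hs.1.trans hr.1, hr.2⟩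
    · have h2 := ((hw.smooth (φ n)).differentiableOn_iteratedDerivWithin
        (by exact_mod_cast hm) hS s hs).hasDerivWithinAt
      rwa [← iteratedDerivWithin_succ] at h2
    · have h2 := hw.equation (φ n) s hs
      have h3 : pairing ((0 : ℝ → Sp d → ℝ) s) (φ n) = 0 := by simp [pairing]
      rw [h3, sub_zero, ← hφ, sub_eq_zero] at h2
      rw [← h2]
      obtain ⟨M, hM⟩ : ∃ M, N = M + 1 := Nat.exists_eq_succ_of_ne_zero (NeZero.ne N)
      have h4 : ∀ g : ℕ → ℂ, ∑ m ∈ Finset.range N, a' m * g m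
          = ∑ m ∈ Finset.Icc 1 M, (a m : ℂ) * g m := fun g => by
        rw [hM, Finset.sum_range_succ', Finset.range_eq_Ico]
        simp only [a', if_true, zero_mul, add_zero, Nat.add_eq_zero_iff, one_ne_zero, and_false,
          if_false]
        rw [Finset.sum_Ico_add' (fun l => (a l : ℂ) * g l) 0 M 1]
        rfl
      have h5 : ∀ g : ℕ → ℂ, ∑ m ∈ Finset.Icc 1 N, (a m : ℂ) * g m
          = (∑ m ∈ Finset.Icc 1 M, (a m : ℂ) * g m) + g N := fun g => by
        rw [hM, Finset.sum_Icc_succ_top (by omega), ← hM, ha]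
        simp
      rw [h4 fun m => iteratedDerivWithin m (fun s => pairing (w s) (φ n)) (timeSet T) s,
        h5 fun m => iteratedDerivWithin m (fun s => pairing (w s) (φ n)) (timeSet T) s, add_comm]
    · have h2 := hw.initial (φ n) ⟨m, hm⟩
      simpa [pairing] using h2
  have hiter : ∀ k n, ∀ s ∈ Icc 0 t,
      ‖pairing (w s) (φ n)‖ ≤ C * D * R ^ n * (1 / 2) ^ k * Real.exp (lam * s) := by
    intro k
    induction k with
    | zero =>
      intro n s hs
      refine (hbase n s hs).trans ?_
      rw [pow_zero, mul_one, ← mul_assoc]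
      exact le_mul_of_one_le_right (by positivity)
        (Real.one_le_exp (mul_nonneg hlam0.le hs.1))
    | succ k ih =>
      intro n s hs
      refine (hstep n _ (by positivity) (ih (n + 1)) s hs).trans (le_of_eq ?_)
      rw [pow_succ, pow_succ]
      field_simp
  have hlim : Tendsto (fun k : ℕ => C * D * R ^ 0 * (1 / 2) ^ k * Real.exp (lam * t)) atTop
      (𝓝 (C * D * R ^ 0 * 0 * Real.exp (lam * t))) :=
    ((tendsto_pow_atTop_nhds_zero_of_lt_one (by norm_num) (by norm_num)).const_mul _).mul_const _
  have h1 := ge_of_tendsto' hlim fun k => hiter k 0 t ⟨ht.1, le_rfl⟩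
  rw [mul_zero, zero_mul] at h1
  exact norm_le_zero_iff.1 h1

theorem IsSolution.unique (hT : 0 < T) (ha : a N = 1) {p : Fin N → ℝ} {f : Fin N → Sp d →ᵇ ℝ}
    {F : ℝ → Sp d → ℝ} {u v : ℝ → Sp d → ℝ} (hu : IsSolution a b p f F T u)
    (hv : IsSolution a b p f F T v) {t : ℝ} (ht : t ∈ timeSet T) (x : Sp d) : v t x = u t x := by
  have hw := hv.sub hT hu
  obtain ⟨C, hC⟩ := hw.bounded t ht
  exact sub_eq_zero.1 (eq_zero_of_pairing_eq_zero (hw.continuous_slice ht)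
    (hC t ⟨ht.1, le_rfl⟩) (fun ψ hψ => hw.pairing_fourier_eq_zero hT ha hψ ht) x)

end Uniqueness

/-! ### Gradients of convolutions -/

section Gradient

variable {d : ℕ}

/-- The distributional gradient of the finite signed measure `γ(x) μ(dx)` is the vector measure
`γ1(x) μ1(dx)`. -/
structure HasMeasureGradient (μ : Measure (Sp d)) (γ : Sp d → ℝ) (μ1 : Measure (Sp d))
    (γ1 : Sp d → Sp d) : Prop where
  integrable : Integrable γ μ
  integrable_gradient : Integrable γ1 μ1
  integral_eq : ∀ ψ : Sp d → ℝ, ContDiff ℝ (⊤ : ℕ∞) ψ → HasCompactSupport ψ → ∀ v : Sp d,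
    ∫ y, inner ℝ (γ1 y) v * ψ y ∂μ1 = -∫ y, γ y * fderiv ℝ ψ y v ∂μ

/-- Bounded pointwise convergence is enough for dominated convergence against finite measures. The
function is cut off first and then smoothed within 1/(k+1) without enlarging its support. -/
theorem exists_smooth_approx (f : Sp d →ᵇ ℝ) : ∃ φ : ℕ → Sp d → ℝ,
    (∀ k, ContDiff ℝ (⊤ : ℕ∞) (φ k)) ∧ (∀ k, HasCompactSupport (φ k)) ∧
    (∀ k x, |φ k x| ≤ ‖f‖ + 1) ∧ ∀ x, Tendsto (fun k => φ k x) atTop (𝓝 (f x)) := by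
  let χ : ℕ → Sp d → ℝ := fun k x => max 0 (min 1 (k + 1 - ‖x‖))
  have hχc : ∀ k, Continuous (χ k) := fun k => by fun_prop
  have hχ0 : ∀ k x, 0 ≤ χ k x := fun k x => le_max_left _ _
  have hχ1 : ∀ k x, χ k x ≤ 1 := fun k x => max_le zero_le_one (min_le_left _ _)
  have h := fun k : ℕ => Continuous.exists_contDiff_approx (f := fun x => χ k x * f x)
    (ε := fun _ => 1 / ((k : ℝ) + 1)) ⊤ ((hχc k).mul f.continuous) continuous_const
    fun _ => Nat.one_div_pos_of_nat
  choose φ hφ hd hs using h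
  refine ⟨φ, hφ, fun k => ?_, fun k x => ?_, fun x => ?_⟩
  · refine HasCompactSupport.intro (isCompact_closedBall (0 : Sp d) (k + 1)) fun x hx => ?_
    rw [mem_closedBall_zero_iff, not_le] at hx
    by_contra hne
    refine hs k (Function.mem_support.2 hne) ?_
    have : χ k x = 0 := max_eq_left ((min_le_right _ _).trans (by linarith))
    exact mul_eq_zero_of_left this _
  · have h1 := (hd k x).le
    rw [Real.dist_eq] at h1
    have h2 : |χ k x * f x| ≤ ‖f‖ := by
      rw [abs_mul, abs_of_nonneg (hχ0 k x)]
      exact (mul_le_of_le_one_left (abs_nonneg _) (hχ1 k x)).trans (f.norm_coe_le_norm x)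
    have h3 : 1 / ((k : ℝ) + 1) ≤ 1 := by
      rw [div_le_one (by positivity)]; linarith [(Nat.cast_nonneg k : (0 : ℝ) ≤ k)]
    have h4 : |φ k x| ≤ |φ k x - χ k x * f x| + |χ k x * f x| := by
      simpa using abs_add_le (φ k x - χ k x * f x) (χ k x * f x)
    linarith
  · have h1 : Tendsto (fun k => φ k x - χ k x * f x) atTop (𝓝 0) := by
      refine squeeze_zero_norm (fun k => ?_) tendsto_one_div_add_atTop_nhds_zero_nat
      rw [← dist_eq_norm]
      exact (hd k x).le
    have h2 : Tendsto (fun k => χ k x * f x) atTop (𝓝 (f x)) := by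
      refine tendsto_const_nhds.congr' ?_
      obtain ⟨K, hK⟩ := exists_nat_ge ‖x‖
      filter_upwards [eventually_ge_atTop K] with k hk
      have h3 : (K : ℝ) ≤ k := by exact_mod_cast hk
      have : χ k x = 1 := by
        simp only [χ]
        rw [min_eq_left (by linarith), max_eq_right zero_le_one]
      rw [this, one_mul]
    simpa using h1.add h2

variable {μ : Measure (Sp d)} {γ : Sp d → ℝ} {μ1 : Measure (Sp d)} {γ1 : Sp d → Sp d}

theorem tendsto_integral_smul {X V ι : Type*} [MeasurableSpace X] [NormedAddCommGroup V]
    [NormedSpace ℝ V] {κ : Measure X} {g : X → V} (hg : Integrable g κ) {l : Filter ι}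
    [l.IsCountablyGenerated] {φ : ι → X → ℝ} {φ₀ : X → ℝ}
    (hφ : ∀ i, StronglyMeasurable (φ i)) {C : ℝ} (hC : ∀ i x, |φ i x| ≤ C)
    (hlim : ∀ x, Tendsto (fun i => φ i x) l (𝓝 (φ₀ x))) :
    Tendsto (fun i => ∫ x, φ i x • g x ∂κ) l (𝓝 (∫ x, φ₀ x • g x ∂κ)) := by
  refine tendsto_integral_filter_of_dominated_convergence (fun x => C * ‖g x‖)
    (Eventually.of_forall fun i => (hφ i).aestronglyMeasurable.smul hg.1)
    (Eventually.of_forall fun i => Eventually.of_forall fun x => ?_) (hg.norm.const_mul C)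
    (Eventually.of_forall fun x => (hlim x).smul_const _)
  rw [norm_smul]
  exact mul_le_mul_of_nonneg_right (hC i x) (norm_nonneg _)

theorem continuous_convolution_smul {V : Type*} [NormedAddCommGroup V] [NormedSpace ℝ V]
    {g : Sp d → V} (hg : Integrable g μ) {f : Sp d → ℝ} (hf : Continuous f) {C : ℝ}
    (hC : ∀ x, |f x| ≤ C) : Continuous fun x => ∫ y, f (x - y) • g y ∂μ :=
  continuous_iff_continuousAt.2 fun x₀ => tendsto_integral_smul hg
    (φ := fun x y => f (x - y)) (fun _ => (hf.comp (by fun_prop)).stronglyMeasurable)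
    (fun _ _ => hC _) fun _ => (hf.comp (by fun_prop : Continuous fun x => x - _)).tendsto x₀

theorem integrable_convolution_smul {V : Type*} [NormedAddCommGroup V] [NormedSpace ℝ V]
    {g : Sp d → V} (hg : Integrable g μ) {f : Sp d → ℝ} (hf : Continuous f) {C : ℝ}
    (hC : ∀ x, |f x| ≤ C) (x : Sp d) : Integrable (fun y => f (x - y) • g y) μ :=
  hg.bdd_smul C (hf.comp (by fun_prop : Continuous fun y => x - y)).aestronglyMeasurable
    (Eventually.of_forall fun _ => hC _)

theorem norm_integral_convolution_smul_le {V : Type*} [NormedAddCommGroup V] [NormedSpace ℝ V]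
    {g : Sp d → V} (hg : Integrable g μ) {f : Sp d → ℝ} {C : ℝ} (hC : ∀ x, |f x| ≤ C) (x : Sp d) :
    ‖∫ y, f (x - y) • g y ∂μ‖ ≤ C * ∫ y, ‖g y‖ ∂μ := by
  rw [← integral_const_mul]
  refine norm_integral_le_of_norm_le (hg.norm.const_mul C) (Eventually.of_forall fun y => ?_)
  rw [norm_smul]
  exact mul_le_mul_of_nonneg_right (hC _) (norm_nonneg _)

/-- The derivative falls on φ and is then moved to the measure; the minus sign of the distributional
derivative cancels that of y ↦ φ(z - y). -/
theorem HasMeasureGradient.hasDerivAt_convolution (h : HasMeasureGradient μ γ μ1 γ1)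
    {φ : Sp d → ℝ} (hφ : ContDiff ℝ (⊤ : ℕ∞) φ) (hs : HasCompactSupport φ) (x v : Sp d) (σ : ℝ) :
    HasDerivAt (fun σ : ℝ => ∫ y, φ (x + σ • v - y) • γ y ∂μ)
      (∫ y, φ (x + σ • v - y) • inner ℝ (γ1 y) v ∂μ1) σ := by
  have hd : Differentiable ℝ φ := hφ.differentiable (by simp)
  have hdc : Continuous (fderiv ℝ φ) := hφ.continuous_fderiv (by simp)
  obtain ⟨C, hC⟩ := hs.exists_bound_of_continuous hφ.continuous
  obtain ⟨C', hC'⟩ := (hs.fderiv ℝ).exists_bound_of_continuous hdc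
  have key : ∫ y, φ (x + σ • v - y) • inner ℝ (γ1 y) v ∂μ1
      = ∫ y, (fderiv ℝ φ (x + σ • v - y) v) • γ y ∂μ := by
    have h1 := h.integral_eq (fun y => φ (x + σ • v - y)) (hφ.comp (by fun_prop))
      (hs.comp_homeomorph (Homeomorph.subLeft (x + σ • v))) v
    rw [← integral_neg] at h1
    have h2 : ∀ y, fderiv ℝ (fun y => φ (x + σ • v - y)) y v
        = - fderiv ℝ φ (x + σ • v - y) v := fun y => by
      have := ((hd (x + σ • v - y)).hasFDerivAt.comp y
        ((hasFDerivAt_id y).const_sub (x + σ • v))).fderiv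
      have h3 := congrArg (fun L : Sp d →L[ℝ] ℝ => L v) this
      simpa [Function.comp_def] using h3
    simp only [h2, mul_neg, neg_neg] at h1
    simpa only [smul_eq_mul, mul_comm] using h1
  rw [key]
  refine (hasDerivAt_integral_of_dominated_loc_of_deriv_le (F := fun (σ : ℝ) y =>
    φ (x + σ • v - y) • γ y) (F' := fun (σ : ℝ) y => (fderiv ℝ φ (x + σ • v - y) v) • γ y)
    (bound := fun y => C' * ‖v‖ * ‖γ y‖) univ_mem (Eventually.of_forall fun σ =>
      (integrable_convolution_smul h.integrable hφ.continuous hC _).1)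
    (integrable_convolution_smul h.integrable hφ.continuous hC _) ?_ ?_
    (h.integrable.norm.const_mul _) ?_).2
  · have hc : Continuous fun y => fderiv ℝ φ (x + σ • v - y) v := by fun_prop
    exact hc.aestronglyMeasurable.smul h.integrable.1
  · refine Eventually.of_forall fun y σ _ => ?_
    rw [norm_smul]
    refine mul_le_mul_of_nonneg_right ((ContinuousLinearMap.le_opNorm _ _).trans ?_) (norm_nonneg _)
    exact mul_le_mul_of_nonneg_right (hC' _) (norm_nonneg _)
  · refine Eventually.of_forall fun y σ _ => HasDerivAt.smul_const ?_ _
    have h1 : HasDerivAt (fun σ : ℝ => x + σ • v - y) v σ := by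
      simpa using (((hasDerivAt_id σ).smul_const v).const_add x).sub_const y
    exact (hd _).hasFDerivAt.comp_hasDerivAt σ h1

/-- In this integrated form no derivative of the test function occurs, so the identity passes from
smooth φ_k to a merely bounded continuous f. -/
theorem HasMeasureGradient.convolution_sub (h : HasMeasureGradient μ γ μ1 γ1)
    (f : Sp d →ᵇ ℝ) (x v : Sp d) :
    (∫ y, f (x + v - y) • γ y ∂μ) - ∫ y, f (x - y) • γ y ∂μ
      = ∫ σ in (0 : ℝ)..1, ∫ y, f (x + σ • v - y) • inner ℝ (γ1 y) v ∂μ1 := by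
  have hi : Integrable (fun y => (inner ℝ (γ1 y) v : ℝ)) μ1 := h.integrable_gradient.inner_const v
  obtain ⟨φ, hφ, hs, hC, hlim⟩ := exists_smooth_approx f
  have h1 : ∀ k, (∫ y, φ k (x + v - y) • γ y ∂μ) - ∫ y, φ k (x - y) • γ y ∂μ
      = ∫ σ in (0 : ℝ)..1, ∫ y, φ k (x + σ • v - y) • inner ℝ (γ1 y) v ∂μ1 := fun k => by
    rw [intervalIntegral.integral_eq_sub_of_hasDerivAt
      (fun σ _ => h.hasDerivAt_convolution (hφ k) (hs k) x v σ)]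
    · simp
    · exact (((continuous_convolution_smul hi (hφ k).continuous (hC k)).comp
        (by fun_prop : Continuous fun σ : ℝ => x + σ • v))).intervalIntegrable _ _
  have h2 : ∀ z, Tendsto (fun k => ∫ y, φ k (z - y) • γ y ∂μ) atTop
      (𝓝 (∫ y, f (z - y) • γ y ∂μ)) := fun z =>
    tendsto_integral_smul h.integrable (φ := fun k y => φ k (z - y))
      (fun k => ((hφ k).continuous.comp (by fun_prop)).stronglyMeasurable)
      (fun k y => hC k _) fun y => hlim _
  refine tendsto_nhds_unique ((h2 (x + v)).sub (h2 x)) ?_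
  simp only [h1]
  refine intervalIntegral.tendsto_integral_filter_of_dominated_convergence
    (fun _ => (‖f‖ + 1) * ∫ y, ‖(inner ℝ (γ1 y) v : ℝ)‖ ∂μ1) (Eventually.of_forall fun k => ?_)
    (Eventually.of_forall fun k => Eventually.of_forall fun σ _ => ?_)
    intervalIntegrable_const (Eventually.of_forall fun σ _ => ?_)
  · exact ((continuous_convolution_smul hi (hφ k).continuous (hC k)).comp
      (by fun_prop : Continuous fun σ : ℝ => x + σ • v)).aestronglyMeasurable
  · exact norm_integral_convolution_smul_le hi (hC k) _
  · exact tendsto_integral_smul hi (φ := fun k y => φ k (x + σ • v - y))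
      (fun k => ((hφ k).continuous.comp (by fun_prop)).stronglyMeasurable)
      (fun k y => hC k _) fun y => hlim _

/-- The remainder is ∫_0^1 ⟨G(x+σv) - G(x), v⟩ dσ, which is o(‖v‖) because G is continuous. -/
theorem HasMeasureGradient.hasGradientAt (h : HasMeasureGradient μ γ μ1 γ1)
    (f : Sp d →ᵇ ℝ) (x : Sp d) :
    HasGradientAt (fun x => ∫ y, γ y * f (x - y) ∂μ) (∫ y, f (x - y) • γ1 y ∂μ1) x := by
  set G : Sp d → Sp d := fun x => ∫ y, f (x - y) • γ1 y ∂μ1 with hG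
  have hGc : Continuous G :=
    continuous_convolution_smul h.integrable_gradient f.continuous f.norm_coe_le_norm
  have hinner : ∀ z v, ∫ y, f (z - y) • inner ℝ (γ1 y) v ∂μ1 = inner ℝ (G z) v := fun z v => by
    rw [hG, real_inner_comm, ← integral_inner (integrable_convolution_smul h.integrable_gradient
      f.continuous f.norm_coe_le_norm z)]
    simp only [inner_smul_right, smul_eq_mul, real_inner_comm]
  rw [hasGradientAt_iff_isLittleO_nhds_zero, Asymptotics.isLittleO_iff]
  intro ε hε
  obtain ⟨δ, hδ, hball⟩ := Metric.continuousAt_iff.1 (hGc.continuousAt (x := x)) ε hε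
  filter_upwards [Metric.ball_mem_nhds (0 : Sp d) hδ] with v hv
  have hv' : ‖v‖ < δ := by simpa using hv
  have h1 : (∫ y, γ y * f (x + v - y) ∂μ) - (∫ y, γ y * f (x - y) ∂μ) - inner ℝ (G x) v
      = ∫ σ in (0 : ℝ)..1, inner ℝ (G (x + σ • v) - G x) v := by
    have h2 := h.convolution_sub f x v
    simp only [hinner] at h2
    simp only [inner_sub_left]
    rw [intervalIntegral.integral_sub, ← h2]
    · simp [mul_comm]
    · exact (Continuous.inner (hGc.comp (by fun_prop)) continuous_const).intervalIntegrable _ _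
    · exact intervalIntegrable_const
  rw [h1]
  refine (intervalIntegral.norm_integral_le_of_norm_le_const (C := ε * ‖v‖) fun σ hσ => ?_).trans
    (by simp)
  rw [uIoc_of_le zero_le_one] at hσ
  refine (norm_inner_le_norm _ _).trans (mul_le_mul_of_nonneg_right ?_ (norm_nonneg _))
  rw [← dist_eq_norm]
  refine (hball ?_).le
  rw [dist_eq_norm, add_sub_cancel_left, norm_smul, Real.norm_eq_abs, abs_of_pos hσ.1]
  exact (mul_le_of_le_one_left (norm_nonneg _) hσ.2).trans_lt hv'

end Gradient

/-! ### From distributional gradients to integration by parts -/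

section GradientMeasures

variable {d N : ℕ} [NeZero N] {T : EReal} {f : Fin N → Sp d →ᵇ ℝ} {g : Fin N → ℝ → 𝓢'(Sp d, ℂ)}
  {ν : Fin N → ℝ → SignedMeasure (Sp d)} {μ : Fin N → ℝ → Measure (Sp d)}
  {γ : Fin N → ℝ → Sp d → ℝ} {μ1 : Fin N → ℝ → Measure (Sp d)} {γ1 : Fin N → ℝ → Sp d → Sp d}

/-- The distributional derivative along each coordinate vector is tested on ψ viewed as a complex
Schwartz function; the identities are then combined linearly with the coordinates of v. -/
theorem GradientMeasures.hasMeasureGradient (h1 : GradientMeasures T f g μ1 γ1)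
    (h : GreenMeasures T g ν μ γ) {n : Fin N} (hn : n = ⊤ ∨ f n ≠ 0) {t : ℝ}
    (ht : t ∈ openTimeSet T) : HasMeasureGradient (μ n t) (γ n t) (μ1 n t) (γ1 n t) := by
  have ht' : t ∈ timeSet T := ⟨ht.1.le, ht.2⟩
  choose ν1 hν1 hdens using fun m => h1.represents n hn m t ht
  have hint := (h.density n t ht').1
  refine ⟨hint, ?_, fun ψ hψ hs v => ?_⟩
  · have := Integrable.of_eval_piLp (q := 2) (f := γ1 n t) fun m => (hdens m).1
    exact this
  · let φ : 𝓢(Sp d, ℂ) := (hs.comp_left (g := ((↑) : ℝ → ℂ)) Complex.ofReal_zero).toSchwartzMap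
      (Complex.ofRealCLM.contDiff.comp hψ)
    have hφ : ∀ y, φ y = (ψ y : ℂ) := fun y => rfl
    have hdψ : Differentiable ℝ ψ := hψ.differentiable (by simp)
    obtain ⟨C', hC'⟩ := (hs.fderiv ℝ).exists_bound_of_continuous (hψ.continuous_fderiv (by simp))
    obtain ⟨C, hC⟩ := hs.exists_bound_of_continuous hψ.continuous
    have hdφ : ∀ (m : Sp d) y, (∂_{m} φ : 𝓢(Sp d, ℂ)) y = (fderiv ℝ ψ y m : ℂ) := fun m y => by
      rw [SchwartzMap.lineDerivOp_apply_eq_fderiv]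
      have h2 : HasFDerivAt φ (Complex.ofRealCLM.comp (fderiv ℝ ψ y)) y :=
        Complex.ofRealCLM.hasFDerivAt.comp y (hdψ y).hasFDerivAt
      rw [h2.fderiv]; rfl
    have hbdd : ∀ χ : 𝓢(Sp d, ℂ), ∃ K, ∀ y, ‖χ y‖ ≤ K := fun χ =>
      ⟨‖χ.toBoundedContinuousFunction‖, χ.toBoundedContinuousFunction.norm_coe_le_norm⟩
    have hcoord : ∀ m : Fin d, ∫ y, γ1 n t y m * ψ y ∂μ1 n t
        = -∫ y, γ n t y * fderiv ℝ ψ y (EuclideanSpace.single m 1) ∂μ n t := fun m => by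
      have h2 := hν1 m φ
      rw [TemperedDistribution.lineDerivOp_apply_apply, h.represents n t ht'] at h2
      obtain ⟨K, hK⟩ := hbdd (-∂_{EuclideanSpace.single m (1 : ℝ)} φ)
      obtain ⟨K', hK'⟩ := hbdd φ
      rw [(h.density n t ht').sintegral_eq (SchwartzMap.continuous _).stronglyMeasurable hK,
        (hdens m).sintegral_eq φ.continuous.stronglyMeasurable hK'] at h2
      simp only [neg_apply, hdφ, hφ, Complex.real_smul, ← Complex.ofReal_neg,
        ← Complex.ofReal_mul, mul_neg] at h2
      simp only [integral_neg, integral_complex_ofReal] at h2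
      exact_mod_cast h2.symm
    have hv : v = ∑ m, v m • EuclideanSpace.single m (1 : ℝ) := by
      simpa using ((EuclideanSpace.basisFun (Fin d) ℝ).sum_repr v).symm
    have e1 : ∀ y, inner ℝ (γ1 n t y) v * ψ y = ∑ m, v m * (γ1 n t y m * ψ y) := fun y => by
      rw [PiLp.inner_apply, Finset.sum_mul]
      exact Finset.sum_congr rfl fun m _ => by simp; ring
    have e2 : ∀ y, γ n t y * fderiv ℝ ψ y v
        = ∑ m, v m * (γ n t y * fderiv ℝ ψ y (EuclideanSpace.single m 1)) := fun y => by
      conv_lhs => rw [hv]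
      rw [map_sum, Finset.mul_sum]
      exact Finset.sum_congr rfl fun m _ => by rw [map_smul, smul_eq_mul]; ring
    simp only [e1, e2]
    rw [integral_finsetSum, integral_finsetSum, ← Finset.sum_neg_distrib]
    · refine Finset.sum_congr rfl fun m _ => ?_
      rw [integral_const_mul, integral_const_mul, hcoord m, mul_neg]
    · refine fun m _ => (hint.mul_bdd (c := C' * ‖EuclideanSpace.single m (1 : ℝ)‖)
        ?_ (Eventually.of_forall fun y => ?_)).const_mul _
      · have := hψ.continuous_fderiv (by simp)
        exact Continuous.aestronglyMeasurable (by fun_prop)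
      · exact (ContinuousLinearMap.le_opNorm _ _).trans
          (mul_le_mul_of_nonneg_right (hC' _) (norm_nonneg _))
    · exact fun m _ => ((hdens m).1.mul_bdd (c := C) hψ.continuous.aestronglyMeasurable
        (Eventually.of_forall hC)).const_mul _

end GradientMeasures

/-! ### The gradient of the source term -/

section DuhamelGradient

variable {d : ℕ} {T : EReal} {μ : ℝ → Measure (Sp d)} {γ : ℝ → Sp d → ℝ}
  {μ1 : ℝ → Measure (Sp d)} {γ1 : ℝ → Sp d → Sp d} {F : ℝ → Sp d → ℝ}

theorem integrableOn_duhamel_gradient {C : ℝ}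
    (hC : ∀ s x, |F s x| ≤ C) {t : ℝ} {x : Sp d}
    (hγ1 : ∀ s ∈ Ioc 0 t, Integrable (γ1 s) (μ1 s))
    (hint : IntegrableOn (fun s => ∫ y, ‖γ1 s y‖ ∂μ1 s) (Ioc 0 t))
    (hmeas : AEStronglyMeasurable (fun s => ∫ y, F (t - s) (x - y) • γ1 s y ∂μ1 s)
      (volume.restrict (Ioc 0 t))) :
    IntegrableOn (fun s => ∫ y, F (t - s) (x - y) • γ1 s y ∂μ1 s) (Ioc 0 t) := by
  refine Integrable.mono' (hint.const_mul C) hmeas ?_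
  filter_upwards [ae_restrict_mem measurableSet_Ioc] with s hs
  exact norm_integral_convolution_smul_le (hγ1 s hs) (hC _) x

/-- Differentiation under the time integral. The derivatives are dominated by C times the total mass
of |γ¹(s)| μ¹(s), which is integrable in s on (0, t]. -/
theorem ContFamily.duhamel_hasGradientAt (h : ContFamily (timeSet T) μ γ)
    (hF : Continuous fun q : ℝ × Sp d => F q.1 q.2) {C : ℝ} (hC : ∀ s x, |F s x| ≤ C)
    {t : ℝ} (ht : t ∈ timeSet T)
    (hγ1 : ∀ s ∈ Ioc 0 t, HasMeasureGradient (μ s) (γ s) (μ1 s) (γ1 s))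
    (hint : IntegrableOn (fun s => ∫ y, ‖γ1 s y‖ ∂μ1 s) (Ioc 0 t)) (x : Sp d)
    (hmeas : AEStronglyMeasurable (fun s => ∫ y, F (t - s) (x - y) • γ1 s y ∂μ1 s)
      (volume.restrict (Ioc 0 t))) :
    HasGradientAt (duhamel μ γ F t) (∫ s in Ioc 0 t, ∫ y, F (t - s) (x - y) • γ1 s y ∂μ1 s) x := by
  obtain ⟨M, hM⟩ := h.tv t ht
  have hC0 : 0 ≤ C := (abs_nonneg _).trans (hC 0 0)
  have hgi := integrableOn_duhamel_gradient (x := x) hC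
    (fun s hs => (hγ1 s hs).integrable_gradient) hint hmeas
  let D : Sp d → StrongDual ℝ (Sp d) := InnerProductSpace.toDual ℝ (Sp d)
  have hD : Continuous D := (InnerProductSpace.toDual ℝ (Sp d)).continuous
  have hDn : ∀ v, ‖D v‖ = ‖v‖ := fun v => (InnerProductSpace.toDual ℝ (Sp d)).norm_map v
  have hDm := hD.comp_aestronglyMeasurable hmeas
  have hDi : Integrable (fun s => D (∫ y, F (t - s) (x - y) • γ1 s y ∂μ1 s))
      (volume.restrict (Ioc 0 t)) :=
    Integrable.mono hgi hDm (Eventually.of_forall fun s => (hDn _).le)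
  -- The identification of vectors with functionals is taken through the integral by evaluating at
  -- each v.
  have hcomm : D (∫ s in Ioc 0 t, ∫ y, F (t - s) (x - y) • γ1 s y ∂μ1 s)
      = ∫ s in Ioc 0 t, D (∫ y, F (t - s) (x - y) • γ1 s y ∂μ1 s) := by
    ext v
    rw [ContinuousLinearMap.integral_apply hDi]
    simp only [D, InnerProductSpace.toDual_apply_apply]
    rw [real_inner_comm, ← integral_inner hgi]
    simp only [real_inner_comm]
  rw [hasGradientAt_iff_hasFDerivAt]
  change HasFDerivAt _ (D _) x
  rw [hcomm]
  refine hasFDerivAt_integral_of_dominated_of_fderiv_le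
    (F' := fun x s => D (∫ y, F (t - s) (x - y) • γ1 s y ∂μ1 s))
    (bound := fun s => C * ∫ y, ‖γ1 s y‖ ∂μ1 s) univ_mem
    (Eventually.of_forall fun z => h.aestronglyMeasurable_convolution hF hC t z ht)
    ?_ hDm ?_ (hint.const_mul C) ?_
  · refine Integrable.of_bound (h.aestronglyMeasurable_convolution hF hC t x ht) (M * C) ?_
    filter_upwards [ae_restrict_mem measurableSet_Ioc] with s hs
    have hs' : s ∈ Icc 0 t := ⟨hs.1.le, hs.2⟩
    exact (h.abs_convolution_le hC (timeSet_mono ht hs') t x).trans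
      (mul_le_mul_of_nonneg_right (hM s hs') hC0)
  · filter_upwards [ae_restrict_mem measurableSet_Ioc] with s hs z _
    rw [hDn]
    exact norm_integral_convolution_smul_le (hγ1 s hs).integrable_gradient (hC _) z
  · filter_upwards [ae_restrict_mem measurableSet_Ioc] with s hs z _
    exact (hγ1 s hs).hasGradientAt (BoundedContinuousFunction.ofNormedAddCommGroup (F (t - s))
      (hF.comp (by fun_prop : Continuous fun x : Sp d => (t - s, x))) C (hC _)) z

end DuhamelGradient

/-! ### The probabilistic representation -/

section Probability

variable {d N : ℕ} {Ω : Type*} [mΩ : MeasurableSpace Ω] {P : Measure Ω}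
  {T : EReal} {p : Fin N → ℝ} {μ1 : Fin N → ℝ → Measure (Sp d)} {ρ : ℝ → ℝ} {τ : Ω → ℝ}
  {I : Ω → Fin N} {Z : Fin N → ℝ → Ω → Sp d} {V : Type*} [NormedAddCommGroup V] [NormedSpace ℝ V]

/-- Positivity of ρ is available only on the open half-line; the origin is a null set. -/
theorem DisplacementModel.law_tau_eq (h : DisplacementModel P T p μ1 ρ τ I Z) :
    P.map τ = (volume.restrict (Ioi 0)).withDensity fun t => ENNReal.ofReal (ρ t) := by
  rw [h.law_tau, restrict_Ioi_eq_restrict_Ici]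

theorem DisplacementModel.aemeasurable_density (h : DisplacementModel P T p μ1 ρ τ I Z) :
    AEMeasurable (fun t => ENNReal.ofReal (ρ t)) (volume.restrict (Ioi 0)) :=
  ((h.density_continuous.mono Ioi_subset_Ici_self).aemeasurable measurableSet_Ioi).ennreal_ofReal

theorem DisplacementModel.integral_law_tau (h : DisplacementModel P T p μ1 ρ τ I Z) (φ : ℝ → V) :
    ∫ s, φ s ∂P.map τ = ∫ s in Ioi 0, ρ s • φ s := by
  rw [h.law_tau_eq, integral_withDensity_eq_integral_toReal_smul₀ h.aemeasurable_density
    (Eventually.of_forall fun _ => ENNReal.ofReal_lt_top)]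
  refine setIntegral_congr_fun measurableSet_Ioi fun s hs => ?_
  simp only [ENNReal.toReal_ofReal (h.density_pos s hs).le]

theorem DisplacementModel.integrable_law_tau_iff (h : DisplacementModel P T p μ1 ρ τ I Z)
    {φ : ℝ → V} :
    Integrable φ (P.map τ) ↔ IntegrableOn (fun s => ρ s • φ s) (Ioi 0) := by
  rw [h.law_tau_eq, integrable_withDensity_iff_integrable_smul₀' h.aemeasurable_density
    (Eventually.of_forall fun _ => ENNReal.ofReal_lt_top)]
  refine integrableOn_congr_fun (fun s hs => ?_) measurableSet_Ioi
  simp only [ENNReal.toReal_ofReal (h.density_pos s hs).le]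

theorem DisplacementModel.integrableOn_density [IsProbabilityMeasure P]
    (h : DisplacementModel P T p μ1 ρ τ I Z) :
    IntegrableOn ρ (Ioi 0) := by
  have : IsProbabilityMeasure (P.map τ) := Measure.isProbabilityMeasure_map h.measurable_tau.aemeasurable
  simpa using h.integrable_law_tau_iff.1 (integrable_const (1 : ℝ))

theorem DisplacementModel.measureReal_tau_ge [IsProbabilityMeasure P]
    (h : DisplacementModel P T p μ1 ρ τ I Z) {t : ℝ}
    (ht : 0 < t) : P.real {ω | t ≤ τ ω} = ∫ s in Ioi t, ρ s := by
  have h1 : P.real {ω | t ≤ τ ω} = (P.map τ).real (Ici t) :=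
    (map_measureReal_apply h.measurable_tau measurableSet_Ici).symm
  rw [h1, ← integral_indicator_one measurableSet_Ici, h.integral_law_tau]
  have h2 : ∀ s, ρ s • (Ici t).indicator (1 : ℝ → ℝ) s = (Ici t).indicator ρ s := fun s => by
    by_cases hs : s ∈ Ici t <;> simp [hs]
  simp only [h2]
  rw [setIntegral_indicator measurableSet_Ici,
    inter_eq_right.2 (Ici_subset_Ioi.2 ht),
    integral_Ici_eq_integral_Ioi]

theorem DisplacementModel.tail_pos [IsProbabilityMeasure P]
    (h : DisplacementModel P T p μ1 ρ τ I Z) {t : ℝ}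
    (ht : 0 < t) : 0 < ∫ s in Ioi t, ρ s := by
  have hsub : Ioi t ⊆ Ioi 0 := Ioi_subset_Ioi ht.le
  rw [setIntegral_pos_iff_support_of_nonneg_ae]
  · have : Ioi t ⊆ Function.support ρ ∩ Ioi t := fun s hs => ⟨(h.density_pos s (hsub hs)).ne', hs⟩
    refine lt_of_lt_of_le ?_ (measure_mono this)
    simp
  · filter_upwards [ae_restrict_mem measurableSet_Ioi] with s hs using (h.density_pos s (hsub hs)).le
  · exact h.integrableOn_density.mono_set hsub

theorem DisplacementModel.measurable_Z (h : DisplacementModel P T p μ1 ρ τ I Z) (n : Fin N) :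
    Measurable fun q : ℝ × Ω => Z n q.1 q.2 := by
  obtain ⟨𝒢, hle, hm, -⟩ := h.field
  exact (hm n).mono (sup_le_sup le_rfl (MeasurableSpace.comap_mono hle)) le_rfl

theorem DisplacementModel.measurable_Z_apply (h : DisplacementModel P T p μ1 ρ τ I Z) (n : Fin N)
    (t : ℝ) : Measurable (Z n t) :=
  (h.measurable_Z n).comp measurable_prodMk_left

theorem DisplacementModel.integral_law_Z (h : DisplacementModel P T p μ1 ρ τ I Z) (n : Fin N)
    {t : ℝ} (ht : t ∈ openTimeSet T) {φ : Sp d → V} (hφ : StronglyMeasurable φ) :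
    ∫ y, φ y ∂μ1 n t = ∫ ω, φ (Z n t ω) ∂P := by
  rw [← h.law_Z n t ht, integral_map (h.measurable_Z_apply n t).aemeasurable
    hφ.aestronglyMeasurable]

theorem DisplacementModel.integrable_comp_Z_iff (h : DisplacementModel P T p μ1 ρ τ I Z)
    (n : Fin N) {t : ℝ} (ht : t ∈ openTimeSet T) {W : Type*} [NormedAddCommGroup W]
    {φ : Sp d → W} (hφ : StronglyMeasurable φ) :
    Integrable (fun ω => φ (Z n t ω)) P ↔ Integrable φ (μ1 n t) := by
  rw [← h.law_Z n t ht, integrable_map_measure hφ.aestronglyMeasurable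
    (h.measurable_Z_apply n t).aemeasurable]
  rfl

theorem DisplacementModel.measurable_pair (h : DisplacementModel P T p μ1 ρ τ I Z) :
    Measurable fun ω => (τ ω, I ω) := h.measurable_tau.prodMk h.measurable_I

theorem DisplacementModel.indep_Z (h : DisplacementModel P T p μ1 ρ τ I Z) (n : Fin N) (t : ℝ) :
    Indep (MeasurableSpace.comap (fun ω => (τ ω, I ω)) inferInstance)
      (MeasurableSpace.comap (Z n t) inferInstance) P := by
  obtain ⟨𝒢, hle, hm, hind⟩ := h.field
  refine (indep_of_indep_of_le_left hind ?_).symm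
  have h1 : Measurable[𝒢] (Z n t) := by
    let _ := 𝒢
    exact (hm n).comp measurable_prodMk_left
  exact h1.comap_le

theorem DisplacementModel.setIntegral_terminal [IsProbabilityMeasure P]
    (h : DisplacementModel P T p μ1 ρ τ I Z) (n : Fin N)
    {t : ℝ} (hp : 0 ≤ p n) (ht : t ∈ openTimeSet T) {φ : Sp d → V} (hφ : StronglyMeasurable φ) :
    ∫ ω in {ω | t ≤ τ ω} ∩ I ⁻¹' {n}, φ (Z n t ω) ∂P
      = ((∫ s in Ioi t, ρ s) * p n) • ∫ y, φ y ∂μ1 n t := by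
  have hA : MeasurableSet[MeasurableSpace.comap (fun ω => (τ ω, I ω)) inferInstance]
      ({ω | t ≤ τ ω} ∩ I ⁻¹' {n}) :=
    ⟨Ici t ×ˢ {n}, measurableSet_Ici.prod (measurableSet_singleton n), rfl⟩
  rw [(h.indep_Z n t).setIntegral_eq_smul h.measurable_pair.comap_le
    (h.measurable_Z_apply n t).aemeasurable hA hφ.aestronglyMeasurable, ← h.integral_law_Z n ht hφ]
  congr 1
  have h1 : P ({ω | t ≤ τ ω} ∩ I ⁻¹' {n}) = P {ω | t ≤ τ ω} * P (I ⁻¹' {n}) :=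
    h.indep_tau_I.measure_inter_preimage_eq_mul (Ici t) {n} measurableSet_Ici
      (measurableSet_singleton n)
  rw [measureReal_def, h1, ENNReal.toReal_mul, ← measureReal_def, h.measureReal_tau_ge ht.1,
    h.law_I, ENNReal.toReal_ofReal hp]

/-- The joint law is the product law, so this is Fubini. The target E carries an arbitrary
σ-algebra, which below is a coarser one on Ω itself. -/
theorem IndepFun.integral_comp_pair [IsProbabilityMeasure P] {E : Type*} {mE : MeasurableSpace E}
    {X : Ω → E} (hτ : Measurable τ) (hX : Measurable X) (hind : IndepFun τ X P) {K : ℝ × E → V}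
    (hK : StronglyMeasurable K) (hi : ∀ᵐ s ∂P.map τ, Integrable (fun ω => K (s, X ω)) P)
    (hn : Integrable (fun s => ∫ ω, ‖K (s, X ω)‖ ∂P) (P.map τ)) :
    Integrable (fun ω => K (τ ω, X ω)) P ∧
      ∫ ω, K (τ ω, X ω) ∂P = ∫ s, ∫ ω, K (s, X ω) ∂P ∂P.map τ := by
  have : IsProbabilityMeasure (P.map τ) := Measure.isProbabilityMeasure_map hτ.aemeasurable
  have : IsProbabilityMeasure (P.map X) := Measure.isProbabilityMeasure_map hX.aemeasurable
  have hlaw := (indepFun_iff_map_prod_eq_prod_map_map hτ.aemeasurable hX.aemeasurable).1 hind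
  have hsec : ∀ s, StronglyMeasurable fun e => K (s, e) := fun s =>
    hK.comp_measurable measurable_prodMk_left
  have hint : ∀ s, ∫ e, K (s, e) ∂P.map X = ∫ ω, K (s, X ω) ∂P := fun s =>
    integral_map hX.aemeasurable (hsec s).aestronglyMeasurable
  have hint' : ∀ s, ∫ e, ‖K (s, e)‖ ∂P.map X = ∫ ω, ‖K (s, X ω)‖ ∂P := fun s =>
    integral_map hX.aemeasurable (hsec s).norm.aestronglyMeasurable
  have hKi : Integrable K ((P.map τ).prod (P.map X)) := by
    rw [integrable_prod_iff hK.aestronglyMeasurable]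
    simp only [hint']
    refine ⟨hi.mono fun s hs => ?_, hn⟩
    exact (integrable_map_measure (hsec s).aestronglyMeasurable hX.aemeasurable).2 hs
  refine ⟨?_, ?_⟩
  · rw [← hlaw] at hKi
    exact (integrable_map_measure hK.aestronglyMeasurable (hτ.prodMk hX).aemeasurable).1 hKi
  · rw [← integral_map (φ := fun ω => (τ ω, X ω)) (hτ.prodMk hX).aemeasurable
      hK.aestronglyMeasurable, hlaw, integral_prod _ hKi]
    simp only [hint]

/-- A function of the displacement field evaluated at the independent time `τ`. -/
theorem DisplacementModel.integral_at_tau [IsProbabilityMeasure P]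
    (h : DisplacementModel P T p μ1 ρ τ I Z)
    (n : Fin N) {H : ℝ → Sp d → V} (hH : StronglyMeasurable fun q : ℝ × Sp d => H q.1 q.2)
    (hi : ∀ s, 0 < s → Integrable (fun ω => H s (Z n s ω)) P)
    (hn : IntegrableOn (fun s => ρ s * ∫ ω, ‖H s (Z n s ω)‖ ∂P) (Ioi 0)) :
    Integrable (fun ω => H (τ ω) (Z n (τ ω) ω)) P ∧
    ∫ ω, H (τ ω) (Z n (τ ω) ω) ∂P = ∫ s in Ioi 0, ρ s • ∫ ω, H s (Z n s ω) ∂P := by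
  have hpos : ∀ᵐ s ∂P.map τ, 0 < s := by
    rw [h.law_tau_eq]
    exact (withDensity_absolutelyContinuous _ _).ae_le (ae_restrict_mem measurableSet_Ioi)
  have hτm := h.measurable_tau
  have hn' := h.integrable_law_tau_iff.2 hn
  rw [← h.integral_law_tau]
  obtain ⟨𝒢, hle, hm, hind⟩ := h.field
  -- The whole field is encoded in one random element, the identity from Ω to (Ω, 𝒢). It is
  -- independent of τ, and (s, ω) ↦ H(s, Z_s(ω)) is jointly measurable over 𝒢, so τ can be frozen at
  -- s.
  have hid : @Measurable Ω Ω mΩ 𝒢 id := measurable_id'' hle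
  have hτ : @IndepFun Ω ℝ Ω mΩ inferInstance 𝒢 τ id P := by
    rw [IndepFun_iff_Indep, MeasurableSpace.comap_id]
    refine (indep_of_indep_of_le_right hind ?_).symm
    exact (measurable_fst.comp (comap_measurable (fun ω => (τ ω, I ω)))).comap_le
  have hg : Measurable[(inferInstance : MeasurableSpace ℝ).prod 𝒢]
      fun q : ℝ × Ω => (q.1, Z n q.1 q.2) :=
    @Measurable.prodMk _ _ _ _ _ _ _ _
      (@measurable_fst _ _ _ 𝒢) (hm n)
  have hK : StronglyMeasurable[(inferInstance : MeasurableSpace ℝ).prod 𝒢]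
      fun q : ℝ × Ω => H q.1 (Z n q.1 q.2) := hH.comp_measurable hg
  exact IndepFun.integral_comp_pair (mΩ := mΩ) (mE := 𝒢) hτm hid hτ hK (hpos.mono hi) hn'

end Probability

/-! ### The gradient as an expectation -/

section Representation

variable {d N : ℕ} {Ω : Type*} [MeasurableSpace Ω] {P : Measure Ω}
  {T : EReal} {p : Fin N → ℝ} {μ1 : Fin N → ℝ → Measure (Sp d)} {ρ : ℝ → ℝ} {τ : Ω → ℝ}
  {I : Ω → Fin N} {Z : Fin N → ℝ → Ω → Sp d} {γ1 : Fin N → ℝ → Sp d → Sp d} {F : ℝ → Sp d → ℝ}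
  {f : Fin N → Sp d →ᵇ ℝ}

theorem Ioc_subset_openTimeSet {t s : ℝ} (ht : t ∈ openTimeSet T) (hs : s ∈ Ioc 0 t) :
    s ∈ openTimeSet T :=
  ⟨hs.1, (EReal.coe_le_coe_iff.2 hs.2).trans_lt ht.2⟩

/-- Measurability of s ↦ μ¹(s) is not among the assumptions. It is supplied by the random field: the
inner integral is an expectation over Z_s, and the field is jointly measurable. -/
theorem DisplacementModel.aestronglyMeasurable_duhamel_gradient [IsProbabilityMeasure P]
    (h : DisplacementModel P T p μ1 ρ τ I Z) (n : Fin N)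
    (hγ1 : Measurable fun q : ℝ × Sp d => γ1 n q.1 q.2)
    (hF : Continuous fun q : ℝ × Sp d => F q.1 q.2) {t : ℝ} (ht : t ∈ openTimeSet T) (x : Sp d) :
    AEStronglyMeasurable (fun s => ∫ y, F (t - s) (x - y) • γ1 n s y ∂μ1 n s)
      (volume.restrict (Ioc 0 t)) := by
  have hH : StronglyMeasurable fun q : ℝ × Sp d => F (t - q.1) (x - q.2) • γ1 n q.1 q.2 :=
    (hF.comp (by fun_prop : Continuous fun q : ℝ × Sp d =>
      (t - q.1, x - q.2))).stronglyMeasurable.smul hγ1.stronglyMeasurable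
  have h1 : StronglyMeasurable fun q : ℝ × Ω =>
      F (t - q.1) (x - Z n q.1 q.2) • γ1 n q.1 (Z n q.1 q.2) :=
    hH.comp_measurable (measurable_fst.prodMk (h.measurable_Z n))
  refine (h1.integral_prod_right' (ν := P)).aestronglyMeasurable.congr ?_
  filter_upwards [ae_restrict_mem measurableSet_Ioc] with s hs
  exact (h.integral_law_Z n (Ioc_subset_openTimeSet ht hs)
    (hH.comp_measurable measurable_prodMk_left)).symm

/-- Splitting according to I, the event {τ ≥ t, I = n} has probability ρ̄(t) p_n and is independent
of Z^n_t, so division by ρ̄(t) leaves p_n. Where f_n = 0 the term vanishes without any integrability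
of γ¹_n. -/
theorem DisplacementModel.integral_terminal [IsProbabilityMeasure P]
    (h : DisplacementModel P T p μ1 ρ τ I Z) (hp : ∀ n, 0 ≤ p n) {t : ℝ} (ht : t ∈ openTimeSet T)
    (hγ1 : ∀ n, Measurable (γ1 n t)) (hi : ∀ n, f n ≠ 0 → Integrable (γ1 n t) (μ1 n t))
    (x : Sp d) :
    Integrable ({ω | t ≤ τ ω}.indicator fun ω => (f (I ω) (x - Z (I ω) t ω) / ∫ s in Ioi t, ρ s) •
      γ1 (I ω) t (Z (I ω) t ω)) P ∧
    ∫ ω, {ω | t ≤ τ ω}.indicator (fun ω => (f (I ω) (x - Z (I ω) t ω) / ∫ s in Ioi t, ρ s) •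
      γ1 (I ω) t (Z (I ω) t ω)) ω ∂P = ∑ n, p n • ∫ y, f n (x - y) • γ1 n t y ∂μ1 n t := by
  set c := ∫ s in Ioi t, ρ s with hc
  have hc0 : 0 < c := h.tail_pos ht.1
  let φ : Fin N → Sp d → Sp d := fun n y => (f n (x - y) / c) • γ1 n t y
  have hφ : ∀ n, StronglyMeasurable (φ n) := fun n => by
    have hfc : Continuous fun y => f n (x - y) / c := by fun_prop
    exact hfc.stronglyMeasurable.smul (hγ1 n).stronglyMeasurable
  have hφi : ∀ n, Integrable (φ n) (μ1 n t) := fun n => by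
    by_cases hn : f n = 0
    · have : φ n = 0 := by ext1 y; simp [φ, hn]
      rw [this]; exact integrable_zero _ _ _
    · have h1 := (integrable_convolution_smul (hi n hn) (f n).continuous
        (f n).norm_coe_le_norm x).smul c⁻¹
      refine h1.congr (Eventually.of_forall fun y => ?_)
      simp only [φ, Pi.smul_apply, smul_smul, div_eq_inv_mul]
  have hA : ∀ n, MeasurableSet ({ω | t ≤ τ ω} ∩ I ⁻¹' {n}) := fun n =>
    (measurableSet_le measurable_const h.measurable_tau).inter
      (h.measurable_I (measurableSet_singleton n))
  have hsum : ({ω | t ≤ τ ω}.indicator fun ω => (f (I ω) (x - Z (I ω) t ω) / c) •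
      γ1 (I ω) t (Z (I ω) t ω)) = fun ω => ∑ n, ({ω | t ≤ τ ω} ∩ I ⁻¹' {n}).indicator
        (fun ω => φ n (Z n t ω)) ω := by
    ext1 ω
    rw [Finset.sum_eq_single (I ω)]
    · by_cases hω : t ≤ τ ω <;> simp [indicator, hω, φ]
    · intro n _ hn
      exact indicator_of_notMem (fun hω => hn hω.2.symm) _
    · simp
  have hint : ∀ n, Integrable (({ω | t ≤ τ ω} ∩ I ⁻¹' {n}).indicator fun ω => φ n (Z n t ω)) P :=
    fun n => ((h.integrable_comp_Z_iff n ht (hφ n)).2 (hφi n)).indicator (hA n)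
  rw [hsum]
  refine ⟨integrable_finsetSum _ fun n _ => hint n, ?_⟩
  rw [integral_finsetSum _ fun n _ => hint n]
  refine Finset.sum_congr rfl fun n _ => ?_
  rw [integral_indicator (hA n), h.setIntegral_terminal n (hp n) ht (hφ n), ← hc]
  have : ∀ y, φ n y = c⁻¹ • f n (x - y) • γ1 n t y := fun y => by
    simp only [φ, smul_smul, div_eq_inv_mul]
  simp only [this]
  rw [integral_smul, smul_smul]
  congr 1
  field_simp

/-- The weight 1/ρ(τ) cancels the density of τ and leaves Lebesgue measure on (0, t). -/
theorem DisplacementModel.integral_source [IsProbabilityMeasure P]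
    (h : DisplacementModel P T p μ1 ρ τ I Z) (n : Fin N)
    (hγ1 : Measurable fun q : ℝ × Sp d => γ1 n q.1 q.2)
    (hF : Continuous fun q : ℝ × Sp d => F q.1 q.2) {C : ℝ} (hC : ∀ s x, |F s x| ≤ C)
    {t : ℝ} (ht : t ∈ openTimeSet T) (hi : ∀ s ∈ Ioc 0 t, Integrable (γ1 n s) (μ1 n s))
    (hint : IntegrableOn (fun s => ∫ y, ‖γ1 n s y‖ ∂μ1 n s) (Ioc 0 t)) (x : Sp d) :
    Integrable ({ω | τ ω < t}.indicator fun ω => (F (t - τ ω) (x - Z n (τ ω) ω) / ρ (τ ω)) •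
      γ1 n (τ ω) (Z n (τ ω) ω)) P ∧
    ∫ ω, {ω | τ ω < t}.indicator (fun ω => (F (t - τ ω) (x - Z n (τ ω) ω) / ρ (τ ω)) •
      γ1 n (τ ω) (Z n (τ ω) ω)) ω ∂P
      = ∫ s in Ioc 0 t, ∫ y, F (t - s) (x - y) • γ1 n s y ∂μ1 n s := by
  -- The open interval avoids s = 0, where ρ may vanish; since τ > 0 almost surely, nothing is lost.
  let r : ℝ → ℝ := (Ioo 0 t).indicator fun s => (ρ s)⁻¹
  have hr : Measurable r := by
    classical
    have hρ : ContinuousOn (fun s => (ρ s)⁻¹) (Ioo 0 t) :=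
      (h.density_continuous.mono fun s hs => hs.1.le).inv₀ fun s hs => (h.density_pos s hs.1).ne'
    simp only [r]
    rw [← piecewise_eq_indicator]
    exact hρ.measurable_piecewise continuousOn_const measurableSet_Ioo
  have hr0 : ∀ s ∉ Ioo 0 t, r s = 0 := fun s hs => indicator_of_notMem hs _
  have hρr : ∀ s ∈ Ioo 0 t, ρ s * r s = 1 := fun s hs => by
    simp only [r, indicator_of_mem hs, mul_inv_cancel₀ (h.density_pos s hs.1).ne']
  have hr_nonneg : ∀ s, 0 ≤ r s := indicator_nonneg fun s hs => (inv_pos.2 (h.density_pos s hs.1)).le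
  let K : ℝ → Sp d → Sp d := fun s y => F (t - s) (x - y) • γ1 n s y
  let H : ℝ → Sp d → Sp d := fun s y => r s • K s y
  have hK : StronglyMeasurable fun q : ℝ × Sp d => K q.1 q.2 :=
    (hF.comp (by fun_prop : Continuous fun q : ℝ × Sp d =>
      (t - q.1, x - q.2))).stronglyMeasurable.smul hγ1.stronglyMeasurable
  have hH : StronglyMeasurable fun q : ℝ × Sp d => H q.1 q.2 :=
    (hr.comp measurable_fst).stronglyMeasurable.smul hK
  have hKs : ∀ s, StronglyMeasurable (K s) := fun s => hK.comp_measurable measurable_prodMk_left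
  have hmem : ∀ s ∈ Ioo 0 t, s ∈ openTimeSet T := fun s hs =>
    Ioc_subset_openTimeSet ht ⟨hs.1, hs.2.le⟩
  have hKi : ∀ s ∈ Ioo 0 t, Integrable (K s) (μ1 n s) := fun s hs =>
    integrable_convolution_smul (hi s ⟨hs.1, hs.2.le⟩) (hF.comp (by fun_prop :
      Continuous fun x : Sp d => (t - s, x))) (hC _) x
  have hHi : ∀ s, 0 < s → Integrable (fun ω => H s (Z n s ω)) P := fun s hs => by
    by_cases hst : s < t
    · exact ((h.integrable_comp_Z_iff n (hmem s ⟨hs, hst⟩) (hKs s)).2 (hKi s ⟨hs, hst⟩)).smul (r s)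
    · simp only [H, hr0 s fun h => hst h.2, zero_smul]
      exact integrable_zero _ _ _
  have hbound : IntegrableOn (fun s => ρ s * ∫ ω, ‖H s (Z n s ω)‖ ∂P) (Ioi 0) := by
    have hb : Integrable ((Ioc 0 t).indicator fun s => C * ∫ y, ‖γ1 n s y‖ ∂μ1 n s)
        (volume.restrict (Ioi 0)) :=
      ((integrable_indicator_iff measurableSet_Ioc).2 (hint.const_mul C)).restrict
    have hm1 : StronglyMeasurable fun s => ∫ ω, ‖H s (Z n s ω)‖ ∂P := by
      have h1 : StronglyMeasurable fun q : ℝ × Ω => ‖H q.1 (Z n q.1 q.2)‖ :=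
        (hH.comp_measurable (measurable_fst.prodMk (h.measurable_Z n))).norm
      exact h1.integral_prod_right'
    refine hb.mono' (h.integrableOn_density.1.mul hm1.aestronglyMeasurable) ?_
    filter_upwards [ae_restrict_mem measurableSet_Ioi] with s hs
    by_cases hst : s < t
    · have hs' : s ∈ Ioo 0 t := ⟨hs, hst⟩
      rw [indicator_of_mem (show s ∈ Ioc 0 t from ⟨hs, hst.le⟩)]
      simp only [H, norm_smul]
      rw [integral_const_mul, ← mul_assoc, Real.norm_of_nonneg (hr_nonneg s), hρr s hs', one_mul,
        ← h.integral_law_Z n (hmem s hs') (φ := fun y => ‖K s y‖) (hKs s).norm,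
        Real.norm_of_nonneg (integral_nonneg fun _ => norm_nonneg _), ← integral_const_mul]
      refine integral_mono (hKi s hs').norm ((hi s ⟨hs, hst.le⟩).norm.const_mul C) fun y => ?_
      simp only [K, norm_smul]
      exact mul_le_mul_of_nonneg_right (hC _ _) (norm_nonneg _)
    · simp only [H, hr0 s fun h => hst h.2, zero_smul, norm_zero, integral_zero, mul_zero]
      refine indicator_nonneg (fun s _ => mul_nonneg ((abs_nonneg _).trans (hC 0 0)) ?_) s
      exact integral_nonneg fun _ => norm_nonneg _
  obtain ⟨h1, h2⟩ := h.integral_at_tau n hH hHi hbound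
  have hpos : ∀ᵐ ω ∂P, 0 < τ ω := by
    refine ae_of_ae_map h.measurable_tau.aemeasurable (p := fun s => 0 < s) ?_
    rw [h.law_tau_eq]
    exact (withDensity_absolutelyContinuous _ _).ae_le (ae_restrict_mem measurableSet_Ioi)
  have hae : (fun ω => H (τ ω) (Z n (τ ω) ω)) =ᵐ[P] {ω | τ ω < t}.indicator fun ω =>
      (F (t - τ ω) (x - Z n (τ ω) ω) / ρ (τ ω)) • γ1 n (τ ω) (Z n (τ ω) ω) := by
    filter_upwards [hpos] with ω hω
    by_cases hωt : τ ω < t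
    · rw [indicator_of_mem (show ω ∈ {ω | τ ω < t} from hωt)]
      simp only [H, K, r, indicator_of_mem (show τ ω ∈ Ioo 0 t from ⟨hω, hωt⟩), smul_smul, div_eq_inv_mul]
    · rw [indicator_of_notMem (show ω ∉ {ω | τ ω < t} from hωt)]
      simp only [H, hr0 _ fun h => hωt h.2, zero_smul]
  refine ⟨h1.congr hae, ?_⟩
  rw [← integral_congr_ae hae, h2, integral_Ioc_eq_integral_Ioo]
  have h3 : ∀ s ∈ Ioi (0 : ℝ), ρ s • ∫ ω, H s (Z n s ω) ∂P
      = (Ioo 0 t).indicator (fun s => ∫ y, K s y ∂μ1 n s) s := fun s hs => by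
    by_cases hst : s < t
    · have hs' : s ∈ Ioo 0 t := ⟨hs, hst⟩
      rw [indicator_of_mem hs']
      simp only [H]
      rw [integral_smul, smul_smul, hρr s hs', one_smul, h.integral_law_Z n (hmem s hs') (hKs s)]
    · rw [indicator_of_notMem fun h => hst h.2]
      simp only [H, hr0 s fun h => hst h.2, zero_smul, integral_zero, smul_zero]
  rw [setIntegral_congr_fun measurableSet_Ioi h3, setIntegral_indicator measurableSet_Ioo,
    inter_eq_right.2 Ioo_subset_Ioi_self]

variable {a : ℕ → ℝ} {b : MvPolynomial (Fin d) ℝ} {g : Fin N → ℝ → 𝓢'(Sp d, ℂ)}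
  {ν : Fin N → ℝ → SignedMeasure (Sp d)} {μ : Fin N → ℝ → Measure (Sp d)}
  {γ : Fin N → ℝ → Sp d → ℝ}

theorem GradientMeasures.hasGradientAt_greenSolution [NeZero N]
    (h1 : GradientMeasures T f g μ1 γ1)
    (h : GreenMeasures T g ν μ γ) [IsProbabilityMeasure P]
    (hZ : DisplacementModel P T p μ1 ρ τ I Z) (hp : ∀ n, 0 ≤ p n)
    (hF : Continuous fun q : ℝ × Sp d => F q.1 q.2) {C : ℝ} (hC : ∀ s x, |F s x| ≤ C)
    {t : ℝ} (ht : t ∈ openTimeSet T) (x : Sp d) :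
    Integrable (gradientWeight f F γ1 ρ τ I Z t x) P ∧
    HasGradientAt (greenSolution p f F μ γ t) (∫ ω, gradientWeight f F γ1 ρ τ I Z t x ω ∂P) x := by
  have hγ1 : ∀ n, Measurable (γ1 n t) := fun n => (h1.measurable n).comp measurable_prodMk_left
  have hgrad : ∀ s ∈ Ioc 0 t, HasMeasureGradient (μ ⊤ s) (γ ⊤ s) (μ1 ⊤ s) (γ1 ⊤ s) := fun s hs =>
    h1.hasMeasureGradient h (Or.inl rfl) (Ioc_subset_openTimeSet ht hs)
  obtain ⟨hi1, he1⟩ := hZ.integral_terminal hp ht hγ1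
    (fun n hn => (h1.hasMeasureGradient h (Or.inr hn) ht).integrable_gradient) x
  obtain ⟨hi2, he2⟩ := hZ.integral_source ⊤ (h1.measurable ⊤) hF hC ht
    (fun s hs => (hgrad s hs).integrable_gradient) (h1.time_integrable t ht) x
  refine ⟨hi1.add hi2, ?_⟩
  have he : ∫ ω, gradientWeight f F γ1 ρ τ I Z t x ω ∂P
      = (∑ n, p n • ∫ y, f n (x - y) • γ1 n t y ∂μ1 n t)
        + ∫ s in Ioc 0 t, ∫ y, F (t - s) (x - y) • γ1 ⊤ s y ∂μ1 ⊤ s := by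
    rw [← he1, ← he2, ← integral_add hi1 hi2]
    rfl
  rw [he]
  have hsum : HasFDerivAt (fun x => ∑ n, p n * ∫ y, γ n t y * f n (x - y) ∂μ n t)
      (∑ n, p n • InnerProductSpace.toDual ℝ (Sp d) (∫ y, f n (x - y) • γ1 n t y ∂μ1 n t)) x := by
    refine HasFDerivAt.fun_sum fun n _ => HasFDerivAt.const_mul ?_ _
    -- For a zero datum no gradient of g_n is available, but the function and its claimed derivative
    -- are both zero.
    by_cases hn : f n = 0
    · simpa [hn] using hasFDerivAt_const (0 : ℝ) x
    · exact (h1.hasMeasureGradient h (Or.inr hn) ht).hasGradientAt (f n) x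
  have hduh := (h.contFamily ⊤).duhamel_hasGradientAt hF hC ⟨ht.1.le, ht.2⟩ hgrad
    (h1.time_integrable t ht) x (hZ.aestronglyMeasurable_duhamel_gradient ⊤ (h1.measurable ⊤) hF ht x)
  rw [hasGradientAt_iff_hasFDerivAt, map_add, map_sum]
  simp only [map_smulₛₗ, conj_trivial]
  exact hsum.add hduh.hasFDerivAt

/-- It permits replacing F by an extension that is continuous at all real times. -/
theorem IsSolution.congr_source {F' : ℝ → Sp d → ℝ} {u : ℝ → Sp d → ℝ}
    (hu : IsSolution a b p f F T u) (hF : ∀ t, 0 ≤ t → F' t = F t) :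
    IsSolution a b p f F' T u where
  continuousOn := hu.continuousOn
  bounded := hu.bounded
  smooth := hu.smooth
  equation := fun φ t ht => by rw [hF t ht.1]; exact hu.equation φ t ht
  initial := hu.initial

end Representation

end LinearCauchy

/-! ### Assembly of existence, uniqueness and the gradient formula -/

theorem mainTheorem6 {d N : ℕ} [NeZero N] (a : ℕ → ℝ) (b : MvPolynomial (Fin d) ℝ)
    (ha : a N = 1) (hb : 1 ≤ b.totalDegree)
    (p : Fin N → ℝ) (hp : ∀ n, 0 < p n) (hp_sum : ∑ n, p n = 1)
    (f : Fin N → LinearCauchy.Sp d →ᵇ ℝ) (F : ℝ → LinearCauchy.Sp d → ℝ)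
    (hF : ContinuousOn (fun q : ℝ × LinearCauchy.Sp d => F q.1 q.2) (Set.Ici 0 ×ˢ Set.univ))
    (hF_bdd : ∃ C : ℝ, ∀ t, 0 ≤ t → ∀ x, |F t x| ≤ C)
    (T : EReal) (hT : 0 < T)
    (g : Fin N → ℝ → 𝓢'(LinearCauchy.Sp d, ℂ))
    (hg : ∀ n, ∀ t ∈ LinearCauchy.timeSet T, LinearCauchy.IsGreen a b n t (g n t))
    (ν : Fin N → ℝ → SignedMeasure (LinearCauchy.Sp d))
    (μ : Fin N → ℝ → Measure (LinearCauchy.Sp d))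
    (γ : Fin N → ℝ → LinearCauchy.Sp d → ℝ)
    (hgm : LinearCauchy.GreenMeasures T g ν μ γ)
    (μ1 : Fin N → ℝ → Measure (LinearCauchy.Sp d))
    (γ1 : Fin N → ℝ → LinearCauchy.Sp d → LinearCauchy.Sp d)
    (hgrad : LinearCauchy.GradientMeasures T f g μ1 γ1)
    {Ω : Type*} [MeasurableSpace Ω] (P : Measure Ω) [IsProbabilityMeasure P]
    (ρ : ℝ → ℝ) (τ : Ω → ℝ) (I : Ω → Fin N) (Z : Fin N → ℝ → Ω → LinearCauchy.Sp d)
    (hmodel : LinearCauchy.DisplacementModel P T p μ1 ρ τ I Z) :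
    ∃ u : ℝ → LinearCauchy.Sp d → ℝ,
      LinearCauchy.IsSolution a b p f F T u ∧
      (∀ v, LinearCauchy.IsSolution a b p f F T v →
        ∀ t ∈ LinearCauchy.timeSet T, ∀ x, v t x = u t x) ∧
      ∀ t ∈ LinearCauchy.openTimeSet T, ∀ x,
        Integrable (LinearCauchy.gradientWeight f F γ1 ρ τ I Z t x) P ∧
        HasGradientAt (u t) (∫ ω, LinearCauchy.gradientWeight f F γ1 ρ τ I Z t x ω ∂P) x := by
  obtain ⟨C, hC⟩ := hF_bdd
  -- The source is continued to negative times by its value at 0. The random vector is unaffected,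
  -- because F is evaluated at t - τ only on {τ < t}.
  let F' : ℝ → LinearCauchy.Sp d → ℝ := fun t => F (max t 0)
  have hF' : Continuous fun q : ℝ × LinearCauchy.Sp d => F' q.1 q.2 :=
    hF.comp_continuous (f := fun q : ℝ × LinearCauchy.Sp d => (max q.1 0, q.2)) (by fun_prop)
      fun q => ⟨Set.mem_Ici.2 (le_max_right _ _), Set.mem_univ _⟩
  have hC' : ∀ t x, |F' t x| ≤ C := fun t x => hC _ (le_max_right _ _) x
  have hFF' : ∀ t, 0 ≤ t → F t = F' t := fun t ht => by simp only [F', max_eq_left ht]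
  have hu := ((hgm.fourier_eq hg).isSolution hT ha p f hF' hC').congr_source hFF'
  refine ⟨_, hu, fun v hv t ht x => hu.unique hT ha hv ht x, fun t ht x => ?_⟩
  have hw : LinearCauchy.gradientWeight f F γ1 ρ τ I Z t x
      = LinearCauchy.gradientWeight f F' γ1 ρ τ I Z t x := by
    ext1 ω
    simp only [LinearCauchy.gradientWeight]
    congr 1
    by_cases hω : τ ω < t
    · simp only [Set.indicator, Set.mem_ofPred_eq, hω, if_true, hFF' _ (sub_nonneg.2 hω.le)]
    · simp only [Set.indicator, Set.mem_ofPred_eq, hω, if_false]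
  rw [hw]
  exact hgrad.hasGradientAt_greenSolution hgm hmodel (fun n => (hp n).le) hF' hC' ht x
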